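/- Let $q\ge 3$ be an integer, $\lambda=2\cos(\pi/q)$, and let $\Gamma\subseteq \mathrm{PSL}_2(\mathbb R)$ be the cofinite Hecke triangle group generated by $S=\begin{pmatrix}0&1\\-1&0\end{pmatrix}$ and $T=\begin{pmatrix}1&\lambda\\0&1\end{pmatrix}$. Let $\mathcal T=\frac1{\sqrt2}\begin{pmatrix}1&-1\\1&1\end{pmatrix}$, $\Lambda=\mathcal T\,\Gamma\,\mathcal T^{-1}$, and $h_k=\mathcal T\big((TS)^kS\big)^{-1}\mathcal T^{-1}$ for $1\le k\le q-1$. Let $\eta$ be a unitary representation of $\Lambda$ on a finite-dimensional complex inner product space $V$, and let $\mathrm{sd}(\eta)=\dim\ker\big(\eta(\mathcal T T\mathcal T^{-1})-1\big)$ be its degree of singularity. For $h\in\Lambda$ with $h^{-1}=\begin{pmatrix}a&b\\c&d\end{pmatrix}$ and $s\in\mathbb C$ put $\beta_s(h)f(z)=\big((cz+d)^{-2}\big)^{s}\,\eta(h)f(h^{-1}.z)$, where, for the elements $h$ used below, the power is the holomorphic continuation of the positive-base power on $(-1,1)$, i.e. it equals $(cz+d)^{-2s}$ with the principal branch when the sign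 of $(c,d)$ is normalized by $d>0$. Put $\mu=\frac{\lambda-1}{\lambda+1}$, $E_1=(\mu,1)$, $E_r=(-\mu,\mu)$, $E_{q-1}=(-1,-\mu)$. Call a triple of open bounded discs $\mathcal E_1,\mathcal E_r,\mathcal E_{q-1}\subseteq\mathbb C$ admissible if (a) $\overline{E_j}\subseteq\mathcal E_j$ for $j\in\{1,r,q-1\}$; (b) the reflection $z\mapsto-\overline z$ maps $\mathcal E_r$ onto itself and $\mathcal E_1$ onto $\mathcal E_{q-1}$; (c) $h_k^{-1}.\overline{\mathcal E_j}\subseteq\mathcal E_r$ for $2\le k\le q-2$ and $j\in\{1,r,q-1\}$; (d) $h_1^{-n}.\overline{\mathcal E_j}\subseteq\mathcal E_1$ for $n\ge1$ and $j\in\{r,q-1\}$; (e) $h_{q-1}^{-n}.\overline{\mathcal E_j}\subseteq\mathcal E_{q-1}$ for $n\ge1$ and $j\in\{1,r\}$; (f) $\operatorname{Re}z>-1$ on $\overline{\mathcal E_1}$, $\operatorname{Re}z<1$ on $\overline{\mathcal E_{q-1}}$, and $-1<\operatorname{Re}z<1$ on $\overline{\mathcal E_r}$. For a disc $\mathcal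 C$ let $B(\mathcal C;V)$ be the Banach space, with the supremum norm, of continuous functions $\overline{\mathcal C}\to V$ that are holomorphic on $\mathcal C$, and let $B(\mathcal E;V)=B(\mathcal E_1;V)\oplus B(\mathcal E_r;V)\oplus B(\mathcal E_{q-1};V)$. Then admissible triples exist, and for every admissible triple the following holds. (i) For $\operatorname{Re}s>\frac12$ all series in the fast transfer operator $$\widetilde{\mathcal L}_{s,\eta}=\begin{pmatrix}0&\sum_{k=2}^{q-2}\beta_s(h_k)&\sum_{n\ge1}\beta_s(h_{q-1}^n)\\ \sum_{n\ge1}\beta_s(h_1^n)&\sum_{k=2}^{q-2}\beta_s(h_k)&\sum_{n\ge1}\beta_s(h_{q-1}^n)\\ \sum_{n\ge1}\beta_s(h_1^n)&\sum_{k=2}^{q-2}\beta_s(h_k)&0\end{pmatrix}$$ converge pointwise on the closed discs, and $\widetilde{\mathcal L}_{s,\eta}$ is a bounded operator on $B(\mathcal E;V)$ which is nuclear of order $0$; that is, for every $p\in(0,1]$ it can be written as $\sum_n a_n\,\varphi_n(\cdot)\,e_n$ with functionals $\|\varphi_n\|\le1$, vectors $\|e_n\|\le1$ and $\sum_n|a_n|^p<\infty$.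 (ii) The map $s\mapsto\widetilde{\mathcal L}_{s,\eta}$ extends to a meromorphic function on $\mathbb C$ with values in the bounded operators on $B(\mathcal E;V)$. All its poles are simple and contained in $\{\frac{1-k}2: k\in\mathbb N_0\}$. Each pole $s_0$ has a neighborhood $U$ on which $$\widetilde{\mathcal L}_{s,\eta}=\frac1{s-s_0}\mathcal A_s+\mathcal B_s\qquad(s\in U\setminus\{s_0\})$$ with operator families $\mathcal A_s$, $\mathcal B_s$ that are holomorphic on $U$, where $\mathcal A_s$ has rank at most $4\,\mathrm{sd}(\eta)$ for all $s\in U$. -/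

import Mathlib

open scoped MatrixGroups

namespace HeckeTransfer

noncomputable section

/-! ### Hecke triangle groups -/

/-- The parameter `λ(q) = 2 cos (π / q)`. -/
def lam (q : ℕ) : ℝ := 2 * Real.cos (Real.pi / q)

/-- The matrix `S = [0, 1; -1, 0]`. -/
def matS : SL(2, ℝ) := ⟨!![0, 1; -1, 0], by simp [Matrix.det_fin_two]⟩

/-- The matrix `T = [1, λ; 0, 1]`. -/
def matT (q : ℕ) : SL(2, ℝ) := ⟨!![1, lam q; 0, 1], by simp [Matrix.det_fin_two]⟩

/-- The conjugating matrix `𝒯 = 2^{-1/2} [1, -1; 1, 1]`. -/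
def matC : SL(2, ℝ) :=
  ⟨!![1 / √2, -(1 / √2); 1 / √2, 1 / √2], by
    have h : (√2 : ℝ) * √2 = 2 := Real.mul_self_sqrt (by norm_num)
    have h0 : (√2 : ℝ) ≠ 0 := by positivity
    rw [Matrix.det_fin_two_of]
    field_simp
    nlinarith⟩

/-- The canonical projection `SL(2, ℝ) → PSL(2, ℝ)`. -/
def proj : SL(2, ℝ) →* PSL(2, ℝ) :=
  QuotientGroup.mk' (Subgroup.center SL(2, ℝ))

/-- The Hecke triangle group `Γ_λ ⊆ PSL(2, ℝ)` with `λ = 2 cos (π / q)`. -/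
def heckeGroup (q : ℕ) : Subgroup PSL(2, ℝ) :=
  Subgroup.closure {proj matS, proj (matT q)}

/-- The conjugate lattice `Λ = 𝒯 Γ_λ 𝒯⁻¹`. -/
def conjGroup (q : ℕ) : Subgroup PSL(2, ℝ) :=
  (heckeGroup q).map (MulAut.conj (proj matC)).toMonoidHom

/-- A matrix representing `g_k = ((TS)^k S)⁻¹`. -/
def g (q k : ℕ) : SL(2, ℝ) := ((matT q * matS) ^ k * matS)⁻¹

/-- A matrix representing `h_k = 𝒯 g_k 𝒯⁻¹`. -/
def h (q k : ℕ) : SL(2, ℝ) := matC * g q k * matC⁻¹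

/-- A matrix representing `𝒯 T 𝒯⁻¹`. -/
def conjT (q : ℕ) : SL(2, ℝ) := matC * matT q * matC⁻¹

theorem proj_conj_mem {q : ℕ} {x : SL(2, ℝ)} (hx : proj x ∈ heckeGroup q) :
    proj (matC * x * matC⁻¹) ∈ conjGroup q :=
  ⟨proj x, hx, by simp⟩

theorem matS_mem (q : ℕ) : proj matS ∈ heckeGroup q :=
  Subgroup.subset_closure (by simp)

theorem matT_mem (q : ℕ) : proj (matT q) ∈ heckeGroup q :=
  Subgroup.subset_closure (by simp)

theorem g_mem (q k : ℕ) : proj (g q k) ∈ heckeGroup q := by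
  rw [g, map_inv, map_mul, map_pow, map_mul]
  exact inv_mem (mul_mem (pow_mem (mul_mem (matT_mem q) (matS_mem q)) k) (matS_mem q))

theorem h_pow_mem (q k n : ℕ) : proj (h q k ^ n) ∈ conjGroup q := by
  rw [map_pow]
  exact pow_mem (proj_conj_mem (g_mem q k)) n

theorem conjT_mem (q : ℕ) : proj (conjT q) ∈ conjGroup q :=
  proj_conj_mem (matT_mem q)

/-! ### Fractional linear action and the weighted action -/

/-- The denominator `c z + d` of `[a, b; c, d].z`. -/
def den (x : SL(2, ℝ)) (z : ℂ) : ℂ := (x 1 0 : ℂ) * z + (x 1 1 : ℂ)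

/-- The fractional linear transformation `[a, b; c, d].z = (a z + b) / (c z + d)`, for points `z`
that are not mapped to `∞`. -/
def moebius (x : SL(2, ℝ)) (z : ℂ) : ℂ := ((x 0 0 : ℂ) * z + (x 0 1 : ℂ)) / den x z

/-- `x.K ⊆ U`, for subsets `K`, `U` of `ℂ`; in particular no point of `K` is mapped to `∞`. -/
def MapsInto (x : SL(2, ℝ)) (K U : Set ℂ) : Prop :=
  ∀ z ∈ K, den x z ≠ 0 ∧ moebius x z ∈ U

/-- The factor `j_s(x, z) = ((c z + d)^{-2})^s` for `x = [a, b; c, d]` of determinant `1`.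
For real `z` near `0` the base is positive and the power is the obvious one; for complex `z` it is
continued holomorphically to the plane slit along the real half line on the other side of the pole
`-d / c`.  That is: the sign of `(c, d)` is normalized so that `d > 0`, and then
`j_s(x, z) = (c z + d)^{-2s}` with the principal branch.
(The value is the same for `x` and `-x`.) -/
def autFactor (s : ℂ) (x : SL(2, ℝ)) (z : ℂ) : ℂ :=
  ((Real.sign (x 1 1) : ℂ) * den x z) ^ (-2 * s)

variable {V : Type*} [NormedAddCommGroup V] [InnerProductSpace ℂ V]

/-- `τ_s(x) f (z) = j_s(x⁻¹, z) f(x⁻¹.z)`. -/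
def tau (s : ℂ) (x : SL(2, ℝ)) (f : ℂ → V) (z : ℂ) : V :=
  autFactor s x⁻¹ z • f (moebius x⁻¹ z)

/-- `β_s(h_k^n) = η(h_k^n) τ_s(h_k^n)`, for a unitary representation `η` of `Λ` on `V`. -/
def beta {q : ℕ} (η : conjGroup q →* (V ≃ₗᵢ[ℂ] V)) (s : ℂ) (k n : ℕ) (f : ℂ → V) (z : ℂ) : V :=
  η ⟨proj (h q k ^ n), h_pow_mem q k n⟩ (tau s (h q k ^ n) f z)

/-- The degree of singularity: the dimension of the space of vectors fixed by the generator
`𝒯 T 𝒯⁻¹` of the stabilizer of the (only) cusp. -/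
def sd {q : ℕ} (η : conjGroup q →* (V ≃ₗᵢ[ℂ] V)) : ℕ :=
  Module.finrank ℂ (LinearMap.ker
    ((η ⟨proj (conjT q), conjT_mem q⟩).toLinearEquiv.toLinearMap - LinearMap.id))

/-! ### Banach spaces of holomorphic functions -/

/-- An open bounded disc in `ℂ`. -/
structure Disc where
  center : ℂ
  radius : ℝ
  radius_pos : 0 < radius

/-- The open disc. -/
def Disc.opn (D : Disc) : Set ℂ := Metric.ball D.center D.radius

/-- The closed disc. -/
def Disc.cl (D : Disc) : Set ℂ := Metric.closedBall D.center D.radius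

instance (D : Disc) : CompactSpace D.cl :=
  isCompact_iff_compactSpace.mp (isCompact_closedBall D.center D.radius)

open Classical in
/-- Extension by zero of a function on the closed disc. -/
def ext0 {D : Disc} (f : C(D.cl, V)) (z : ℂ) : V := if hz : z ∈ D.cl then f ⟨z, hz⟩ else 0

theorem ext0_of_mem {D : Disc} (f : C(D.cl, V)) {z : ℂ} (hz : z ∈ D.cl) :
    ext0 f z = f ⟨z, hz⟩ := dif_pos hz

theorem ext0_add {D : Disc} (f₁ f₂ : C(D.cl, V)) : ext0 (f₁ + f₂) = ext0 f₁ + ext0 f₂ := by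
  funext z
  by_cases hz : z ∈ D.cl <;> simp [ext0, hz]

theorem ext0_smul {D : Disc} (c : ℂ) (f : C(D.cl, V)) : ext0 (c • f) = c • ext0 f := by
  funext z
  by_cases hz : z ∈ D.cl <;> simp [ext0, hz]

/-- `B(D; V)`: continuous functions on the closed disc that are holomorphic on the open disc, with
the supremum norm (inherited from `C(D.cl, V)`). -/
def HolSpace (D : Disc) (V : Type*) [NormedAddCommGroup V] [InnerProductSpace ℂ V] :
    Submodule ℂ C(D.cl, V) where
  carrier := {f | DifferentiableOn ℂ (ext0 f) D.opn}
  zero_mem' := by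
    have : ext0 (0 : C(D.cl, V)) = fun _ => 0 := by
      funext z
      by_cases hz : z ∈ D.cl <;> simp [ext0, hz]
    simp only [Set.mem_ofPred_eq, this]
    exact differentiableOn_const 0
  add_mem' := by
    intro a b ha hb
    simp only [Set.mem_ofPred_eq, ext0_add] at *
    exact ha.add hb
  smul_mem' := by
    intro c a ha
    simp only [Set.mem_ofPred_eq, ext0_smul] at *
    exact ha.const_smul c

/-- `B(D; V)` is a Banach space. -/
instance [CompleteSpace V] (D : Disc) : CompleteSpace (HolSpace D V) := by
  have hc : IsClosed (HolSpace D V : Set C(D.cl, V)) := by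
    refine isClosed_of_closure_subset fun f hf => ?_
    obtain ⟨u, hu, hlim⟩ := mem_closure_iff_seq_limit.mp hf
    refine TendstoLocallyUniformlyOn.differentiableOn (φ := Filter.atTop)
      (F := fun n => ext0 (u n)) (f := ext0 f) ?_ (.of_forall hu) Metric.isOpen_ball
    refine TendstoUniformlyOn.tendstoLocallyUniformlyOn ?_
    rw [ContinuousMap.tendsto_iff_tendstoUniformly, Metric.tendstoUniformly_iff] at hlim
    rw [Metric.tendstoUniformlyOn_iff]
    intro ε hε
    filter_upwards [hlim ε hε] with n hn z hz
    have hz' : z ∈ D.cl := Metric.ball_subset_closedBall hz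
    rw [ext0_of_mem _ hz', ext0_of_mem _ hz']
    exact hn ⟨z, hz'⟩
  exact hc.completeSpace_coe

/-- The three discs `𝓔_1`, `𝓔_r`, `𝓔_{q-1}` (the last one is called `e2`). -/
structure DiscTriple where
  e1 : Disc
  er : Disc
  e2 : Disc

/-- The Banach space `B(𝓔; V) = B(𝓔_1; V) ⊕ B(𝓔_r; V) ⊕ B(𝓔_{q-1}; V)`. -/
abbrev DirectSumSpace (E : DiscTriple) (V : Type*) [NormedAddCommGroup V]
    [InnerProductSpace ℂ V] : Type _ :=
  HolSpace E.e1 V × HolSpace E.er V × HolSpace E.e2 V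

/-- The real interval `(a, b)` as a subset of `ℂ`. -/
def realInterval (a b : ℝ) : Set ℂ := Complex.ofReal '' Set.Ioo a b

/-- The conditions on the discs: each contains the closure of the corresponding interval
`E_1 = (μ, 1)`, `E_r = (-μ, μ)`, `E_{q-1} = (-1, -μ)`, where `μ = (λ - 1) / (λ + 1)`; they are
exchanged by the reflection `J.z = -z̄`; they are mapped into each other by the branches of the
system; and they lie in the stated half planes. -/
structure DiscTriple.IsAdmissible (q : ℕ) (E : DiscTriple) : Prop where
  sub_e1 : closure (realInterval ((lam q - 1) / (lam q + 1)) 1) ⊆ E.e1.opn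
  sub_er : closure (realInterval (-((lam q - 1) / (lam q + 1))) ((lam q - 1) / (lam q + 1)))
    ⊆ E.er.opn
  sub_e2 : closure (realInterval (-1) (-((lam q - 1) / (lam q + 1)))) ⊆ E.e2.opn
  symm_er : (fun z : ℂ => -(starRingEnd ℂ) z) '' E.er.opn = E.er.opn
  symm_e1 : (fun z : ℂ => -(starRingEnd ℂ) z) '' E.e1.opn = E.e2.opn
  maps_k : ∀ k ∈ Finset.Icc 2 (q - 2),
    MapsInto (h q k)⁻¹ E.e1.cl E.er.opn ∧ MapsInto (h q k)⁻¹ E.er.cl E.er.opn ∧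
      MapsInto (h q k)⁻¹ E.e2.cl E.er.opn
  maps_1 : ∀ n : ℕ, 1 ≤ n →
    MapsInto (h q 1 ^ n)⁻¹ E.er.cl E.e1.opn ∧ MapsInto (h q 1 ^ n)⁻¹ E.e2.cl E.e1.opn
  maps_2 : ∀ n : ℕ, 1 ≤ n →
    MapsInto (h q (q - 1) ^ n)⁻¹ E.e1.cl E.e2.opn ∧ MapsInto (h q (q - 1) ^ n)⁻¹ E.er.cl E.e2.opn
  re_e1 : ∀ z ∈ E.e1.cl, -1 < z.re
  re_e2 : ∀ z ∈ E.e2.cl, z.re < 1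
  re_er : ∀ z ∈ E.er.cl, -1 < z.re ∧ z.re < 1

/-! ### The fast transfer operator -/

/-- The term of index `n` of the series `∑_{n ≥ 1} β_s(h_k^n) f (z)` (the index is shifted, so that
it starts at `0`). -/
def seriesTerm {q : ℕ} {D : Disc} (η : conjGroup q →* (V ≃ₗᵢ[ℂ] V)) (s : ℂ) (k : ℕ)
    (f : HolSpace D V) (z : ℂ) (n : ℕ) : V :=
  beta η s k (n + 1) (ext0 f.1) z

/-- The finite sum `∑_{k=2}^{q-2} β_s(h_k) f (z)`. -/
def finPart {q : ℕ} {D : Disc} (η : conjGroup q →* (V ≃ₗᵢ[ℂ] V)) (s : ℂ)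
    (f : HolSpace D V) (z : ℂ) : V :=
  ∑ k ∈ Finset.Icc 2 (q - 2), beta η s k 1 (ext0 f.1) z

/-- The operator `L` on `B(𝓔; V)` is the fast transfer operator with parameter `s`, i.e. all
occurring series converge and `L` is given by the matrix
```
(        0             ∑_k β_s(h_k)   ∑_n β_s(h_{q-1}^n) )
( ∑_n β_s(h_1^n)       ∑_k β_s(h_k)   ∑_n β_s(h_{q-1}^n) )
( ∑_n β_s(h_1^n)       ∑_k β_s(h_k)          0           )
```
where `k` runs through `2, …, q - 2` and `n` through the positive integers. -/
structure IsFastTransferOperator {q : ℕ} (η : conjGroup q →* (V ≃ₗᵢ[ℂ] V)) (E : DiscTriple)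
    (s : ℂ) (L : DirectSumSpace E V →L[ℂ] DirectSumSpace E V) : Prop where
  row_1 : ∀ (f : DirectSumSpace E V) (z : E.e1.cl),
    Summable (seriesTerm η s (q - 1) f.2.2 z) ∧
    (L f).1.1 z = finPart η s f.2.1 z + ∑' n, seriesTerm η s (q - 1) f.2.2 z n
  row_r : ∀ (f : DirectSumSpace E V) (z : E.er.cl),
    Summable (seriesTerm η s 1 f.1 z) ∧ Summable (seriesTerm η s (q - 1) f.2.2 z) ∧
    (L f).2.1.1 z = ∑' n, seriesTerm η s 1 f.1 z n + finPart η s f.2.1 z +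
      ∑' n, seriesTerm η s (q - 1) f.2.2 z n
  row_2 : ∀ (f : DirectSumSpace E V) (z : E.e2.cl),
    Summable (seriesTerm η s 1 f.1 z) ∧
    (L f).2.2.1 z = ∑' n, seriesTerm η s 1 f.1 z n + finPart η s f.2.1 z

/-! ### Nuclear operators -/

/-- `L = ∑ₙ aₙ φₙ(·) eₙ` with `‖φₙ‖ ≤ 1`, `‖eₙ‖ ≤ 1` and `∑ₙ |aₙ|^p < ∞`. -/
def IsPowNuclear {X Y : Type*} [NormedAddCommGroup X] [NormedSpace ℂ X]
    [NormedAddCommGroup Y] [NormedSpace ℂ Y] (p : ℝ) (L : X →L[ℂ] Y) : Prop :=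
  ∃ (a : ℕ → ℂ) (φ : ℕ → X →L[ℂ] ℂ) (e : ℕ → Y),
    (∀ n, ‖φ n‖ ≤ 1) ∧ (∀ n, ‖e n‖ ≤ 1) ∧ Summable (fun n => ‖a n‖ ^ p) ∧
      ∀ f, HasSum (fun n => (a n * φ n f) • e n) (L f)

/-- Nuclear of order `0`: the infimum of the exponents `p ∈ (0, 1]` for which `L` has a nuclear
representation with `p`-summable coefficients is `0`; equivalently all `p ∈ (0, 1]` occur. -/
def IsNuclearOfOrderZero {X Y : Type*} [NormedAddCommGroup X] [NormedSpace ℂ X]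
    [NormedAddCommGroup Y] [NormedSpace ℂ Y] (L : X →L[ℂ] Y) : Prop :=
  ∀ p : ℝ, 0 < p → p ≤ 1 → IsPowNuclear p L

end

end HeckeTransfer

/-! The two parabolic generators $h_1$, $h_{q-1}$ account for all poles. A power of $h_1^{-1}$ or
$h_{q-1}^{-1}$ fixes $p=1$ or $p=-1$ respectively, and in the coordinate
$u(z)=\frac{2}{\lambda}(1-pz)^{-1}$ its $n$-th power is the translation $u\mapsto u+n$. Hence the
$n$-th branch is $z\mapsto p+c/(n+u(z))$ with $c=-2p/\lambda$, and its automorphy factor is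
$((n+u)/u)^{-2s}$. Condition (f) says exactly that $\operatorname{Re}u>0$ on the discs concerned, so
principal logarithms add and the factor $u^{2s}$ can be pulled out of the series.

Diagonalize the unitary map $\eta(h)$ and consider one eigenvalue $\varepsilon$. Taylor expansion of
$f$ at $p$ (index $j$), followed by binomial expansion of $(n+u)^{-2s-j}$ (index $i$), and summation
over $n\ge n_0$ turn the tail of the series into $\sum_{j,i}K_i(2s+j)\,Q_{j,i}$, where
$K_i(w)=\binom{-w}{i}\sum_{n\ge n_0}\varepsilon^n n^{-w-i}$ and $Q_{j,i}$ has rank one (the $j$-th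
Taylor coefficient times $u^i$). The kernels are continued by periodic zeta functions. For $i\ge1$
the binomial coefficient vanishes where the zeta function has its pole, so $K_i$ is entire. Only
$K_0$ can have a pole, simple, at $w=1$, and only if $\varepsilon=1$. Thus poles in $s$ occur only
where $2s+j=1$, with a rank-one residue for each eigenvalue $1$, which gives at most
$\mathrm{sd}(\eta)$ per parabolic block. There are four such blocks. If $n_0$ is large compared with
the sizes of $c$ and $u$, the terms decay like $2^{-(i+j)}$, locally uniformly in $s$ apart from
finitely many of them. This one estimate yields the continuation (`hasSimplePoles_kernel_series`)
and nuclearity of order $0$ (`isNuclearOfOrderZero_kernel_series`).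

The finitely many branches $n<n_0$ and the branches of $h_k$, $2\le k\le q-2$, are weighted
composition operators that map a closed disc into an open one. They are entire in $s$, and Taylor
expansion at the disc's center shows that they are nuclear of order $0$
(`isNuclearOfOrderZero_wcomp`).

Admissible discs are found by explicit choice. In the coordinate $1/(1-pz)$ the parabolic branches
are translations, so they shrink discs touching $p$ (`parabolic_mem_ball`). The middle branches map
the closed unit disc into the closed disc of radius $\mu$ by sine inequalities, and compactness
leaves room for a slight enlargement (`exists_mapsInto_middle`). -/

namespace HeckeTransfer

open Complex Metric Filter Topology
open scoped InnerProductSpace MatrixGroups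

noncomputable section

/-! ### Holomorphic functions on discs and weighted composition operators -/

section WeightedComposition

/-- A map with values in a Banach space that has a second order Taylor estimate at every point is
analytic. -/
theorem analyticAt_of_norm_sub_le {F : Type*} [NormedAddCommGroup F] [NormedSpace ℂ F]
    [CompleteSpace F] {W W' : ℂ → F}
    (h : ∀ s, ∃ C, ∀ᶠ t in 𝓝 (0 : ℂ), ‖W (s + t) - W s - t • W' s‖ ≤ C * ‖t‖ ^ 2) (s : ℂ) :
    AnalyticAt ℂ W s := by
  refine Differentiable.analyticAt (fun s => ?_) s
  obtain ⟨C, hC⟩ := h s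
  suffices h : HasDerivAt W (W' s) s from h.differentiableAt
  rw [hasDerivAt_iff_isLittleO_nhds_zero]
  have hsq : (fun t : ℂ => t ^ 2) =o[𝓝 0] fun t : ℂ => t := by
    simpa using Asymptotics.isLittleO_pow_pow (𝕜 := ℂ) (one_lt_two)
  refine Asymptotics.IsBigO.trans_isLittleO (Asymptotics.IsBigO.of_bound C ?_) hsq
  simpa only [norm_pow] using hC

/-! ### Spaces of holomorphic functions on discs -/

section HolSpaces

variable {V : Type*} [NormedAddCommGroup V] [InnerProductSpace ℂ V] {D D' : Disc}

/-- `F` is continuous on the closed disc and holomorphic on the open disc. -/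
def IsHol (D : Disc) (F : ℂ → V) : Prop :=
  ContinuousOn F D.cl ∧ DifferentiableOn ℂ F D.opn

theorem Disc.opn_subset_cl (D : Disc) : D.opn ⊆ D.cl := ball_subset_closedBall

theorem Disc.isOpen_opn (D : Disc) : IsOpen D.opn := isOpen_ball

theorem Disc.isCompact_cl (D : Disc) : IsCompact D.cl := isCompact_closedBall _ _

theorem Disc.center_mem_opn (D : Disc) : D.center ∈ D.opn := mem_ball_self D.radius_pos

theorem IsHol.smul {g : ℂ → ℂ} {F : ℂ → V} (hg : IsHol D g) (hF : IsHol D F) :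
    IsHol D (fun z => g z • F z) :=
  ⟨hg.1.smul hF.1, hg.2.smul hF.2⟩

theorem IsHol.pow {g : ℂ → ℂ} (hg : IsHol D g) (n : ℕ) : IsHol D (fun z => g z ^ n) :=
  ⟨hg.1.pow n, hg.2.pow n⟩

theorem isHol_const (v : V) : IsHol D (fun _ => v) :=
  ⟨continuousOn_const, differentiableOn_const v⟩

theorem isHol_id : IsHol D (fun z => z) := ⟨continuousOn_id, differentiableOn_id⟩

theorem IsHol.add {F G : ℂ → V} (hF : IsHol D F) (hG : IsHol D G) :
    IsHol D (fun z => F z + G z) :=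
  ⟨hF.1.add hG.1, hF.2.add hG.2⟩

theorem IsHol.sub {F G : ℂ → V} (hF : IsHol D F) (hG : IsHol D G) :
    IsHol D (fun z => F z - G z) :=
  ⟨hF.1.sub hG.1, hF.2.sub hG.2⟩

theorem IsHol.mul {F G : ℂ → ℂ} (hF : IsHol D F) (hG : IsHol D G) :
    IsHol D (fun z => F z * G z) :=
  ⟨hF.1.mul hG.1, hF.2.mul hG.2⟩

theorem IsHol.const_mul {F : ℂ → ℂ} (c : ℂ) (hF : IsHol D F) : IsHol D (fun z => c * F z) :=
  (isHol_const c).mul hF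

theorem IsHol.inv {F : ℂ → ℂ} (hF : IsHol D F) (h0 : ∀ z ∈ D.cl, F z ≠ 0) :
    IsHol D (fun z => (F z)⁻¹) :=
  ⟨hF.1.inv₀ h0, hF.2.inv fun z hz => h0 z (D.opn_subset_cl hz)⟩

theorem IsHol.div {F G : ℂ → ℂ} (hF : IsHol D F) (hG : IsHol D G) (h0 : ∀ z ∈ D.cl, G z ≠ 0) :
    IsHol D (fun z => F z / G z) := by
  simpa only [div_eq_mul_inv] using hF.mul (hG.inv h0)

theorem IsHol.cexp {F : ℂ → ℂ} (hF : IsHol D F) : IsHol D (fun z => Complex.exp (F z)) :=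
  ⟨hF.1.cexp, hF.2.cexp⟩

theorem IsHol.clog {F : ℂ → ℂ} (hF : IsHol D F) (h0 : ∀ z ∈ D.cl, F z ∈ slitPlane) :
    IsHol D (fun z => Complex.log (F z)) :=
  ⟨hF.1.clog h0, hF.2.clog fun z hz => h0 z (D.opn_subset_cl hz)⟩

theorem IsHol.exists_bound {F : ℂ → V} (hF : IsHol D F) :
    ∃ M, 0 ≤ M ∧ ∀ z ∈ D.cl, ‖F z‖ ≤ M := by
  obtain ⟨M, hM⟩ := D.isCompact_cl.exists_bound_of_continuousOn hF.1
  exact ⟨max M 0, le_max_right _ _, fun z hz => (hM z hz).trans (le_max_left _ _)⟩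

/-- The element of `B(D; V)` given by a function on the plane. -/
def IsHol.toHol {F : ℂ → V} (hF : IsHol D F) : HolSpace D V :=
  ⟨⟨fun z => F z, hF.1.domRestrict⟩, hF.2.congr fun _ hz => ext0_of_mem _ (D.opn_subset_cl hz)⟩

@[simp]
theorem IsHol.toHol_apply {F : ℂ → V} (hF : IsHol D F) (z : D.cl) : hF.toHol.1 z = F z := rfl

theorem norm_toHol_le {F : ℂ → V} (hF : IsHol D F) {M : ℝ} (hM : 0 ≤ M)
    (h : ∀ z ∈ D.cl, ‖F z‖ ≤ M) : ‖hF.toHol‖ ≤ M :=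
  (ContinuousMap.norm_le _ hM).2 fun z => h z z.2

theorem isHol_ext0 (f : HolSpace D V) : IsHol D (ext0 f.1) := by
  refine ⟨continuousOn_iff_continuous_domRestrict.2 ?_, f.2⟩
  convert f.1.continuous using 1
  funext z
  exact ext0_of_mem f.1 z.2

theorem norm_ext0_le (f : HolSpace D V) (z : ℂ) : ‖ext0 f.1 z‖ ≤ ‖f‖ := by
  by_cases hz : z ∈ D.cl
  · rw [ext0_of_mem _ hz]
    exact f.1.norm_coe_le_norm ⟨z, hz⟩
  · simp [ext0, hz]

/-- Evaluation at a point of the closed disc. -/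
def evalAt (z : D.cl) : HolSpace D V →L[ℂ] V :=
  (ContinuousMap.evalCLM ℂ z).comp (HolSpace D V).subtypeL

@[simp]
theorem evalAt_apply (z : D.cl) (f : HolSpace D V) : evalAt z f = f.1 z := rfl

/-- Absolute convergence supplies a limit in norm; continuity of the point evaluations then
identifies it. -/
theorem hasSum_of_pointwise [CompleteSpace V] {ι : Type*} {F : ι → HolSpace D V}
    {f : HolSpace D V} (hs : Summable fun i => ‖F i‖)
    (h : ∀ z : D.cl, HasSum (fun i => (F i).1 z) (f.1 z)) : HasSum F f := by
  have hF : Summable F := hs.of_norm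
  have : ∑' i, F i = f := by
    refine Subtype.ext (ContinuousMap.ext fun z => ?_)
    exact (hF.hasSum.mapL (evalAt z)).unique (h z)
  exact this ▸ hF.hasSum

/-- The Taylor coefficients at `p`, as bounded linear maps on `B(D; V)`. -/
theorem exists_taylor_coeff [CompleteSpace V] {p : ℂ} {r : ℝ} (hr : 0 < r)
    (hp : closedBall p r ⊆ D.opn) :
    ∃ a : ℕ → HolSpace D V →L[ℂ] V, (∀ m, ‖a m‖ ≤ (r⁻¹) ^ m) ∧
      ∀ (f : HolSpace D V) (z : ℂ), ‖z - p‖ < r →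
        HasSum (fun m => (z - p) ^ m • a m f) (ext0 f.1 z) := by
  -- The coefficients are Cauchy integrals over the circle of radius `r`, so they are linear in `f`
  -- and bounded by `r⁻¹ ^ m` with a constant independent of `f`.
  have hcirc : ∀ (m : ℕ) (f : HolSpace D V),
      CircleIntegrable (fun z => (z - p)⁻¹ ^ m • (z - p)⁻¹ • ext0 f.1 z) p r := by
    intro m f
    refine ContinuousOn.circleIntegrable hr.le ?_
    have h1 : ContinuousOn (fun z : ℂ => (z - p)⁻¹) (sphere p r) := by
      refine ContinuousOn.inv₀ (by fun_prop) fun z hz => ?_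
      rw [mem_sphere_iff_norm] at hz
      exact norm_pos_iff.1 (hz ▸ hr)
    exact (h1.pow m).smul (h1.smul ((isHol_ext0 f).2.continuousOn.mono
      (sphere_subset_closedBall.trans hp)))
  have hbound : ∀ (m : ℕ) (f : HolSpace D V),
      ‖(2 * Real.pi * I : ℂ)⁻¹ • ∮ z in C(p, r), (z - p)⁻¹ ^ m • (z - p)⁻¹ • ext0 f.1 z‖
        ≤ (r⁻¹) ^ m * ‖f‖ := by
    intro m f
    have h := circleIntegral.norm_two_pi_i_inv_smul_integral_le_of_norm_le_const
      (f := fun z => (z - p)⁻¹ ^ m • (z - p)⁻¹ • ext0 f.1 z) (c := p) (R := r)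
      (C := (r⁻¹) ^ m * r⁻¹ * ‖f‖) hr.le (fun z hz => by
        rw [mem_sphere_iff_norm] at hz
        rw [norm_smul, norm_smul, norm_pow, norm_inv, hz, mul_assoc]
        gcongr
        exact norm_ext0_le f z)
    refine h.trans (le_of_eq ?_)
    field_simp
  refine ⟨fun m => LinearMap.mkContinuous
    { toFun := fun f =>
        (2 * Real.pi * I : ℂ)⁻¹ • ∮ z in C(p, r), (z - p)⁻¹ ^ m • (z - p)⁻¹ • ext0 f.1 z
      map_add' := fun f g => ?_
      map_smul' := fun c f => ?_ } ((r⁻¹) ^ m) (hbound m), fun m => ?_, fun f z hz => ?_⟩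
  · rw [← smul_add, ← circleIntegral.integral_add (hcirc m f) (hcirc m g)]
    simp only [Submodule.coe_add, ext0_add, Pi.add_apply, smul_add]
  · simp only [Submodule.coe_smul, ext0_smul, Pi.smul_apply, RingHom.id_apply]
    rw [smul_comm c, ← circleIntegral.integral_smul c]
    congr 2
    funext z
    rw [smul_comm c, smul_comm c]
  · exact LinearMap.mkContinuous_norm_le _ (by positivity) _
  · lift r to NNReal using hr.le
    have hd : DifferentiableOn ℂ (ext0 f.1) (closedBall p r) := (isHol_ext0 f).2.mono hp
    have h := (hd.hasFPowerSeriesOnBall (by exact_mod_cast hr)).hasSum (y := z - p) (by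
      simpa [Metric.mem_eball, edist_zero_right, enorm_eq_nnnorm, ← NNReal.coe_lt_coe] using hz)
    rw [add_sub_cancel] at h
    refine h.congr_fun fun m => ?_
    change (z - p) ^ m • ((2 * Real.pi * I : ℂ)⁻¹ •
      ∮ w in C(p, r), (w - p)⁻¹ ^ m • (w - p)⁻¹ • ext0 f.1 w) = _
    rw [cauchyPowerSeries_apply]
    simp only [div_eq_mul_inv, mul_pow, mul_smul, circleIntegral.integral_smul]
    rw [smul_comm]

/-- `γ` is a holomorphic map from one disc to another. -/
structure IsBranch (D D' : Disc) (γ : ℂ → ℂ) : Prop where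
  isHol : IsHol D γ
  mapsTo_cl : Set.MapsTo γ D.cl D'.cl
  mapsTo_opn : Set.MapsTo γ D.opn D'.opn

theorem isBranch_id : IsBranch D D (fun z => z) :=
  ⟨isHol_id, fun _ h => h, fun _ h => h⟩

theorem IsBranch.of_mapsTo {γ : ℂ → ℂ} (hγ : IsHol D γ) (h : Set.MapsTo γ D.cl D'.opn) :
    IsBranch D D' γ :=
  ⟨hγ, fun _ hz => D'.opn_subset_cl (h hz), fun _ hz => h (D.opn_subset_cl hz)⟩

theorem IsBranch.isHol_comp {γ : ℂ → ℂ} (hγ : IsBranch D D' γ) (A : V →L[ℂ] V)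
    (f : HolSpace D' V) : IsHol D (fun z => A (ext0 f.1 (γ z))) :=
  ⟨A.continuous.comp_continuousOn ((isHol_ext0 f).1.comp hγ.isHol.1 hγ.mapsTo_cl),
    A.differentiable.comp_differentiableOn ((isHol_ext0 f).2.comp hγ.isHol.2 hγ.mapsTo_opn)⟩

/-- The weighted composition operator `f ↦ g • A (f ∘ γ)`. -/
def wcomp {γ : ℂ → ℂ} (hγ : IsBranch D D' γ) (A : V →L[ℂ] V) {g : ℂ → ℂ} (hg : IsHol D g) :
    HolSpace D' V →L[ℂ] HolSpace D V :=
  LinearMap.mkContinuousOfExistsBound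
    { toFun := fun f => (hg.smul (hγ.isHol_comp A f)).toHol
      map_add' := fun f₁ f₂ => by
        refine Subtype.ext (ContinuousMap.ext fun z => ?_)
        simp [ext0_add]
      map_smul' := fun c f => by
        refine Subtype.ext (ContinuousMap.ext fun z => ?_)
        simp [ext0_smul, smul_comm c] }
    (by
      obtain ⟨M, hM, h⟩ := hg.exists_bound
      refine ⟨M * ‖A‖, fun f => norm_toHol_le _ (by positivity) fun z hz => ?_⟩
      rw [norm_smul, mul_assoc]
      gcongr
      · exact h z hz
      · exact A.le_opNorm_of_le (norm_ext0_le f _))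

theorem wcomp_apply {γ : ℂ → ℂ} (hγ : IsBranch D D' γ) (A : V →L[ℂ] V) {g : ℂ → ℂ}
    (hg : IsHol D g) (f : HolSpace D' V) (z : D.cl) :
    (wcomp hγ A hg f).1 z = g z • A (ext0 f.1 (γ z)) := rfl

theorem norm_wcomp_le {γ : ℂ → ℂ} (hγ : IsBranch D D' γ) (A : V →L[ℂ] V) {g : ℂ → ℂ}
    (hg : IsHol D g) {M : ℝ} (hM : 0 ≤ M) (h : ∀ z ∈ D.cl, ‖g z‖ ≤ M) :
    ‖wcomp hγ A hg‖ ≤ M * ‖A‖ := by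
  refine ContinuousLinearMap.opNorm_le_bound _ (by positivity) fun f => ?_
  refine norm_toHol_le (hg.smul (hγ.isHol_comp A f)) (by positivity) fun z hz => ?_
  rw [norm_smul, mul_assoc]
  gcongr
  · exact h z hz
  · exact A.le_opNorm_of_le (norm_ext0_le f _)

theorem IsHol.exp_mul {l : ℂ → ℂ} (hl : IsHol D l) (s : ℂ) :
    IsHol D (fun z => Complex.exp (s * l z)) :=
  (hl.const_mul s).cexp

/-- The operators with weight `exp (s l)` depend holomorphically on `s`. -/
theorem analyticAt_wcomp_exp [CompleteSpace V] {γ : ℂ → ℂ} (hγ : IsBranch D D' γ)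
    (A : V →L[ℂ] V) {l : ℂ → ℂ} (hl : IsHol D l) (s : ℂ) :
    AnalyticAt ℂ (fun s => wcomp hγ A (hl.exp_mul s)) s := by
  refine analyticAt_of_norm_sub_le (W' := fun s => wcomp hγ A (hl.mul (hl.exp_mul s)))
    (fun s => ?_) s
  obtain ⟨K, hK, hlK⟩ := hl.exists_bound
  obtain ⟨M, hM, hM'⟩ := (hl.exp_mul s).exists_bound
  -- The remainder of the weight is $e^{sl}(e^{tl}-1-tl)$, and $|e^x-1-x|\le|x|^2$ for $|x|\le1$;
  -- hence the restriction `‖t‖ * K ≤ 1` below.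
  refine ⟨M * K ^ 2 * ‖A‖, ?_⟩
  have hev : ∀ᶠ t : ℂ in 𝓝 0, ‖t‖ * K ≤ 1 := by
    have hc : Tendsto (fun t : ℂ => ‖t‖ * K) (𝓝 0) (𝓝 0) := by
      have : Continuous fun t : ℂ => ‖t‖ * K := by fun_prop
      simpa using this.tendsto 0
    exact (hc.eventually_lt_const one_pos).mono fun t ht => ht.le
  filter_upwards [hev] with t ht
  have hg : IsHol D (fun z => Complex.exp ((s + t) * l z) - Complex.exp (s * l z)
      - t * (l z * Complex.exp (s * l z))) :=
    ((hl.exp_mul (s + t)).sub (hl.exp_mul s)).sub ((hl.mul (hl.exp_mul s)).const_mul t)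
  have heq : wcomp hγ A (hl.exp_mul (s + t)) - wcomp hγ A (hl.exp_mul s) -
      t • wcomp hγ A (hl.mul (hl.exp_mul s)) = wcomp hγ A hg := by
    refine ContinuousLinearMap.ext fun f => Subtype.ext (ContinuousMap.ext fun z => ?_)
    change _ - _ - t • ((_ : ℂ) • A (ext0 f.1 (γ z))) = (_ : ℂ) • A (ext0 f.1 (γ z))
    rw [sub_smul, sub_smul, mul_smul t]
    rfl
  rw [heq]
  refine (norm_wcomp_le hγ A hg (M := M * (K ^ 2 * ‖t‖ ^ 2)) (by positivity) fun z hz => ?_).trans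
    (le_of_eq (by ring))
  have h1 : Complex.exp ((s + t) * l z) - Complex.exp (s * l z)
      - t * (l z * Complex.exp (s * l z)) =
      Complex.exp (s * l z) * (Complex.exp (t * l z) - 1 - t * l z) := by
    rw [add_mul, Complex.exp_add]; ring
  have h2 : ‖t * l z‖ ≤ ‖t‖ * K := by
    rw [norm_mul]; gcongr; exact hlK z hz
  rw [h1, norm_mul]
  gcongr
  · exact hM' z hz
  · refine (norm_exp_sub_one_sub_id_le (h2.trans ht)).trans ?_
    calc ‖t * l z‖ ^ 2 ≤ (‖t‖ * K) ^ 2 := by gcongr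
      _ = _ := by ring

end HolSpaces

end WeightedComposition

/-! ### Nuclear operators -/

section Nuclear

variable {X Y Z : Type*} [NormedAddCommGroup X] [NormedSpace ℂ X] [NormedAddCommGroup Y]
  [NormedSpace ℂ Y] [NormedAddCommGroup Z] [NormedSpace ℂ Z]

/-- Removes the bookkeeping from nuclear representations: any countable index set is allowed, and
functionals and vectors need not be normalized. Norms are moved into the coefficients, and the
family is extended by zero along an injection into `ℕ`. -/
theorem isPowNuclear_of_hasSum {ι : Type*} [Countable ι] {p : ℝ} (hp : 0 < p) {L : X →L[ℂ] Y}
    (φ : ι → X →L[ℂ] ℂ) (e : ι → Y) (hs : Summable fun i => (‖φ i‖ * ‖e i‖) ^ p)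
    (h : ∀ f, HasSum (fun i => φ i f • e i) (L f)) : IsPowNuclear p L := by
  obtain ⟨j, hj⟩ := exists_injective_nat ι
  refine ⟨Function.extend j (fun i => ((‖φ i‖ * ‖e i‖ : ℝ) : ℂ)) 0,
    Function.extend j (fun i => ((‖φ i‖⁻¹ : ℝ) : ℂ) • φ i) 0,
    Function.extend j (fun i => ((‖e i‖⁻¹ : ℝ) : ℂ) • e i) 0, fun n => ?_, fun n => ?_, ?_,
    fun f => ?_⟩
  · by_cases hn : ∃ i, j i = n
    · obtain ⟨i, rfl⟩ := hn
      rw [hj.extend_apply, norm_smul, norm_real, norm_inv, norm_norm]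
      exact inv_mul_le_one
    · rw [Function.extend_apply' _ _ _ hn]
      simp
  · by_cases hn : ∃ i, j i = n
    · obtain ⟨i, rfl⟩ := hn
      rw [hj.extend_apply, norm_smul, norm_real, norm_inv, norm_norm]
      exact inv_mul_le_one
    · rw [Function.extend_apply' _ _ _ hn]
      simp
  · refine (hj.summable_iff fun n hn => ?_).1 (hs.congr fun i => ?_)
    · rw [Function.extend_apply' _ _ _ hn]
      simp [Real.zero_rpow hp.ne']
    · simp [hj.extend_apply]
  · refine (hj.hasSum_iff fun n hn => ?_).1 ((h f).congr_fun fun i => ?_)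
    · rw [Function.extend_apply' _ _ _ hn]
      simp
    · simp only [Function.comp_apply, hj.extend_apply, smul_apply, smul_smul,
        smul_eq_mul]
      by_cases h1 : φ i = 0
      · simp [h1]
      by_cases h2 : e i = 0
      · simp [h2]
      have h1' : ((‖φ i‖ : ℝ) : ℂ) ≠ 0 := by simpa using h1
      have h2' : ((‖e i‖ : ℝ) : ℂ) ≠ 0 := by simpa using h2
      congr 1
      push_cast
      field_simp

theorem IsPowNuclear.add {p : ℝ} (hp : 0 < p) {L M : X →L[ℂ] Y} (hL : IsPowNuclear p L)
    (hM : IsPowNuclear p M) : IsPowNuclear p (L + M) := by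
  obtain ⟨a, φ, e, hφ, he, hs, h⟩ := hL
  obtain ⟨a', φ', e', hφ', he', hs', h'⟩ := hM
  have key : ∀ (a : ℕ → ℂ) (φ : ℕ → X →L[ℂ] ℂ) (e : ℕ → Y), (∀ n, ‖φ n‖ ≤ 1) →
      (∀ n, ‖e n‖ ≤ 1) → Summable (fun n => ‖a n‖ ^ p) →
      Summable fun n => (‖a n • φ n‖ * ‖e n‖) ^ p := by
    intro a φ e hφ he hs
    refine hs.of_nonneg_of_le (fun n => by positivity) fun n => ?_
    refine Real.rpow_le_rpow (by positivity) ?_ hp.le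
    rw [norm_smul, mul_assoc]
    exact mul_le_of_le_one_right (norm_nonneg _) (mul_le_one₀ (hφ n) (norm_nonneg _) (he n))
  refine isPowNuclear_of_hasSum hp (Sum.elim (fun n => a n • φ n) (fun n => a' n • φ' n))
    (Sum.elim e e') ?_ fun f => ?_
  · exact Summable.sum _ (key a φ e hφ he hs) (key a' φ' e' hφ' he' hs')
  · exact HasSum.sum (h f) (h' f)

theorem IsPowNuclear.comp {W : Type*} [NormedAddCommGroup W] [NormedSpace ℂ W] {p : ℝ}
    (hp : 0 < p) {L : X →L[ℂ] Y} (hL : IsPowNuclear p L) (A : Y →L[ℂ] Z) (B : W →L[ℂ] X) :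
    IsPowNuclear p (A ∘L L ∘L B) := by
  obtain ⟨a, φ, e, hφ, he, hs, h⟩ := hL
  refine isPowNuclear_of_hasSum hp (fun n => a n • (φ n ∘L B)) (fun n => A (e n)) ?_ fun f => ?_
  · refine (hs.mul_right ((‖A‖ * ‖B‖) ^ p)).of_nonneg_of_le (fun n => by positivity) fun n => ?_
    rw [← Real.mul_rpow (norm_nonneg _) (by positivity)]
    refine Real.rpow_le_rpow (by positivity) ?_ hp.le
    have h1 : ‖φ n ∘L B‖ ≤ ‖B‖ :=
      (ContinuousLinearMap.opNorm_comp_le _ _).trans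
        (mul_le_of_le_one_left (norm_nonneg _) (hφ n))
    have h2 : ‖A (e n)‖ ≤ ‖A‖ :=
      (A.le_opNorm _).trans (mul_le_of_le_one_right (norm_nonneg _) (he n))
    rw [norm_smul]
    calc ‖a n‖ * ‖φ n ∘L B‖ * ‖A (e n)‖ ≤ ‖a n‖ * ‖B‖ * ‖A‖ := by gcongr
      _ = _ := by ring
  · have := (h (B f)).mapL A
    simpa using this

theorem isPowNuclear_zero {p : ℝ} (hp : 0 < p) : IsPowNuclear p (0 : X →L[ℂ] Y) :=
  ⟨0, 0, 0, by simp, by simp, by simp [Real.zero_rpow hp.ne', summable_zero],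
    fun f => by simp⟩

theorem IsNuclearOfOrderZero.add {L M : X →L[ℂ] Y} (hL : IsNuclearOfOrderZero L)
    (hM : IsNuclearOfOrderZero M) : IsNuclearOfOrderZero (L + M) :=
  fun p hp hp' => (hL p hp hp').add hp (hM p hp hp')

theorem IsNuclearOfOrderZero.comp {W : Type*} [NormedAddCommGroup W] [NormedSpace ℂ W]
    {L : X →L[ℂ] Y} (hL : IsNuclearOfOrderZero L) (A : Y →L[ℂ] Z) (B : W →L[ℂ] X) :
    IsNuclearOfOrderZero (A ∘L L ∘L B) :=
  fun p hp hp' => (hL p hp hp').comp hp A B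

theorem IsNuclearOfOrderZero.sum {ι : Type*} (s : Finset ι) {L : ι → X →L[ℂ] Y}
    (h : ∀ i ∈ s, IsNuclearOfOrderZero (L i)) : IsNuclearOfOrderZero (∑ i ∈ s, L i) := by
  induction s using Finset.cons_induction with
  | empty => exact fun p hp _ => by simpa using isPowNuclear_zero hp
  | cons i s hi ih =>
    rw [Finset.sum_cons]
    exact (h i (by simp)).add (ih fun k hk => h k (by simp [hk]))

variable {V : Type*} [NormedAddCommGroup V] [InnerProductSpace ℂ V] [FiniteDimensional ℂ V]
  {D D' : Disc}

/-- A weighted composition operator is nuclear of order `0` if it is induced by a map into the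
open disc. -/
theorem isNuclearOfOrderZero_wcomp {γ : ℂ → ℂ} (hγ : IsBranch D D' γ)
    (hmaps : Set.MapsTo γ D.cl D'.opn) (A : V →L[ℂ] V) {g : ℂ → ℂ} (hg : IsHol D g) :
    IsNuclearOfOrderZero (wcomp hγ A hg) := by
  intro p hp _
  have : CompleteSpace V := FiniteDimensional.complete ℂ V
  obtain ⟨M, hM, hgM⟩ := hg.exists_bound
  -- By compactness the image of the closed disc stays at distance at most `R` from the center, with
  -- `R` below the radius. For `R < r < D'.radius`, the Taylor terms at the center are bounded by a
  -- multiple of `(R / r) ^ m`, which is summable to every positive power.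
  obtain ⟨R, hR, hγR⟩ : ∃ R, R < D'.radius ∧ ∀ z ∈ D.cl, ‖γ z - D'.center‖ ≤ R := by
    obtain ⟨z₀, hz₀, hmax⟩ := D.isCompact_cl.exists_isMaxOn
      ⟨D.center, D.opn_subset_cl D.center_mem_opn⟩
      ((hγ.isHol.1.sub (continuousOn_const (c := D'.center))).norm)
    exact ⟨_, mem_ball_iff_norm.1 (hmaps hz₀), fun z hz => hmax hz⟩
  have hR0 : 0 ≤ R := (norm_nonneg _).trans
    (hγR _ (D.opn_subset_cl D.center_mem_opn))
  obtain ⟨r, hRr, hr⟩ := exists_between hR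
  have hr0 : 0 < r := hR0.trans_lt hRr
  obtain ⟨a, ha, hsum⟩ := exists_taylor_coeff (V := V) (D := D') (p := D'.center) hr0
    (closedBall_subset_ball hr)
  let b := stdOrthonormalBasis ℂ V
  have hhol : ∀ (m : ℕ) (v : V), IsHol D (fun z => (g z * (γ z - D'.center) ^ m) • v) := fun m v =>
    (hg.mul ((hγ.isHol.sub (isHol_const D'.center)).pow m)).smul (isHol_const v)
  have hφ : ∀ m l, ‖innerSL ℂ (b l) ∘L A ∘L a m‖ ≤ ‖A‖ * (r⁻¹) ^ m := by
    intro m l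
    refine (ContinuousLinearMap.opNorm_comp_le _ _).trans ?_
    rw [innerSL_apply_norm, b.norm_eq_one, one_mul]
    exact (ContinuousLinearMap.opNorm_comp_le _ _).trans (by gcongr; exact ha m)
  have he : ∀ m l, ‖(hhol m (b l)).toHol‖ ≤ M * R ^ m := by
    intro m l
    refine norm_toHol_le _ (by positivity) fun z hz => ?_
    rw [norm_smul, b.norm_eq_one, mul_one, norm_mul, norm_pow]
    gcongr
    · exact hgM z hz
    · exact hγR z hz
  have hq0 : 0 ≤ R / r := by positivity
  have hq1 : R / r < 1 := (div_lt_one hr0).2 hRr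
  have hle : ∀ x : ℕ × Fin (Module.finrank ℂ V),
      ‖innerSL ℂ (b x.2) ∘L A ∘L a x.1‖ * ‖(hhol x.1 (b x.2)).toHol‖
        ≤ (‖A‖ * M) * (R / r) ^ x.1 := by
    intro x
    calc _ ≤ (‖A‖ * (r⁻¹) ^ x.1) * (M * R ^ x.1) := by
          gcongr
          exacts [hφ _ _, he _ _]
      _ = _ := by rw [div_eq_mul_inv, mul_pow]; ring
  have hsummable : ∀ t : ℝ, 0 < t →
      Summable fun x : ℕ × Fin (Module.finrank ℂ V) => ((‖A‖ * M) * (R / r) ^ x.1) ^ t := by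
    intro t ht
    have h1 : Summable fun m : ℕ => ((R / r) ^ t) ^ m :=
      summable_geometric_of_lt_one (by positivity) (Real.rpow_lt_one hq0 hq1 ht)
    have h2 := (h1.mul_left ((‖A‖ * M) ^ t)).mul_of_nonneg
      (g := fun _ : Fin (Module.finrank ℂ V) => (1 : ℝ)) Summable.of_finite
      (fun m => by positivity) (fun _ => zero_le_one)
    refine h2.congr fun x => ?_
    rw [mul_one, Real.mul_rpow (x := ‖A‖ * M) (by positivity) (by positivity),
      ← Real.rpow_natCast, ← Real.rpow_natCast, ← Real.rpow_mul hq0, ← Real.rpow_mul hq0,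
      mul_comm t]
  refine isPowNuclear_of_hasSum hp
    (fun x : ℕ × Fin (Module.finrank ℂ V) => innerSL ℂ (b x.2) ∘L A ∘L a x.1)
    (fun x => (hhol x.1 (b x.2)).toHol) ?_ fun f => ?_
  · exact (hsummable p hp).of_nonneg_of_le (fun x => by positivity) fun x =>
      Real.rpow_le_rpow (by positivity) (hle x) hp.le
  · have hs : Summable fun x : ℕ × Fin (Module.finrank ℂ V) =>
        ‖(innerSL ℂ (b x.2) ∘L A ∘L a x.1) f • (hhol x.1 (b x.2)).toHol‖ := by
      refine ((hsummable 1 one_pos).mul_right ‖f‖).of_nonneg_of_le (fun x => norm_nonneg _)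
        fun x => ?_
      rw [norm_smul, Real.rpow_one]
      calc _ ≤ (‖innerSL ℂ (b x.2) ∘L A ∘L a x.1‖ * ‖f‖) * ‖(hhol x.1 (b x.2)).toHol‖ := by
            gcongr
            exact ContinuousLinearMap.le_opNorm _ _
        _ = (‖innerSL ℂ (b x.2) ∘L A ∘L a x.1‖ * ‖(hhol x.1 (b x.2)).toHol‖) * ‖f‖ := by ring
        _ ≤ _ := mul_le_mul_of_nonneg_right (hle x) (norm_nonneg _)
    refine hasSum_of_pointwise hs fun z => ?_
    have hz := hsum f (γ z) ((hγR z z.2).trans_lt hRr)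
    have hz' := (hz.mapL A).const_smul (g z)
    rw [wcomp_apply]
    have hfib := (hs.of_norm.hasSum.mapL (evalAt z))
    have hfib' := hfib.prod_fiberwise fun m => hasSum_fintype _
    suffices hfe : (fun m => ∑ l, evalAt z ((innerSL ℂ (b l) ∘L A ∘L a m) f •
        (hhol m (b l)).toHol)) = fun m => g z • A ((γ z - D'.center) ^ m • a m f) by
      have := (hfe ▸ hfib').unique hz'
      rw [← this]
      exact hfib
    funext m
    rw [map_smul]
    conv_rhs => rw [← b.sum_repr' (A (a m f)), Finset.smul_sum, Finset.smul_sum]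
    refine Finset.sum_congr rfl fun l _ => ?_
    rw [map_smul, evalAt_apply, IsHol.toHol_apply]
    simp only [ContinuousLinearMap.comp_apply, innerSL_apply_apply, smul_smul]
    congr 1
    ring

end Nuclear

/-! ### Families of operators with simple poles -/

section SimplePoles

variable {X Y Z : Type*} [NormedAddCommGroup X] [NormedSpace ℂ X] [NormedAddCommGroup Y]
  [NormedSpace ℂ Y] [NormedAddCommGroup Z] [NormedSpace ℂ Z]

/-- The family `L` is analytic outside of `{(1 - k) / 2 : k ∈ ℕ}` and has at most simple poles with
residues of rank at most `r`. -/
structure HasSimplePoles (r : ℕ) (L : ℂ → X →L[ℂ] Y) : Prop where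
  analyticAt : ∀ s₀ : ℂ, (∀ k : ℕ, s₀ ≠ (1 - (k : ℂ)) / 2) → AnalyticAt ℂ L s₀
  exists_residue : ∀ s₀ : ℂ, ∃ (R : X →L[ℂ] Y) (B : ℂ → X →L[ℂ] Y),
    R.toLinearMap.rank ≤ r ∧ AnalyticAt ℂ B s₀ ∧
      ∀ᶠ s in 𝓝[≠] s₀, L s = (s - s₀)⁻¹ • R + B s

theorem hasSimplePoles_of_analyticAt {L : ℂ → X →L[ℂ] Y} (h : ∀ s, AnalyticAt ℂ L s) :
    HasSimplePoles 0 L :=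
  ⟨fun s _ => h s, fun s => ⟨0, L, by simp, h s, by simp⟩⟩

theorem HasSimplePoles.mono {r r' : ℕ} {L : ℂ → X →L[ℂ] Y} (h : HasSimplePoles r L)
    (hr : r ≤ r') : HasSimplePoles r' L :=
  ⟨h.1, fun s => by
    obtain ⟨R, B, h1, h2, h3⟩ := h.2 s
    exact ⟨R, B, h1.trans (by exact_mod_cast hr), h2, h3⟩⟩

theorem HasSimplePoles.add {r r' : ℕ} {L M : ℂ → X →L[ℂ] Y} (hL : HasSimplePoles r L)
    (hM : HasSimplePoles r' M) : HasSimplePoles (r + r') (fun s => L s + M s) := by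
  refine ⟨fun s hs => (hL.1 s hs).add (hM.1 s hs), fun s => ?_⟩
  obtain ⟨R, B, h1, h2, h3⟩ := hL.2 s
  obtain ⟨R', B', h1', h2', h3'⟩ := hM.2 s
  refine ⟨R + R', fun s => B s + B' s, ?_, h2.add h2', ?_⟩
  · rw [ContinuousLinearMap.toLinearMap_add, Nat.cast_add]
    exact (LinearMap.rank_add_le _ _).trans (add_le_add h1 h1')
  · filter_upwards [h3, h3'] with t ht ht'
    rw [ht, ht', smul_add]
    abel

theorem HasSimplePoles.sum {ι : Type*} (S : Finset ι) {r : ι → ℕ} {L : ι → ℂ → X →L[ℂ] Y}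
    (h : ∀ i ∈ S, HasSimplePoles (r i) (L i)) :
    HasSimplePoles (∑ i ∈ S, r i) (fun s => ∑ i ∈ S, L i s) := by
  induction S using Finset.cons_induction with
  | empty => exact hasSimplePoles_of_analyticAt fun s => by simpa using analyticAt_const
  | cons i S hi ih =>
    simp only [Finset.sum_cons]
    exact (h i (by simp)).add (ih fun k hk => h k (by simp [hk]))

theorem rank_comp_comp_le {X₀ : Type*} [NormedAddCommGroup X₀] [NormedSpace ℂ X₀]
    (A : Y →L[ℂ] Z) (R : X →L[ℂ] Y) (B : X₀ →L[ℂ] X) {r : ℕ} (h : R.toLinearMap.rank ≤ r) :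
    (A ∘L R ∘L B).toLinearMap.rank ≤ r := by
  have h1 := LinearMap.lift_rank_comp_le_right (R ∘L B).toLinearMap A.toLinearMap
  have h2 : (R ∘L B).toLinearMap.rank ≤ r :=
    (LinearMap.rank_comp_le_left B.toLinearMap R.toLinearMap).trans h
  have h3 := h1.trans (Cardinal.lift_le.2 h2)
  rw [Cardinal.lift_natCast, Cardinal.lift_le_nat_iff] at h3
  exact h3

theorem analyticAt_clm_comp {M : ℂ → Y →L[ℂ] Z} {L : ℂ → X →L[ℂ] Y} {s : ℂ}
    (hM : AnalyticAt ℂ M s) (hL : AnalyticAt ℂ L s) : AnalyticAt ℂ (fun t => M t ∘L L t) s :=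
  ((ContinuousLinearMap.compL ℂ X Y Z).analyticAt_bilinear (M s, L s)).comp₂ hM hL

/-- Writing `M t = M s + (t - s) • dslope M s t` moves the variation of `M` into the holomorphic
part, so the residue is `M s ∘L R ∘L B` and its rank does not grow. -/
theorem HasSimplePoles.comp {X₀ : Type*} [NormedAddCommGroup X₀] [NormedSpace ℂ X₀]
    {r : ℕ} {L : ℂ → X →L[ℂ] Y} (hL : HasSimplePoles r L) {M : ℂ → Y →L[ℂ] Z}
    (hM : ∀ s, AnalyticAt ℂ M s) (B : X₀ →L[ℂ] X) :
    HasSimplePoles r (fun s => M s ∘L L s ∘L B) := by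
  refine ⟨fun s hs => ?_, fun s => ?_⟩
  · exact analyticAt_clm_comp (hM s) (analyticAt_clm_comp (hL.1 s hs) analyticAt_const)
  · obtain ⟨R, C, h1, h2, h3⟩ := hL.2 s
    obtain ⟨P, hP⟩ := hM s
    have hdM : AnalyticAt ℂ (dslope M s) s := hP.has_fpower_series_dslope_fslope.analyticAt
    refine ⟨M s ∘L R ∘L B, fun t => dslope M s t ∘L R ∘L B + M t ∘L C t ∘L B,
      rank_comp_comp_le _ _ _ h1,
      (analyticAt_clm_comp hdM analyticAt_const).add
        (analyticAt_clm_comp (hM s) (analyticAt_clm_comp h2 analyticAt_const)), ?_⟩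
    filter_upwards [h3, self_mem_nhdsWithin] with t ht hts
    have hts' : t - s ≠ 0 := sub_ne_zero.2 hts
    have hMt : M t = M s + (t - s) • dslope M s t := by rw [sub_smul_dslope]; abel
    rw [ht]
    ext f
    simp only [ContinuousLinearMap.comp_apply, add_apply, smul_apply, map_add, map_smul]
    rw [hMt]
    simp only [add_apply, smul_apply, smul_add, smul_smul, inv_mul_cancel₀ hts', one_smul]
    abel

theorem HasSimplePoles.comp_const {X₀ : Type*} [NormedAddCommGroup X₀] [NormedSpace ℂ X₀]
    {r : ℕ} {L : ℂ → X →L[ℂ] Y} (hL : HasSimplePoles r L) (A : Y →L[ℂ] Z) (B : X₀ →L[ℂ] X) :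
    HasSimplePoles r (fun s => A ∘L L s ∘L B) :=
  hL.comp (M := fun _ => A) (fun _ => analyticAt_const) B

theorem HasSimplePoles.meromorphicAt {r : ℕ} {L : ℂ → X →L[ℂ] Y} (h : HasSimplePoles r L)
    (s : ℂ) : MeromorphicAt L s := by
  obtain ⟨R, B, -, hB, hev⟩ := h.exists_residue s
  have h1 : MeromorphicAt (fun t : ℂ => (t - s)⁻¹ • R + B t) s :=
    (((MeromorphicAt.id s).sub (MeromorphicAt.const s s)).inv.smul (MeromorphicAt.const R s)).add
      hB.meromorphicAt
  exact h1.congr (hev.mono fun t ht => ht.symm)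

/-- The normal form of a family with at most simple poles. -/
theorem HasSimplePoles.exists_normalForm [CompleteSpace Y] {r : ℕ} {L : ℂ → X →L[ℂ] Y}
    (h : HasSimplePoles r L) :
    ∃ L' : ℂ → X →L[ℂ] Y, (∀ s, (∀ k : ℕ, s ≠ (1 - (k : ℂ)) / 2) → L' s = L s) ∧
      (∀ s, MeromorphicAt L' s) ∧ (∀ s, 0 ≤ meromorphicOrderAt L' s → AnalyticAt ℂ L' s) ∧
      ∀ s₀, meromorphicOrderAt L' s₀ < 0 → meromorphicOrderAt L' s₀ = -1 ∧
        (∃ k : ℕ, s₀ = (1 - (k : ℂ)) / 2) ∧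
        ∃ U : Set ℂ, IsOpen U ∧ s₀ ∈ U ∧ ∃ A B : ℂ → X →L[ℂ] Y,
          DifferentiableOn ℂ A U ∧ DifferentiableOn ℂ B U ∧
          (∀ s ∈ U, s ≠ s₀ → L' s = (s - s₀)⁻¹ • A s + B s) ∧
          ∀ s ∈ U, (A s).toLinearMap.rank ≤ r := by
  have hmer : MeromorphicOn L Set.univ := fun s _ => h.meromorphicAt s
  have hnf : MeromorphicNFOn (toMeromorphicNFOn L Set.univ) Set.univ :=
    meromorphicNFOn_toMeromorphicNFOn L Set.univ
  have hord : ∀ s, meromorphicOrderAt (toMeromorphicNFOn L Set.univ) s = meromorphicOrderAt L s :=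
    fun s => meromorphicOrderAt_toMeromorphicNFOn hmer (Set.mem_univ s)
  -- The given family has arbitrary values at its singularities. Passing to the meromorphic normal
  -- form makes nonnegative order equivalent to analyticity, and changes nothing where the family is
  -- already analytic.
  refine ⟨toMeromorphicNFOn L Set.univ, fun s hs => ?_, fun s => ?_, fun s hs => ?_,
    fun s₀ hs₀ => ?_⟩
  · rw [toMeromorphicNFOn_eq_toMeromorphicNFAt hmer (Set.mem_univ s),
      toMeromorphicNFAt_eq_self.2 (h.1 s hs).meromorphicNFAt]
  · exact (hnf (Set.mem_univ s)).meromorphicAt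
  · exact (hnf (Set.mem_univ s)).meromorphicOrderAt_nonneg_iff_analyticAt.1 hs
  obtain ⟨R, B, hR, hB, hev⟩ := h.2 s₀
  have hev' : ∀ᶠ s in 𝓝[≠] s₀,
      toMeromorphicNFOn L Set.univ s = (s - s₀)⁻¹ • R + B s := by
    filter_upwards [hmer.toMeromorphicNFOn_eq_self_on_nhdsNE (Set.mem_univ s₀), hev] with s h1 h2
    rw [h1, h2]
  refine ⟨?_, ?_, ?_⟩
  -- A zero residue would make the order nonnegative; a nonzero one makes it exactly `-1`, because
  -- `(s - s₀) • L' s` tends to `R`.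
  · have hR0 : R ≠ 0 := by
      rintro rfl
      refine not_le_of_gt hs₀ ?_
      rw [meromorphicOrderAt_congr (f₂ := B) (hev'.mono fun s hs => by simpa using hs)]
      exact hB.meromorphicOrderAt_nonneg
    refine (meromorphicOrderAt_eq_int_iff (n := -1) (hnf (Set.mem_univ s₀)).meromorphicAt).2
      ⟨fun s => R + (s - s₀) • B s, ?_, by simpa using hR0, ?_⟩
    · exact analyticAt_const.add ((analyticAt_id.sub analyticAt_const).smul hB)
    · filter_upwards [hev', self_mem_nhdsWithin] with s hs hne
      have hne' : s - s₀ ≠ 0 := sub_ne_zero.2 hne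
      rw [hs, zpow_neg_one, smul_add, smul_smul, inv_mul_cancel₀ hne', one_smul]
  · by_contra hk
    push Not at hk
    rw [hord] at hs₀
    exact not_le_of_gt hs₀ (h.1 s₀ hk).meromorphicOrderAt_nonneg
  · obtain ⟨U, hU, hUo, hU0⟩ := _root_.eventually_nhds_iff.1
      (hB.eventually_analyticAt.and (eventually_nhdsWithin_iff.1 hev'))
    -- The numerator may be taken constant, equal to the residue.
    exact ⟨U, hUo, hU0, fun _ => R, B, differentiableOn_const _,
      fun s hs => (hU s hs).1.differentiableAt.differentiableWithinAt,
      fun s hs hne => (hU s hs).2 hne, fun _ _ => hR⟩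

end SimplePoles

/-! ### Periodic zeta functions -/

section Zeta

/-- The function $(\sigma-1)\zeta(\sigma)$, given the value $1$ at $\sigma=1$, is entire; `G` is its
difference quotient at $1$. -/
theorem exists_riemannZeta_eq :
    ∃ G : ℂ → ℂ, Differentiable ℂ G ∧ ∀ σ, σ ≠ 1 → riemannZeta σ = 1 / (σ - 1) + G σ := by
  let Y : ℂ → ℂ := Function.update (fun σ => (σ - 1) * riemannZeta σ) 1 1
  have hY : DifferentiableOn ℂ Y Set.univ := by
    refine (differentiableOn_compl_singleton_and_continuousAt_iff (c := 1) univ_mem).1 ⟨?_, ?_⟩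
    · intro σ hσ
      have hσ' : σ ≠ 1 := by simpa using hσ.2
      have h1 : DifferentiableAt ℂ (fun σ => (σ - 1) * riemannZeta σ) σ :=
        (differentiableAt_id.sub_const 1).mul (differentiableAt_riemannZeta hσ')
      refine (h1.congr_of_eventuallyEq ?_).differentiableWithinAt
      filter_upwards [isOpen_ne.mem_nhds hσ'] with x hx
      exact Function.update_of_ne hx _ _
    · exact continuousAt_update_same.2 riemannZeta_residue_one
  refine ⟨dslope Y 1, differentiableOn_univ.1 ((differentiableOn_dslope univ_mem).2 hY),
    fun σ hσ => ?_⟩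
  have h0 : σ - 1 ≠ 0 := sub_ne_zero.2 hσ
  rw [dslope_of_ne _ hσ, slope_def_field]
  simp only [Y, Function.update_self, Function.update_of_ne hσ]
  field_simp
  ring

/-- The analytic continuation of the tail of a periodic zeta function. -/
theorem exists_periodicZeta_tail {ε : ℂ} (hε : ‖ε‖ = 1) (n₀ : ℕ) :
    ∃ (ρ : ℂ) (G : ℂ → ℂ), (ε ≠ 1 → ρ = 0) ∧ Differentiable ℂ G ∧
      ∀ σ : ℂ, 1 < σ.re →
        HasSum (fun n : ℕ => ε ^ (n + n₀) * ((n + n₀ : ℕ) : ℂ) ^ (-σ)) (ρ / (σ - 1) + G σ) := by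
  obtain ⟨α, hα⟩ : ∃ α : ℝ, ε = Complex.exp (2 * Real.pi * I * α) := by
    refine ⟨arg ε / (2 * Real.pi), ?_⟩
    have h := norm_mul_exp_arg_mul_I ε
    rw [hε, ofReal_one, one_mul] at h
    rw [← h]
    congr 1
    have : (Real.pi : ℂ) ≠ 0 := by exact_mod_cast Real.pi_ne_zero
    rw [h]
    push_cast
    field_simp
  obtain ⟨ρ, G, hρ, hG, hz⟩ : ∃ (ρ : ℂ) (G : ℂ → ℂ), (ε ≠ 1 → ρ = 0) ∧ Differentiable ℂ G ∧
      ∀ σ, σ ≠ 1 → HurwitzZeta.expZeta α σ = ρ / (σ - 1) + G σ := by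
    by_cases h0 : (α : UnitAddCircle) = 0
    · obtain ⟨G, hG, h⟩ := exists_riemannZeta_eq
      refine ⟨1, G, fun h1 => ?_, hG, fun σ hσ => ?_⟩
      · obtain ⟨n, hn⟩ := (AddCircle.coe_eq_zero_iff (p := (1 : ℝ)) (x := α)).1 h0
        refine absurd ?_ h1
        rw [hα, ← hn, ← Complex.exp_int_mul_two_pi_mul_I n]
        congr 1
        push_cast
        simp
        ring
      · rw [h0, HurwitzZeta.expZeta_zero, h σ hσ]
    · exact ⟨0, HurwitzZeta.expZeta α, fun _ => rfl,
        HurwitzZeta.differentiable_expZeta_of_ne_zero h0, fun σ _ => by simp⟩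
  have hpow : ∀ n : ℕ, Complex.exp (2 * Real.pi * I * α * n) = ε ^ n := by
    intro n
    rw [hα, ← Complex.exp_nat_mul]
    congr 1
    ring
  -- The term `i = 0` is set to `0`: that is its value for `σ ≠ 0`, whereas `0 ^ (-σ)` jumps at `σ =
  -- 0` and would destroy differentiability.
  refine ⟨ρ, fun σ => G σ - ∑ i ∈ Finset.range n₀, if i = 0 then 0 else ε ^ i * (i : ℂ) ^ (-σ),
    hρ, ?_, fun σ hσ => ?_⟩
  · refine hG.sub (Differentiable.fun_sum fun i _ => ?_)
    by_cases hi : i = 0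
    · simp [hi]
    · simp only [hi, if_false]
      have hi' : (i : ℂ) ≠ 0 := by exact_mod_cast hi
      exact (differentiable_id.neg.const_cpow (Or.inl hi')).const_mul _
  · have hσ1 : σ ≠ 1 := by rintro rfl; simp at hσ
    have hσ0 : σ ≠ 0 := by rintro rfl; simp at hσ; linarith
    have h := (hasSum_nat_add_iff' n₀).2 (HurwitzZeta.hasSum_expZeta_of_one_lt_re α hσ)
    rw [hz σ hσ1, add_sub_assoc] at h
    have hfin : (∑ i ∈ Finset.range n₀, if i = 0 then 0 else ε ^ i * (i : ℂ) ^ (-σ)) =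
        ∑ i ∈ Finset.range n₀, Complex.exp (2 * Real.pi * I * α * i) / (i : ℂ) ^ σ := by
      refine Finset.sum_congr rfl fun i _ => ?_
      by_cases hi : i = 0
      · simp [hi, hσ0]
      · rw [if_neg hi, hpow, cpow_neg, div_eq_mul_inv]
    beta_reduce
    rw [hfin]
    refine h.congr_fun fun n => ?_
    rw [hpow, cpow_neg, div_eq_mul_inv]

theorem choose_succ_eq (a : ℂ) (i : ℕ) :
    Ring.choose a (i + 1) = Ring.choose a i * ((a - i) / (i + 1)) := by
  rw [Ring.choose_eq_smul, Ring.choose_eq_smul, descPochhammer_succ_right, Polynomial.smeval_mul,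
    Polynomial.smeval_sub, Polynomial.smeval_X, Polynomial.smeval_natCast, Nat.factorial_succ]
  have h1 : (i.factorial : ℂ) ≠ 0 := by exact_mod_cast i.factorial_ne_zero
  have h2 : (i + 1 : ℂ) ≠ 0 := by exact_mod_cast i.succ_ne_zero
  simp only [smul_eq_mul, pow_one, pow_zero, nsmul_eq_mul, mul_one]
  push_cast
  field_simp

/-- The successive factors satisfy $|a-i|/(i+1)\le(M+i+1)/(i+1)$, and the product of the latter is
the ordinary binomial coefficient $\binom{M+i}{i}$. -/
theorem norm_choose_le {a : ℂ} {M : ℕ} (ha : ‖a‖ ≤ M) (i : ℕ) :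
    ‖Ring.choose a i‖ ≤ 2 ^ (M + i) := by
  have key : ‖Ring.choose a i‖ ≤ ((M + i).choose i : ℝ) := by
    induction i with
    | zero => simp
    | succ i ih =>
      rw [choose_succ_eq, norm_mul, norm_div]
      have h1 : ‖a - i‖ ≤ M + i := (norm_sub_le _ _).trans (by simpa using ha)
      have h2 : ‖(i + 1 : ℂ)‖ = i + 1 := by
        rw [← Nat.cast_succ, Complex.norm_natCast, Nat.cast_succ]
      have h3 : ((M + i).choose i : ℝ) * ((M + i + 1) / (i + 1)) =
          ((M + (i + 1)).choose (i + 1) : ℝ) := by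
        have h4 : (i + 1 : ℝ) ≠ 0 := by positivity
        have h5 := Nat.add_one_mul_choose_eq (M + i) i
        have h6 : ((M + i + 1 : ℕ) : ℝ) * ((M + i).choose i : ℝ) =
          ((M + i + 1).choose (i + 1) : ℝ) * ((i + 1 : ℕ) : ℝ) := by exact_mod_cast h5
        rw [← add_assoc]
        push_cast at h6
        field_simp
        linarith
      rw [h2, ← h3]
      gcongr
      linarith
  refine key.trans ?_
  exact_mod_cast Nat.choose_le_two_pow _ _

theorem differentiable_choose_neg (i : ℕ) : Differentiable ℂ fun w : ℂ => Ring.choose (-w) i := by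
  induction i with
  | zero => simp
  | succ i ih =>
    simp only [choose_succ_eq]
    exact ih.mul ((differentiable_id.neg.sub_const _).div_const _)

/-- The functions `w ↦ binom (-w) i * ∑_{n ≥ n₀} ε ^ n n ^ (-w - i)`: continuation and bounds. -/
theorem exists_zeta_kernel {ε : ℂ} (hε : ‖ε‖ = 1) {n₀ : ℕ} (hn₀ : 1 ≤ n₀) :
    ∃ (K : ℕ → ℂ → ℂ) (ρ : ℂ) (G : ℂ → ℂ), (ε ≠ 1 → ρ = 0) ∧ Differentiable ℂ G ∧
      (∀ w, K 0 w = ρ / (w - 1) + G w) ∧ (∀ i, Differentiable ℂ (K (i + 1))) ∧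
      (∀ (i : ℕ) (w : ℂ), 1 < w.re → HasSum (fun n : ℕ => Ring.choose (-w) i *
        (ε ^ (n + n₀) * ((n + n₀ : ℕ) : ℂ) ^ (-(w + i)))) (K i w)) ∧
      ∀ N : ℕ, ∃ C, 0 ≤ C ∧ ∀ (i j : ℕ) (w : ℂ), ‖w‖ ≤ N → (i = 0 → N + 2 ≤ j) →
        ‖K i (w + j)‖ ≤ C * (4 / n₀) ^ (i + j) := by
  obtain ⟨ρ, G, hρ, hG, hsum⟩ := exists_periodicZeta_tail hε n₀
  have hn0 : (1 : ℝ) ≤ n₀ := by exact_mod_cast hn₀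
  have hn0' : (0 : ℝ) < n₀ := by linarith
  set Y : ℂ → ℂ := fun σ => ρ + (σ - 1) * G σ with hYdef
  have hY : Differentiable ℂ Y := by
    refine (differentiable_const ρ).add ((differentiable_id.sub_const 1).mul hG)
  have hYZ : ∀ σ, σ ≠ 1 → Y σ = (σ - 1) * (ρ / (σ - 1) + G σ) := by
    intro σ hσ
    have : σ - 1 ≠ 0 := sub_ne_zero.2 hσ
    simp only [Y]
    field_simp
  -- For positive index, $\binom{-w}{i+1}=-\frac{w+i}{i+1}\binom{-w}{i}$, and the factor $w+i$ is
  -- the denominator of the polar part at $\sigma=w+i+1$. It is absorbed into `Y`, so the kernel is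
  -- entire.
  let K : ℕ → ℂ → ℂ := fun i w => match i with
    | 0 => ρ / (w - 1) + G w
    | i + 1 => -(1 / (i + 1)) * Ring.choose (-w) i * Y (w + i + 1)
  -- bounds for the tails
  obtain ⟨C₂, hC₂, hZbound⟩ : ∃ C₂ : ℝ, 0 ≤ C₂ ∧ ∀ (N m : ℕ) (w : ℂ), ‖w‖ ≤ N → N + 2 ≤ m →
      ‖ρ / (w + m - 1) + G (w + m)‖ ≤ C₂ * n₀ ^ (N + 2) * (1 / n₀) ^ m := by
    have hs2 : Summable fun n : ℕ => 1 / ((n + n₀ : ℕ) : ℝ) ^ 2 :=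
      (summable_nat_add_iff (f := fun n : ℕ => 1 / (n : ℝ) ^ 2) n₀).2
        (Real.summable_one_div_nat_pow.2 one_lt_two)
    refine ⟨∑' n : ℕ, 1 / ((n + n₀ : ℕ) : ℝ) ^ 2, tsum_nonneg fun n => by positivity,
      fun N m w hw hm => ?_⟩
    -- With `m = N + 2 + k` the real part of the exponent is at least `k + 2`: two powers make the
    -- series converge, and the other `k` give the decay in `n₀`.
    obtain ⟨k, rfl⟩ := Nat.exists_eq_add_of_le hm
    have hre : (k : ℝ) + 2 ≤ (w + ((N + 2 + k : ℕ) : ℂ)).re := by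
      have h1 : -(N : ℝ) ≤ w.re := (neg_le_neg hw).trans (neg_le_of_abs_le (abs_re_le_norm w))
      rw [add_re, natCast_re]
      push_cast
      linarith
    have hgt : 1 < (w + ((N + 2 + k : ℕ) : ℂ)).re := by
      have : (0 : ℝ) ≤ k := k.cast_nonneg
      linarith
    have hH := hsum _ hgt
    rw [← hH.tsum_eq]
    have hle : ∀ n : ℕ, ‖ε ^ (n + n₀) * ((n + n₀ : ℕ) : ℂ) ^ (-(w + ((N + 2 + k : ℕ) : ℂ)))‖ ≤
        (1 / ((n + n₀ : ℕ) : ℝ) ^ 2) * (1 / n₀) ^ k := by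
      intro n
      have hpos : 0 < n + n₀ := by omega
      have h1 : (1 : ℝ) ≤ ((n + n₀ : ℕ) : ℝ) := by exact_mod_cast hpos
      rw [norm_mul, norm_pow, hε, one_pow, one_mul, norm_natCast_cpow_of_pos hpos, neg_re]
      calc ((n + n₀ : ℕ) : ℝ) ^ (-(w + ((N + 2 + k : ℕ) : ℂ)).re)
          ≤ ((n + n₀ : ℕ) : ℝ) ^ (-((2 + k : ℕ) : ℝ)) := by
            refine Real.rpow_le_rpow_of_exponent_le h1 ?_
            push_cast at *
            linarith
        _ = (1 / ((n + n₀ : ℕ) : ℝ) ^ 2) * (1 / ((n + n₀ : ℕ) : ℝ)) ^ k := by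
            rw [Real.rpow_neg (by positivity), Real.rpow_natCast, pow_add, one_div_pow, mul_inv,
              one_div, one_div]
        _ ≤ _ := by
            gcongr
            linarith [n.cast_nonneg (α := ℝ)]
    have := tsum_of_norm_bounded ((hs2.mul_right _).hasSum) hle
    rw [tsum_mul_right] at this
    refine this.trans (le_of_eq ?_)
    have h5 : (n₀ : ℝ) ^ (N + 2) * (1 / n₀) ^ (N + 2 + k) = (1 / n₀) ^ k := by
      rw [pow_add (1 / (n₀ : ℝ)), ← mul_assoc, ← mul_pow, mul_one_div_cancel hn0'.ne', one_pow,
        one_mul]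
    rw [mul_assoc, h5]
  have hYbound : ∀ N : ℕ, ∃ C₃ : ℝ, 0 ≤ C₃ ∧ ∀ (m : ℕ) (w : ℂ), ‖w‖ ≤ N →
      ‖Y (w + m)‖ ≤ C₃ * (2 / n₀) ^ m := by
    intro N
    obtain ⟨C, hC⟩ := (isCompact_closedBall (0 : ℂ) (2 * N + 2)).exists_bound_of_continuousOn
      hY.continuous.continuousOn
    have hC0 : 0 ≤ C := (norm_nonneg _).trans (hC 0 (mem_closedBall_self (by positivity)))
    -- The first summand treats `m < N + 2` by compactness; the second treats larger `m`, where the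
    -- linear factor $|w+m-1|\le(N+1)(m+1)$ costs at most $2^m$.
    refine ⟨C * n₀ ^ (N + 2) + (N + 1) * (C₂ * n₀ ^ (N + 2)), by positivity, fun m w hw => ?_⟩
    have h2m : (m + 1 : ℝ) ≤ 2 ^ m := by exact_mod_cast Nat.lt_two_pow_self (n := m)
    have hdm : (2 / (n₀ : ℝ)) ^ m = 2 ^ m * (1 / n₀) ^ m := by rw [← mul_pow]; ring
    rcases lt_or_ge m (N + 2) with hm | hm
    · have h1 : ‖Y (w + m)‖ ≤ C := by
        refine hC _ (mem_closedBall_zero_iff.2 ((norm_add_le _ _).trans ?_))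
        rw [Complex.norm_natCast]
        have : (m : ℝ) ≤ N + 2 := by exact_mod_cast hm.le
        linarith
      have h3 : (1 : ℝ) ≤ n₀ ^ (N + 2) * (1 / n₀) ^ m := by
        obtain ⟨k, hk⟩ := Nat.exists_eq_add_of_le hm.le
        rw [hk, pow_add, mul_right_comm, ← mul_pow, mul_one_div_cancel hn0'.ne', one_pow, one_mul]
        exact one_le_pow₀ hn0
      have h4 : (1 : ℝ) ≤ 2 ^ m := one_le_pow₀ one_le_two
      calc ‖Y (w + m)‖ ≤ C * (1 * 1) := by simpa using h1
        _ ≤ C * (2 ^ m * (n₀ ^ (N + 2) * (1 / n₀) ^ m)) := by gcongr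
        _ = C * n₀ ^ (N + 2) * (2 / n₀) ^ m := by rw [hdm]; ring
        _ ≤ _ := by
            gcongr
            exact le_add_of_nonneg_right (by positivity)
    · have hne : w + m ≠ 1 := by
        intro h
        have h1 : -(N : ℝ) ≤ w.re := (neg_le_neg hw).trans (neg_le_of_abs_le (abs_re_le_norm w))
        have h2 := congrArg re h
        have h3 : (N + 2 : ℝ) ≤ m := by exact_mod_cast hm
        rw [add_re, natCast_re, one_re] at h2
        linarith
      have h1 : ‖w + m - 1‖ ≤ (N + 1) * (m + 1) := by
        have : ‖w + m - 1‖ ≤ N + m + 1 := by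
          refine (norm_sub_le _ _).trans ?_
          rw [norm_one]
          gcongr
          refine (norm_add_le _ _).trans ?_
          rw [Complex.norm_natCast]
          gcongr
        refine this.trans ?_
        have : (0 : ℝ) ≤ N * m := by positivity
        linarith
      rw [hYZ _ hne, norm_mul]
      calc _ ≤ ((N + 1) * (m + 1)) * (C₂ * n₀ ^ (N + 2) * (1 / n₀) ^ m) := by
            gcongr
            exact hZbound N m w hw hm
        _ ≤ ((N + 1) * 2 ^ m) * (C₂ * n₀ ^ (N + 2) * (1 / n₀) ^ m) := by gcongr
        _ = (N + 1) * (C₂ * n₀ ^ (N + 2)) * (2 / n₀) ^ m := by rw [hdm]; ring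
        _ ≤ _ := by
            gcongr
            exact le_add_of_nonneg_left (by positivity)
  refine ⟨K, ρ, G, hρ, hG, fun w => rfl, fun i => ?_, fun i w hw => ?_, fun N => ?_⟩
  · exact ((differentiable_choose_neg i).const_mul _).mul
      (hY.comp ((differentiable_id.add_const _).add_const _))
  · have hre : 1 < (w + i).re := by
      rw [add_re, natCast_re]
      linarith [i.cast_nonneg (α := ℝ)]
    suffices hK : K i w = Ring.choose (-w) i * (ρ / (w + i - 1) + G (w + i)) by
      rw [hK]
      exact (hsum _ hre).mul_left (Ring.choose (-w) i)
    cases i with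
    | zero => simp [K]
    | succ i =>
      have hne : w + (i + 1 : ℕ) ≠ 1 := by
        intro h
        rw [h] at hre
        simp at hre
      have hne' : w + (i + 1 : ℕ) - 1 ≠ 0 := sub_ne_zero.2 hne
      have h2 : (i + 1 : ℂ) ≠ 0 := by exact_mod_cast i.succ_ne_zero
      simp only [K]
      rw [show w + i + 1 = w + (i + 1 : ℕ) by push_cast; ring, hYZ _ hne, choose_succ_eq]
      push_cast
      field_simp
      ring
  · obtain ⟨C₃, hC₃, hY3⟩ := hYbound N
    -- For positive index the binomial coefficient contributes at most `2 ^ (N + j + i)`; together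
    -- with the base `2 / n₀` from `Y` this gives `4 / n₀`.
    refine ⟨C₂ * n₀ ^ (N + 2) + 2 ^ N * C₃, by positivity, fun i j w hw hij => ?_⟩
    cases i with
    | zero =>
      have h := hZbound N j w hw (hij rfl)
      calc ‖K 0 (w + j)‖ ≤ C₂ * n₀ ^ (N + 2) * (1 / n₀) ^ j := h
        _ ≤ C₂ * n₀ ^ (N + 2) * (4 / n₀) ^ (0 + j) := by
            rw [zero_add]
            gcongr
            norm_num
        _ ≤ _ := by
            gcongr
            exact le_add_of_nonneg_right (by positivity)
    | succ i =>
      have h1 : ‖Ring.choose (-(w + j)) i‖ ≤ 2 ^ (N + j + i) := by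
        refine norm_choose_le ?_ i
        rw [norm_neg]
        refine (norm_add_le _ _).trans ?_
        rw [Complex.norm_natCast]
        push_cast
        gcongr
      have h2 : ‖Y (w + j + i + 1)‖ ≤ C₃ * (2 / n₀) ^ (i + 1 + j) := by
        convert hY3 (i + 1 + j) w hw using 3
        push_cast
        ring
      have h3 : ‖(-(1 / (i + 1)) : ℂ)‖ ≤ 1 := by
        rw [norm_neg, norm_div, norm_one, ← Nat.cast_succ, Complex.norm_natCast]
        exact div_le_one_of_le₀ (by push_cast; linarith [i.cast_nonneg (α := ℝ)]) (by positivity)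
      calc ‖K (i + 1) (w + j)‖ ≤ 1 * 2 ^ (N + j + i) * (C₃ * (2 / n₀) ^ (i + 1 + j)) := by
            simp only [K, norm_mul]
            gcongr
        _ ≤ 1 * 2 ^ (N + (i + 1 + j)) * (C₃ * (2 / n₀) ^ (i + 1 + j)) := by
            gcongr 1 * ?_ * _
            exact pow_le_pow_right₀ one_le_two (by omega)
        _ = 2 ^ N * C₃ * (4 / n₀) ^ (i + 1 + j) := by
            rw [one_mul, pow_add, show (4 / n₀ : ℝ) = 2 * (2 / n₀) by ring, mul_pow]
            ring
        _ ≤ _ := by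
            gcongr
            exact le_add_of_nonneg_left (by positivity)

end Zeta

/-! ### Series of operators with zeta coefficients -/

section KernelSeries

variable {X Y : Type*} [NormedAddCommGroup X] [NormedSpace ℂ X] [NormedAddCommGroup Y]
  [NormedSpace ℂ Y]

theorem summable_half_pow_rpow {C t : ℝ} (hC : 0 ≤ C) (ht : 0 < t) :
    Summable fun x : ℕ × ℕ => (C * (1 / 2) ^ (x.1 + x.2)) ^ t := by
  have h1 : Summable fun m : ℕ => ((1 / 2 : ℝ) ^ t) ^ m :=
    summable_geometric_of_lt_one (by positivity) (Real.rpow_lt_one (by norm_num) (by norm_num) ht)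
  have h2 := ((h1.mul_of_nonneg h1 (fun m => by positivity) fun m => by positivity)).mul_left (C ^ t)
  refine h2.congr fun x => ?_
  rw [Real.mul_rpow hC (by positivity), ← pow_add, ← Real.rpow_natCast, ← Real.rpow_natCast,
    ← Real.rpow_mul (by norm_num), ← Real.rpow_mul (by norm_num), mul_comm t]

theorem summable_half_pow (C : ℝ) : Summable fun x : ℕ × ℕ => C * (1 / 2 : ℝ) ^ (x.1 + x.2) := by
  have h1 : Summable fun m : ℕ => (1 / 2 : ℝ) ^ m :=
    summable_geometric_of_lt_one (by norm_num) (by norm_num)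
  have h2 := ((h1.mul_of_nonneg h1 (fun m => by positivity) fun m => by positivity)).mul_left C
  exact h2.congr fun x => by rw [pow_add]

/-- Bounds for the functions `K i (2 s + j)`, valid for all but finitely many `(j, i)`. -/
theorem norm_kernel_smul_le {K : ℕ → ℂ → ℂ} {x C C₀ : ℝ} (hx : 0 < x) {N : ℕ}
    (hK : ∀ (i j : ℕ) (w : ℂ), ‖w‖ ≤ N → (i = 0 → N + 2 ≤ j) →
      ‖K i (w + j)‖ ≤ C * x ^ (i + j)) {Q : ℕ × ℕ → X →L[ℂ] Y}
    (hQ : ∀ y, ‖Q y‖ ≤ C₀ * (1 / (2 * x)) ^ (y.1 + y.2)) {y : ℕ × ℕ}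
    (hy : y ∉ Finset.range (N + 2) ×ˢ ({0} : Finset ℕ)) {s : ℂ} (hs : ‖2 * s‖ ≤ N) :
    ‖K y.2 (2 * s + y.1)‖ * ‖Q y‖ ≤ C * C₀ * (1 / 2) ^ (y.1 + y.2) := by
  have h1 : ‖K y.2 (2 * s + y.1)‖ ≤ C * x ^ (y.2 + y.1) := by
    refine hK _ _ _ hs fun h0 => ?_
    by_contra hlt
    exact hy (Finset.mem_product.2 ⟨Finset.mem_range.2 (not_le.1 hlt), Finset.mem_singleton.2 h0⟩)
  have h2 : 0 ≤ C * x ^ (y.2 + y.1) := (norm_nonneg _).trans h1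
  calc _ ≤ (C * x ^ (y.2 + y.1)) * (C₀ * (1 / (2 * x)) ^ (y.1 + y.2)) := by
        gcongr
        exact hQ y
    _ = C * C₀ * (x * (1 / (2 * x))) ^ (y.1 + y.2) := by rw [mul_pow, add_comm y.2]; ring
    _ = _ := by
        congr 2
        field_simp

variable {K : ℕ → ℂ → ℂ} {x C₀ : ℝ} {Q : ℕ × ℕ → X →L[ℂ] Y}

theorem eventually_norm_kernel_smul_le (hx : 0 < x) (hC₀ : 0 ≤ C₀)
    (hK : ∀ N : ℕ, ∃ C, 0 ≤ C ∧ ∀ (i j : ℕ) (w : ℂ), ‖w‖ ≤ N → (i = 0 → N + 2 ≤ j) →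
      ‖K i (w + j)‖ ≤ C * x ^ (i + j))
    (hQ : ∀ y, ‖Q y‖ ≤ C₀ * (1 / (2 * x)) ^ (y.1 + y.2)) (s : ℂ) :
    ∃ C, 0 ≤ C ∧ ∀ᶠ y in cofinite,
      ‖K y.2 (2 * s + y.1)‖ * ‖Q y‖ ≤ C * (1 / 2) ^ (y.1 + y.2) := by
  obtain ⟨N, hN⟩ := exists_nat_ge ‖2 * s‖
  obtain ⟨C, hC, h⟩ := hK N
  refine ⟨C * C₀, by positivity, ?_⟩
  filter_upwards [(Finset.range (N + 2) ×ˢ ({0} : Finset ℕ)).finite_toSet.compl_mem_cofinite]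
    with y hy
  exact norm_kernel_smul_le hx h hQ (by simpa using hy) hN

/-- The estimate fails for at most finitely many indices, those with `i = 0` and small `j`. Hence
summability holds at every `s`, including the poles, where a term merely has a conventional value.
-/
theorem summable_kernel_smul [CompleteSpace Y] (hx : 0 < x) (hC₀ : 0 ≤ C₀)
    (hK : ∀ N : ℕ, ∃ C, 0 ≤ C ∧ ∀ (i j : ℕ) (w : ℂ), ‖w‖ ≤ N → (i = 0 → N + 2 ≤ j) →
      ‖K i (w + j)‖ ≤ C * x ^ (i + j))
    (hQ : ∀ y, ‖Q y‖ ≤ C₀ * (1 / (2 * x)) ^ (y.1 + y.2)) (s : ℂ) :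
    Summable fun y => K y.2 (2 * s + y.1) • Q y := by
  obtain ⟨C, -, h⟩ := eventually_norm_kernel_smul_le hx hC₀ hK hQ s
  refine Summable.of_norm_bounded_eventually (summable_half_pow C) ?_
  filter_upwards [h] with y hy
  rwa [norm_smul]

theorem analyticAt_two_mul_add (j : ℕ) (s : ℂ) : AnalyticAt ℂ (fun s : ℂ => 2 * s + j) s :=
  (analyticAt_const.mul analyticAt_id).add analyticAt_const

theorem analyticAt_kernel {ρ : ℂ} {G : ℂ → ℂ} (hG : Differentiable ℂ G)
    (hK0 : ∀ w, K 0 w = ρ / (w - 1) + G w) (hKd : ∀ i, Differentiable ℂ (K (i + 1)))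
    {s : ℂ} (y : ℕ × ℕ) (hy : y.2 = 0 → 2 * s + y.1 ≠ 1) :
    AnalyticAt ℂ (fun s => K y.2 (2 * s + y.1)) s := by
  obtain ⟨j, i⟩ := y
  cases i with
  | zero =>
    simp only [hK0]
    refine AnalyticAt.add (AnalyticAt.div analyticAt_const
      ((analyticAt_two_mul_add j s).sub analyticAt_const) (sub_ne_zero.2 (hy rfl))) ?_
    exact (hG.analyticAt _).fun_comp (analyticAt_two_mul_add j s)
  | succ i => exact ((hKd i).analyticAt _).fun_comp (analyticAt_two_mul_add j s)

/-- Only a term with index `(j, 0)` can be singular at `s₀`, and the hypothesis on `Q` removes it. A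
finite set containing all other possibly singular terms nearby is split off, and the rest converges
uniformly on a ball of radius `1`. -/
theorem analyticAt_tsum_kernel_smul [CompleteSpace Y] (hx : 0 < x) (hC₀ : 0 ≤ C₀)
    (hK : ∀ N : ℕ, ∃ C, 0 ≤ C ∧ ∀ (i j : ℕ) (w : ℂ), ‖w‖ ≤ N → (i = 0 → N + 2 ≤ j) →
      ‖K i (w + j)‖ ≤ C * x ^ (i + j))
    (hQ : ∀ y, ‖Q y‖ ≤ C₀ * (1 / (2 * x)) ^ (y.1 + y.2))
    {ρ : ℂ} {G : ℂ → ℂ} (hG : Differentiable ℂ G)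
    (hK0 : ∀ w, K 0 w = ρ / (w - 1) + G w) (hKd : ∀ i, Differentiable ℂ (K (i + 1)))
    {s₀ : ℂ} (hs₀ : ∀ j : ℕ, 2 * s₀ + j = 1 → Q (j, 0) = 0) :
    AnalyticAt ℂ (fun s => ∑' y, K y.2 (2 * s + y.1) • Q y) s₀ := by
  obtain ⟨N, hN⟩ := exists_nat_ge (2 * (‖s₀‖ + 1))
  obtain ⟨C, hC, hKN⟩ := hK N
  have hball : ∀ s ∈ ball s₀ 1, ‖2 * s‖ ≤ N := by
    intro s hs
    have h1 : ‖s‖ ≤ ‖s₀‖ + 1 := by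
      have := norm_le_norm_add_norm_sub' s s₀
      have h2 := mem_ball_iff_norm.1 hs
      linarith
    rw [norm_mul, Complex.norm_ofNat]
    linarith
  -- Since `‖2 * s‖ ≤ N` on the ball, an index `(j, 0)` outside `F` has `j ≥ N + 2`, so `2 * s + j`
  -- cannot equal `1` there.
  set F : Finset (ℕ × ℕ) := Finset.range (N + 2) ×ˢ ({0} : Finset ℕ) with hF
  have hsplit : (fun s => ∑' y, K y.2 (2 * s + y.1) • Q y) = fun s =>
      ∑ y ∈ F, K y.2 (2 * s + y.1) • Q y +
        ∑' y : ↑((F : Set (ℕ × ℕ))ᶜ), K y.1.2 (2 * s + y.1.1) • Q y := by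
    funext s
    exact (Summable.sum_add_tsum_compl (summable_kernel_smul hx hC₀ hK hQ s)).symm
  rw [hsplit]
  refine AnalyticAt.add ?_ ?_
  · refine Finset.analyticAt_fun_sum _ fun y _ => ?_
    by_cases h0 : y.2 = 0 → 2 * s₀ + y.1 ≠ 1
    · exact (analyticAt_kernel hG hK0 hKd y h0).smul analyticAt_const
    · push Not at h0
      obtain ⟨j, i⟩ := y
      obtain ⟨rfl, h0⟩ := h0
      simp only [hs₀ j h0, smul_zero]
      exact analyticAt_const
  · have hd : DifferentiableOn ℂ
        (fun s => ∑' y : ↑((F : Set (ℕ × ℕ))ᶜ), K y.1.2 (2 * s + y.1.1) • Q y) (ball s₀ 1) := by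
      refine differentiableOn_tsum_of_summable_norm
        (u := fun y : ↑((F : Set (ℕ × ℕ))ᶜ) => C * C₀ * (1 / 2) ^ (y.1.1 + y.1.2))
        ((summable_half_pow (C * C₀)).subtype _) (fun y s hs => ?_) isOpen_ball
        fun y s hs => ?_
      · refine ((analyticAt_kernel hG hK0 hKd y.1 fun h0 h1 => ?_).smul
          analyticAt_const).differentiableAt.differentiableWithinAt
        have hy : ¬ y.1.1 < N + 2 := fun hlt => y.2
          (Finset.mem_product.2 ⟨Finset.mem_range.2 hlt, Finset.mem_singleton.2 h0⟩)
        have h2 : (N + 2 : ℝ) ≤ y.1.1 := by exact_mod_cast not_lt.1 hy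
        have h3 : -(N : ℝ) ≤ (2 * s).re :=
          (neg_le_neg (hball s hs)).trans (neg_le_of_abs_le (abs_re_le_norm _))
        have h4 := congrArg re h1
        rw [add_re, natCast_re, one_re] at h4
        linarith
      · rw [norm_smul]
        exact norm_kernel_smul_le hx hKN hQ (fun h => y.2 h) (hball s hs)
    exact hd.analyticAt (isOpen_ball.mem_nhds (mem_ball_self one_pos))

/-- At `s₀ = (1 - k) / 2` exactly the term `(k, 0)` is singular, and its polar part is
$\frac{\rho}{2(s-s_0)}Q_{k,0}$. -/
theorem hasSimplePoles_kernel_series [CompleteSpace Y] (hx : 0 < x) (hC₀ : 0 ≤ C₀)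
    (hK : ∀ N : ℕ, ∃ C, 0 ≤ C ∧ ∀ (i j : ℕ) (w : ℂ), ‖w‖ ≤ N → (i = 0 → N + 2 ≤ j) →
      ‖K i (w + j)‖ ≤ C * x ^ (i + j))
    (hQ : ∀ y, ‖Q y‖ ≤ C₀ * (1 / (2 * x)) ^ (y.1 + y.2))
    {ρ : ℂ} {G : ℂ → ℂ} (hG : Differentiable ℂ G)
    (hK0 : ∀ w, K 0 w = ρ / (w - 1) + G w) (hKd : ∀ i, Differentiable ℂ (K (i + 1)))
    {r : ℕ} (hr : ∀ j, ((ρ / 2) • Q (j, 0)).toLinearMap.rank ≤ r) :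
    HasSimplePoles r (fun s => ∑' y, K y.2 (2 * s + y.1) • Q y) := by
  have hreg : ∀ s₀ : ℂ, (∀ k : ℕ, s₀ ≠ (1 - (k : ℂ)) / 2) →
      AnalyticAt ℂ (fun s => ∑' y, K y.2 (2 * s + y.1) • Q y) s₀ := by
    intro s₀ hs₀
    refine analyticAt_tsum_kernel_smul hx hC₀ hK hQ hG hK0 hKd fun j hj => ?_
    exact absurd (by rw [← hj]; ring) (hs₀ j)
  refine ⟨hreg, fun s₀ => ?_⟩
  by_cases hs₀ : ∀ k : ℕ, s₀ ≠ (1 - (k : ℂ)) / 2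
  · exact ⟨0, _, by simp, hreg s₀ hs₀, by simp⟩
  push Not at hs₀
  obtain ⟨k, hk⟩ := hs₀
  -- Deleting the singular term leaves a series to which the analytic case applies.
  let Q' : ℕ × ℕ → X →L[ℂ] Y := fun y => if y = (k, 0) then 0 else Q y
  have hQ' : ∀ y, ‖Q' y‖ ≤ C₀ * (1 / (2 * x)) ^ (y.1 + y.2) := by
    intro y
    by_cases hy : y = (k, 0)
    · simp only [Q', hy, if_true, norm_zero]
      positivity
    · simpa only [Q', hy, if_false] using hQ y
  have hrest : AnalyticAt ℂ (fun s => ∑' y, K y.2 (2 * s + y.1) • Q' y) s₀ := by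
    refine analyticAt_tsum_kernel_smul hx hC₀ hK hQ' hG hK0 hKd fun j hj => ?_
    have : j = k := by
      rw [hk] at hj
      have h1 : (j : ℂ) = k := by linear_combination hj
      exact_mod_cast h1
    simp [Q', this]
  refine ⟨(ρ / 2) • Q (k, 0), fun s => G (2 * s + k) • Q (k, 0) +
    ∑' y, K y.2 (2 * s + y.1) • Q' y, hr k, ?_, ?_⟩
  · exact (((hG.analyticAt _).fun_comp (analyticAt_two_mul_add k s₀)).smul analyticAt_const).add hrest
  · filter_upwards [self_mem_nhdsWithin] with s hs
    have hne : s - s₀ ≠ 0 := sub_ne_zero.2 hs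
    have h1 := (summable_kernel_smul hx hC₀ hK hQ s).tsum_eq_add_tsum_ite (k, 0)
    have h2 : ∀ y : ℕ × ℕ, (if y = (k, 0) then 0 else K y.2 (2 * s + y.1) • Q y) =
        K y.2 (2 * s + y.1) • Q' y := by
      intro y
      by_cases hy : y = (k, 0) <;> simp [Q', hy]
    simp only [h2] at h1
    rw [h1, hK0, ← add_assoc, smul_smul, ← add_smul]
    congr 3
    have h3 : 2 * s + k - 1 = 2 * (s - s₀) := by rw [hk]; ring
    rw [h3]
    field_simp

/-- The series is itself a nuclear representation, since its terms have rank one and all but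
finitely many are bounded by a multiple of $2^{-(i+j)}$, which is summable to every positive power.
-/
theorem isNuclearOfOrderZero_kernel_series [CompleteSpace Y] (hx : 0 < x) (hC₀ : 0 ≤ C₀)
    (hK : ∀ N : ℕ, ∃ C, 0 ≤ C ∧ ∀ (i j : ℕ) (w : ℂ), ‖w‖ ≤ N → (i = 0 → N + 2 ≤ j) →
      ‖K i (w + j)‖ ≤ C * x ^ (i + j))
    {ψ : ℕ × ℕ → X →L[ℂ] ℂ} {e : ℕ × ℕ → Y}
    (hQ : ∀ y, ‖(ψ y).smulRight (e y)‖ ≤ C₀ * (1 / (2 * x)) ^ (y.1 + y.2)) (s : ℂ) :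
    IsNuclearOfOrderZero (∑' y, K y.2 (2 * s + y.1) • (ψ y).smulRight (e y)) := by
  intro p hp _
  refine isPowNuclear_of_hasSum hp (fun y => K y.2 (2 * s + y.1) • ψ y) e ?_ fun f => ?_
  · obtain ⟨C, hC, h⟩ := eventually_norm_kernel_smul_le hx hC₀ hK hQ s
    refine Summable.of_norm_bounded_eventually (summable_half_pow_rpow hC hp) ?_
    filter_upwards [h] with y hy
    rw [Real.norm_of_nonneg (by positivity)]
    refine Real.rpow_le_rpow (by positivity) ?_ hp.le
    rwa [norm_smul, mul_assoc, ← ContinuousLinearMap.norm_smulRight_apply]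
  · have h := (summable_kernel_smul hx hC₀ hK hQ s).hasSum.mapL
      (ContinuousLinearMap.apply ℂ Y f)
    refine h.congr_fun fun y => ?_
    simp [smul_smul]

end KernelSeries

/-! ### Parabolic blocks -/

section Parabolic

theorem log_mul_of_re_pos {a b : ℂ} (ha : 0 < a.re) (hb : 0 < b.re) :
    Complex.log (a * b) = Complex.log a + Complex.log b := by
  have ha0 : a ≠ 0 := by rintro rfl; simp at ha
  have hb0 : b ≠ 0 := by rintro rfl; simp at hb
  refine (Complex.log_mul_eq_add_log_iff ha0 hb0).2 ?_
  have h1 := abs_lt.1 (abs_arg_lt_pi_div_two_iff.2 (Or.inl ha))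
  have h2 := abs_lt.1 (abs_arg_lt_pi_div_two_iff.2 (Or.inl hb))
  constructor <;> linarith [h1.1, h1.2, h2.1, h2.2]

theorem re_add_div_self_pos {u : ℂ} (hu : 0 < u.re) (n : ℕ) : 0 < ((n + u) / u).re := by
  have hu0 : u ≠ 0 := by rintro rfl; simp at hu
  rw [add_div, div_self hu0, add_re, one_re, div_re]
  simp only [natCast_re, natCast_im, zero_mul, zero_div, add_zero]
  have : 0 ≤ (n : ℝ) * u.re / normSq u :=
    div_nonneg (mul_nonneg n.cast_nonneg hu.le) (normSq_nonneg u)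
  linarith

/-- Both $(n+u)/u$ and $u$ lie in the right half plane, so their principal logarithms add up to that
of the product. This separates the factor $u^{2s}$, independent of $n$, from the power to be
expanded. -/
theorem add_div_self_cpow {u : ℂ} (hu : 0 < u.re) (n : ℕ) (s : ℂ) :
    ((n + u) / u) ^ (-2 * s) =
      Complex.exp (s * (2 * Complex.log u)) * ((n : ℂ) + u) ^ (-2 * s) := by
  have hu0 : u ≠ 0 := by rintro rfl; simp at hu
  have hpos := re_add_div_self_pos hu n
  have hne : (n + u) / u ≠ 0 := by intro h; rw [h] at hpos; simp at hpos
  have hnu : (n : ℂ) + u ≠ 0 := fun h => hne (by rw [h, zero_div])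
  have h := log_mul_of_re_pos hpos hu
  rw [div_mul_cancel₀ _ hu0] at h
  rw [cpow_def_of_ne_zero hne, cpow_def_of_ne_zero hnu, h, ← Complex.exp_add]
  congr 1
  ring

/-- Newton's binomial series for $(1+u/m)^{-w}$; factoring out $m>0$ does not affect the principal
branch. -/
theorem hasSum_binomial_cpow {m : ℕ} (hm : 1 ≤ m) {u : ℂ} (hu : ‖u‖ < m) (w : ℂ) :
    HasSum (fun i : ℕ => Ring.choose (-w) i * ((m : ℂ) ^ (-(w + i)) * u ^ i))
      (((m : ℂ) + u) ^ (-w)) := by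
  have hm0 : (0 : ℝ) < m := by exact_mod_cast hm
  have hmc : (m : ℂ) ≠ 0 := by exact_mod_cast hm0.ne'
  have hlt : ‖u / m‖ < 1 := by
    rw [norm_div, Complex.norm_natCast]
    exact (div_lt_one hm0).2 hu
  have h := (one_add_cpow_hasFPowerSeriesOnBall_zero (a := -w)).hasSum (y := u / m) (by
    rw [← ENNReal.ofReal_one, Metric.eball_ofReal]
    simpa using hlt)
  have hne : 1 + u / m ≠ 0 := slitPlane_ne_zero (mem_slitPlane_of_norm_lt_one hlt)
  have hval : ((m : ℂ) + u) ^ (-w) = (m : ℂ) ^ (-w) * (1 + (0 + u / m)) ^ (-w) := by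
    have hmu : (m : ℂ) + u = ((m : ℝ) : ℂ) * (1 + u / m) := by
      push_cast
      field_simp
    rw [zero_add, hmu, cpow_def_of_ne_zero (mul_ne_zero (by exact_mod_cast hm0.ne') hne),
      cpow_def_of_ne_zero hmc, cpow_def_of_ne_zero hne, log_ofReal_mul hm0 hne, ← Complex.exp_add,
      natCast_log]
    congr 1
    ring
  rw [hval]
  refine (h.mul_left _).congr_fun fun i => ?_
  simp only [binomialSeries_apply, List.ofFn_const, List.prod_replicate, smul_eq_mul]
  rw [neg_add, cpow_add _ _ hmc, cpow_neg _ (i : ℂ), cpow_natCast, div_pow]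
  field_simp

/-- The terms of the expansion of a parabolic series into powers. -/
theorem summable_parabolic_expansion {ε c u s : ℂ} (hε : ‖ε‖ = 1) {n₀ : ℕ} (hn₀ : 1 ≤ n₀)
    {α : ℕ → ℂ} {C r : ℝ} (hC : 0 ≤ C) (hα : ∀ j, ‖α j‖ ≤ C * (r⁻¹) ^ j) (hr : 0 < r)
    (hcr : 4 / n₀ * (‖c‖ / r) ≤ 1 / 2) (hu : 4 / n₀ * ‖u‖ ≤ 1 / 2) (hs : 1 < (2 * s).re) :
    Summable fun x : ℕ × (ℕ × ℕ) => (Ring.choose (-(2 * s + x.2.1)) x.2.2 *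
      (ε ^ (x.1 + n₀) * ((x.1 + n₀ : ℕ) : ℂ) ^ (-(2 * s + x.2.1 + x.2.2)))) *
        (c ^ x.2.1 * α x.2.1 * u ^ x.2.2) := by
  obtain ⟨N, hN⟩ := exists_nat_ge ‖2 * s‖
  have hn0 : (1 : ℝ) ≤ n₀ := by exact_mod_cast hn₀
  have hn0' : (0 : ℝ) < n₀ := by linarith
  have h1 : Summable fun n : ℕ => 1 / ((n + n₀ : ℕ) : ℝ) ^ (2 * s).re :=
    (summable_nat_add_iff (f := fun n : ℕ => 1 / (n : ℝ) ^ (2 * s).re) n₀).2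
      (Real.summable_one_div_nat_rpow.2 hs)
  have h2 := h1.mul_of_nonneg (summable_half_pow (2 ^ N * C)) (fun n => by positivity)
    (fun y => by positivity)
  refine Summable.of_norm_bounded h2 fun x => ?_
  obtain ⟨n, j, i⟩ := x
  have hpos : 0 < n + n₀ := by omega
  have hle : (1 : ℝ) ≤ ((n + n₀ : ℕ) : ℝ) := by exact_mod_cast hpos
  have hle' : (n₀ : ℝ) ≤ ((n + n₀ : ℕ) : ℝ) := by push_cast; linarith [n.cast_nonneg (α := ℝ)]
  have hch : ‖Ring.choose (-(2 * s + j)) i‖ ≤ 2 ^ (N + j + i) := by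
    refine norm_choose_le ?_ i
    rw [norm_neg]
    refine (norm_add_le _ _).trans ?_
    rw [Complex.norm_natCast]
    push_cast
    gcongr
  have hpw : ‖ε ^ (n + n₀) * ((n + n₀ : ℕ) : ℂ) ^ (-(2 * s + j + i))‖ ≤
      1 / ((n + n₀ : ℕ) : ℝ) ^ (2 * s).re * (1 / n₀) ^ (j + i) := by
    rw [norm_mul, norm_pow, hε, one_pow, one_mul, norm_natCast_cpow_of_pos hpos, neg_re, add_re,
      add_re, natCast_re, natCast_re, Real.rpow_neg (by positivity), add_assoc,
      Real.rpow_add (by positivity), mul_inv, ← one_div, ← Nat.cast_add, Real.rpow_natCast,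
      ← inv_pow, one_div (n₀ : ℝ)]
    gcongr
  simp only [norm_mul, norm_pow] at hpw ⊢
  have hα' := hα j
  calc _ ≤ (2 ^ (N + j + i) * (1 / ((n + n₀ : ℕ) : ℝ) ^ (2 * s).re * (1 / n₀) ^ (j + i))) *
        (‖c‖ ^ j * (C * (r⁻¹) ^ j) * ‖u‖ ^ i) := by gcongr
    _ = 1 / ((n + n₀ : ℕ) : ℝ) ^ (2 * s).re *
        (2 ^ N * C * ((2 / n₀ * (‖c‖ / r)) ^ j * (2 / n₀ * ‖u‖) ^ i)) := by
      rw [pow_add, pow_add, pow_add, div_eq_mul_inv ‖c‖, mul_pow (2 / (n₀ : ℝ)),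
        mul_pow (2 / (n₀ : ℝ)), mul_pow ‖c‖, div_eq_mul_one_div (2 : ℝ), mul_pow 2, mul_pow 2]
      ring
    _ ≤ _ := by
      rw [pow_add]
      have h3 : 2 / n₀ * (‖c‖ / r) ≤ 1 / 2 := by
        refine le_trans ?_ hcr
        gcongr
        norm_num
      have h4 : 2 / n₀ * ‖u‖ ≤ 1 / 2 := by
        refine le_trans ?_ hu
        gcongr
        norm_num
      gcongr

/-- Resummation of a parabolic series in terms of periodic zeta functions. -/
theorem exists_hasSum_parabolic {ε c u s : ℂ} (hε : ‖ε‖ = 1) {n₀ : ℕ} (hn₀ : 1 ≤ n₀)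
    {α : ℕ → ℂ} {C r : ℝ} (hC : 0 ≤ C) (hα : ∀ j, ‖α j‖ ≤ C * (r⁻¹) ^ j) (hr : 0 < r)
    (hcr : 4 / n₀ * (‖c‖ / r) ≤ 1 / 2) (hu : 4 / n₀ * ‖u‖ ≤ 1 / 2) (hs : 1 < (2 * s).re)
    (hure : 0 < u.re) {K : ℕ → ℂ → ℂ}
    (hK : ∀ (i : ℕ) (w : ℂ), 1 < w.re → HasSum (fun n : ℕ => Ring.choose (-w) i *
        (ε ^ (n + n₀) * ((n + n₀ : ℕ) : ℂ) ^ (-(w + i)))) (K i w))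
    {Φ : ℂ → ℂ} (hΦ : ∀ x, ‖x‖ < r → HasSum (fun j => x ^ j * α j) (Φ x)) :
    ∃ F, HasSum (fun y : ℕ × ℕ => K y.2 (2 * s + y.1) * (c ^ y.1 * α y.1 * u ^ y.2)) F ∧
      HasSum (fun n : ℕ => ε ^ (n + n₀) * (((n + n₀ : ℕ) : ℂ) + u) ^ (-2 * s) *
        Φ (c / (((n + n₀ : ℕ) : ℂ) + u))) F := by
  have hn0 : (1 : ℝ) ≤ n₀ := by exact_mod_cast hn₀
  have hn0' : (0 : ℝ) < n₀ := by linarith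
  have hS := summable_parabolic_expansion hε hn₀ hC hα hr hcr hu hs
  have hre : ∀ j : ℕ, 1 < (2 * s + j).re := by
    intro j
    rw [add_re, natCast_re]
    linarith [j.cast_nonneg (α := ℝ)]
  -- The triple series converges absolutely, so it may be summed in either order. Summing over `n`
  -- first produces the kernels; summing over `(j, i)` first restores the original terms.
  have hswap : HasSum (fun x : (ℕ × ℕ) × ℕ => (Ring.choose (-(2 * s + x.1.1)) x.1.2 *
      (ε ^ (x.2 + n₀) * ((x.2 + n₀ : ℕ) : ℂ) ^ (-(2 * s + x.1.1 + x.1.2)))) *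
        (c ^ x.1.1 * α x.1.1 * u ^ x.1.2)) _ :=
    (Equiv.prodComm (ℕ × ℕ) ℕ).hasSum_iff.2 hS.hasSum
  refine ⟨_, hswap.prod_fiberwise fun y => (hK y.2 (2 * s + y.1) (hre y.1)).mul_right
    (c ^ y.1 * α y.1 * u ^ y.2), ?_⟩
  refine hS.hasSum.prod_fiberwise fun n => ?_
  have hpos : 1 ≤ n + n₀ := by omega
  have hle' : (n₀ : ℝ) ≤ ((n + n₀ : ℕ) : ℝ) := by push_cast; linarith [n.cast_nonneg (α := ℝ)]
  have hun : ‖u‖ < ((n + n₀ : ℕ) : ℝ) := by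
    have : 4 * ‖u‖ ≤ 1 / 2 * n₀ := by
      rw [div_mul_eq_mul_div, div_le_iff₀ hn0'] at hu
      exact hu
    linarith [norm_nonneg u]
  have hmu : ((n + n₀ : ℕ) : ℝ) ≤ ‖((n + n₀ : ℕ) : ℂ) + u‖ := by
    refine le_trans ?_ (re_le_norm _)
    rw [add_re, natCast_re]
    linarith
  have hmu0 : ((n + n₀ : ℕ) : ℂ) + u ≠ 0 := norm_pos_iff.1 (by linarith)
  have hx : ‖c / (((n + n₀ : ℕ) : ℂ) + u)‖ < r := by
    have h4 : 4 * ‖c‖ ≤ 1 / 2 * n₀ * r := by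
      have : 4 / n₀ * (‖c‖ / r) = 4 * ‖c‖ / (n₀ * r) := by field_simp
      rw [this, div_le_iff₀ (by positivity)] at hcr
      linarith
    rw [norm_div, div_lt_iff₀ (by linarith)]
    have h5 : r * n₀ ≤ r * ‖((n + n₀ : ℕ) : ℂ) + u‖ := by
      gcongr
      linarith
    have h6 : 0 < r * n₀ := by positivity
    linarith [norm_nonneg c]
  have hSn : Summable fun y : ℕ × ℕ => _ := hS.prod_factor n
  have hj := hSn.hasSum.prod_fiberwise fun j => by
    have := ((hasSum_binomial_cpow hpos hun (2 * s + j)).mul_left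
      (ε ^ (n + n₀) * (c ^ j * α j)))
    refine this.congr_fun fun i => ?_
    ring
  have hgoal := (hΦ _ hx).mul_left (ε ^ (n + n₀) * (((n + n₀ : ℕ) : ℂ) + u) ^ (-2 * s))
  have heq := hj.unique (hgoal.congr_fun fun j => by
    rw [neg_add, cpow_add _ _ hmu0, cpow_neg _ (j : ℂ), cpow_natCast, div_pow, neg_mul]
    field_simp)
  rw [← heq]
  exact hSn.hasSum

end Parabolic

/-! ### Parabolic series as operator families, reduced to eigenvectors -/

section ParabolicBlock

variable {V : Type*} [NormedAddCommGroup V] [InnerProductSpace ℂ V] [FiniteDimensional ℂ V]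
  {D D' : Disc}

theorem rank_smulRight_le {X Y : Type*} [NormedAddCommGroup X] [NormedSpace ℂ X]
    [NormedAddCommGroup Y] [NormedSpace ℂ Y] (φ : X →L[ℂ] ℂ) (e : Y) :
    (φ.smulRight e).toLinearMap.rank ≤ 1 := by
  have h : LinearMap.range (φ.smulRight e).toLinearMap ≤ Submodule.span ℂ {e} := by
    rintro _ ⟨f, rfl⟩
    exact Submodule.smul_mem _ _ (Submodule.mem_span_singleton_self e)
  refine (Submodule.rank_mono h).trans ((rank_span_le _).trans ?_)
  simp

theorem ne_zero_of_re_pos {u : ℂ} (hu : 0 < u.re) : u ≠ 0 := by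
  rintro rfl
  simp at hu

theorem natCast_add_ne_zero {u : ℂ} (hu : 0 < u.re) (n : ℕ) : (n : ℂ) + u ≠ 0 := by
  refine ne_zero_of_re_pos ?_
  rw [add_re, natCast_re]
  positivity

/-- The logarithm of the weight of the `n`-th branch at a parabolic fixed point. -/
theorem isHol_parabolic_log {u : ℂ → ℂ} (hu : IsHol D u) (hre : ∀ z ∈ D.cl, 0 < (u z).re)
    (n : ℕ) : IsHol D (fun z => -2 * Complex.log ((n + u z) / u z)) :=
  ((((isHol_const (n : ℂ)).add hu).div hu fun z hz => ne_zero_of_re_pos (hre z hz)).clog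
    fun z hz => mem_slitPlane_iff.2 (Or.inl (re_add_div_self_pos (hre z hz) n))).const_mul _

theorem isHol_parabolic {u : ℂ → ℂ} (hu : IsHol D u) (hre : ∀ z ∈ D.cl, 0 < (u z).re)
    (p c : ℂ) (n : ℕ) : IsHol D (fun z => p + c / (n + u z)) :=
  (isHol_const p).add ((isHol_const c).div ((isHol_const (n : ℂ)).add hu)
    fun z hz => natCast_add_ne_zero (hre z hz) n)

/-- The part `∑ₙ εⁿ j_s φ(f(γₙ z)) b` of the transfer operator that is induced by the branches at a
parabolic fixed point `p`. -/
theorem exists_parabolic_block_scalar {p c : ℂ} (hp : p ∈ D'.opn) {u : ℂ → ℂ} (hu : IsHol D u)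
    (hre : ∀ z ∈ D.cl, 0 < (u z).re)
    (hmaps : ∀ n : ℕ, 1 ≤ n → Set.MapsTo (fun z => p + c / (n + u z)) D.cl D'.opn)
    {ε : ℂ} (hε : ‖ε‖ = 1) (φ : V →L[ℂ] ℂ) (b : V) {k : ℕ} (hk : ε = 1 → 1 ≤ k) :
    ∃ L : ℂ → (HolSpace D' V →L[ℂ] HolSpace D V), HasSimplePoles k L ∧
      ∀ s : ℂ, 1 / 2 < s.re → IsNuclearOfOrderZero (L s) ∧
        ∀ (f : HolSpace D' V) (z : D.cl), HasSum (fun n : ℕ =>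
          ((((n + 1 : ℕ) : ℂ) + u z) / u z) ^ (-2 * s) •
            (ε ^ (n + 1) * φ (ext0 f.1 (p + c / (((n + 1 : ℕ) : ℂ) + u z)))) • b)
          ((L s f).1 z) := by
  have : CompleteSpace V := FiniteDimensional.complete ℂ V
  obtain ⟨U, hU, huU⟩ := hu.exists_bound
  obtain ⟨r, hr, hpr⟩ := nhds_basis_closedBall.mem_iff.1 (D'.isOpen_opn.mem_nhds hp)
  obtain ⟨a, ha, hasum⟩ := exists_taylor_coeff (V := V) hr hpr
  -- The tail starts at `n₀ = m₀ + 1`, large enough that both `‖c‖ / r` and the bound of `u` are at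
  -- most `1 / (2 * x)` with `x = 4 / n₀`. This compensates the growth `x ^ (i + j)` of the kernels
  -- and leaves the ratio `1 / 2`.
  obtain ⟨m₀, hm₀⟩ := exists_nat_ge (8 * (‖c‖ / r) + 8 * U)
  have hcr0 : 0 ≤ ‖c‖ / r := by positivity
  have hn₀ : 1 ≤ m₀ + 1 := by omega
  have hn0' : (0 : ℝ) < ((m₀ + 1 : ℕ) : ℝ) := by positivity
  have hn0c : (m₀ : ℝ) ≤ ((m₀ + 1 : ℕ) : ℝ) := by push_cast; linarith
  have hcr : 4 / ((m₀ + 1 : ℕ) : ℝ) * (‖c‖ / r) ≤ 1 / 2 := by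
    rw [div_mul_eq_mul_div, div_le_iff₀ hn0']
    linarith
  have hUn : 4 / ((m₀ + 1 : ℕ) : ℝ) * U ≤ 1 / 2 := by
    rw [div_mul_eq_mul_div, div_le_iff₀ hn0']
    linarith
  obtain ⟨K, ρ, G, hρ, hG, hK0, hKd, hKsum, hKb⟩ := exists_zeta_kernel hε hn₀
  set x : ℝ := 4 / ((m₀ + 1 : ℕ) : ℝ) with hxdef
  have hx : 0 < x := by positivity
  have hhalf : ∀ t : ℝ, x * t ≤ 1 / 2 → t ≤ 1 / (2 * x) := by
    intro t ht
    rw [le_div_iff₀ (by positivity)]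
    linarith
  let ψ : ℕ × ℕ → HolSpace D' V →L[ℂ] ℂ := fun y => (c ^ y.1 • φ) ∘L a y.1
  have hel : ∀ i : ℕ, IsHol D (fun z => u z ^ i • b) := fun i => (hu.pow i).smul (isHol_const b)
  let e : ℕ × ℕ → HolSpace D V := fun y => (hel y.2).toHol
  have hQ : ∀ y, ‖(ψ y).smulRight (e y)‖ ≤ ‖φ‖ * ‖b‖ * (1 / (2 * x)) ^ (y.1 + y.2) := by
    intro y
    rw [ContinuousLinearMap.norm_smulRight_apply]
    have h1 : ‖ψ y‖ ≤ ‖φ‖ * (‖c‖ / r) ^ y.1 := by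
      refine (ContinuousLinearMap.opNorm_comp_le _ _).trans ?_
      rw [norm_smul, norm_pow]
      calc _ ≤ ‖c‖ ^ y.1 * ‖φ‖ * (r⁻¹) ^ y.1 := by gcongr; exact ha _
        _ = _ := by rw [div_eq_mul_inv, mul_pow]; ring
    have h2 : ‖e y‖ ≤ U ^ y.2 * ‖b‖ := by
      refine norm_toHol_le _ (by positivity) fun z hz => ?_
      rw [norm_smul, norm_pow]
      gcongr
      exact huU z hz
    calc _ ≤ (‖φ‖ * (‖c‖ / r) ^ y.1) * (U ^ y.2 * ‖b‖) := by gcongr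
      _ ≤ (‖φ‖ * (1 / (2 * x)) ^ y.1) * ((1 / (2 * x)) ^ y.2 * ‖b‖) := by
        gcongr ‖φ‖ * ?_ ^ _ * (?_ ^ _ * ‖b‖)
        · exact hhalf _ hcr
        · exact hhalf _ hUn
      _ = _ := by rw [pow_add]; ring
  have hC₀ : 0 ≤ ‖φ‖ * ‖b‖ := by positivity
  let N : ℂ → HolSpace D' V →L[ℂ] HolSpace D V := fun s =>
    ∑' y, K y.2 (2 * s + y.1) • (ψ y).smulRight (e y)
  -- A pole is possible only for `ε = 1`, where its residue has rank one; otherwise `ρ = 0`.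
  have hNpoles : HasSimplePoles k N := by
    refine hasSimplePoles_kernel_series hx hC₀ hKb hQ hG hK0 hKd fun j => ?_
    by_cases h1 : ε = 1
    · have h2 : (ρ / 2) • (ψ (j, 0)).smulRight (e (j, 0)) =
          ((ρ / 2) • ψ (j, 0)).smulRight (e (j, 0)) := by
        ext f
        simp [smul_smul]
      rw [h2]
      refine (rank_smulRight_le _ _).trans ?_
      exact_mod_cast hk h1
    · simp [hρ h1]
  have hlogu : IsHol D (fun z => 2 * Complex.log (u z)) :=
    (hu.clog fun z hz => mem_slitPlane_iff.2 (Or.inl (hre z hz))).const_mul 2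
  let M : ℂ → HolSpace D V →L[ℂ] HolSpace D V := fun s =>
    wcomp isBranch_id (ContinuousLinearMap.id ℂ V) (hlogu.exp_mul s)
  have hM : ∀ s, AnalyticAt ℂ M s := fun s => analyticAt_wcomp_exp isBranch_id _ hlogu s
  have hbr : ∀ n : ℕ, IsBranch D D' (fun z => p + c / (((n + 1 : ℕ) : ℂ) + u z)) := fun n =>
    IsBranch.of_mapsTo (isHol_parabolic hu hre p c (n + 1)) (hmaps (n + 1) (by omega))
  let P : ℕ → ℂ → HolSpace D' V →L[ℂ] HolSpace D V := fun n s =>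
    wcomp (hbr n) (ε ^ (n + 1) • φ.smulRight b) ((isHol_parabolic_log hu hre (n + 1)).exp_mul s)
  -- The first `m₀` branches enter directly; `M s` is multiplication by $u^{2s}$ and restores the
  -- factor taken out of the tail.
  refine ⟨fun s => ∑ n ∈ Finset.range m₀, P n s +
    M s ∘L N s ∘L ContinuousLinearMap.id ℂ (HolSpace D' V), ?_, fun s hs => ⟨?_, fun f z => ?_⟩⟩
  · have h1 : HasSimplePoles (∑ n ∈ Finset.range m₀, 0) fun s => ∑ n ∈ Finset.range m₀, P n s :=
      HasSimplePoles.sum _ fun n _ => hasSimplePoles_of_analyticAt fun s =>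
        analyticAt_wcomp_exp (hbr n) _ (isHol_parabolic_log hu hre (n + 1)) s
    simpa using h1.add (hNpoles.comp hM (ContinuousLinearMap.id ℂ (HolSpace D' V)))
  · refine IsNuclearOfOrderZero.add (IsNuclearOfOrderZero.sum _ fun n _ => ?_)
      (IsNuclearOfOrderZero.comp ?_ _ _)
    · exact isNuclearOfOrderZero_wcomp _ (hmaps (n + 1) (by omega)) _ _
    · exact isNuclearOfOrderZero_kernel_series hx hC₀ hKb hQ s
  · have h2s : 1 < (2 * s).re := by
      rw [mul_re]
      norm_num
      linarith
    have hz := hre z z.2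
    have hux : x * ‖u z‖ ≤ 1 / 2 := le_trans (by gcongr; exact huU z z.2) hUn
    obtain ⟨F, hF1, hF2⟩ := exists_hasSum_parabolic (α := fun j => φ (a j f)) (s := s)
      (C := ‖φ‖ * ‖f‖) hε hn₀ (by positivity) (fun j => by
        refine (φ.le_opNorm _).trans ?_
        rw [mul_assoc]
        gcongr
        refine ((a j).le_opNorm f).trans ?_
        rw [mul_comm]
        gcongr
        exact ha j) hr hcr hux h2s hz hKsum (Φ := fun t => φ (ext0 f.1 (p + t))) (fun t ht => by
          have h := (hasum f (p + t) (by simpa using ht)).mapL φ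
          simpa using h)
    have hNz : (N s f).1 z = F • b := by
      have h1 := ((summable_kernel_smul hx hC₀ hKb hQ s).hasSum.mapL
        (ContinuousLinearMap.apply ℂ (HolSpace D V) f)).mapL (evalAt z)
      refine h1.unique ((hF1.smul_const b).congr_fun fun y => ?_)
      change K y.2 (2 * s + y.1) • ((c ^ y.1 • φ (a y.1 f)) • (u z ^ y.2 • b)) = _
      simp only [smul_smul, smul_eq_mul]
    have hw : ∀ n : ℕ, ((((n + 1 : ℕ) : ℂ) + u z) / u z) ^ (-2 * s) =
        Complex.exp (s * (-2 * Complex.log ((((n + 1 : ℕ) : ℂ) + u z) / u z))) := by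
      intro n
      rw [cpow_def_of_ne_zero (ne_zero_of_re_pos (re_add_div_self_pos hz (n + 1)))]
      congr 1
      ring
    have hval : (((∑ n ∈ Finset.range m₀, P n s +
        M s ∘L N s ∘L ContinuousLinearMap.id ℂ (HolSpace D' V)) f).1 z : V) =
        Complex.exp (s * (2 * Complex.log (u z))) • F • b +
        ∑ n ∈ Finset.range m₀, ((((n + 1 : ℕ) : ℂ) + u z) / u z) ^ (-2 * s) •
            (ε ^ (n + 1) * φ (ext0 f.1 (p + c / (((n + 1 : ℕ) : ℂ) + u z)))) • b := by
      rw [← hNz, add_comm]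
      have h1 : evalAt z ((∑ n ∈ Finset.range m₀, P n s) f) =
          ∑ n ∈ Finset.range m₀, evalAt z (P n s f) := by
        rw [sum_apply, map_sum]
      have h2 : ∀ n, evalAt z (P n s f) = ((((n + 1 : ℕ) : ℂ) + u z) / u z) ^ (-2 * s) •
            (ε ^ (n + 1) * φ (ext0 f.1 (p + c / (((n + 1 : ℕ) : ℂ) + u z)))) • b := by
        intro n
        rw [hw, mul_smul]
        rfl
      simp only [h2] at h1
      rw [← h1]
      have h3 : Complex.exp (s * (2 * Complex.log (u z))) • (N s f).1 z =
          (M s (N s f)).1 z := by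
        rw [wcomp_apply, ContinuousLinearMap.id_apply, ext0_of_mem _ z.2]
      rw [h3]
      rfl
    rw [hval]
    refine (hasSum_nat_add_iff m₀).1 ?_
    refine ((hF2.smul_const b).const_smul (Complex.exp (s * (2 * Complex.log (u z))))).congr_fun
      fun n => ?_
    rw [add_div_self_cpow hz (n + m₀ + 1)]
    simp only [smul_smul, add_assoc]
    congr 1
    ring

/-- A unitary map of a finite-dimensional space has a basis of eigenvectors. -/
theorem exists_eigenbasis (A : V ≃ₗᵢ[ℂ] V) :
    ∃ (ι : Set V) (_ : Fintype ι) (b : Module.Basis ι ℂ V) (ε : ι → ℂ),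
      ∀ l, A (b l) = ε l • b l ∧ ‖ε l‖ = 1 := by
  let a : V →ₗ[ℂ] V := A.toLinearEquiv.toLinearMap
  let a' : V →ₗ[ℂ] V := A.symm.toLinearEquiv.toLinearMap
  have haa : ∀ x, a (a' x) = x := fun x => A.apply_symm_apply x
  have haa' : ∀ x, a' (a x) = x := fun x => A.symm_apply_apply x
  have hin : ∀ x y, ⟪a x, y⟫_ℂ = ⟪x, a' y⟫_ℂ := fun x y => by
    rw [← A.inner_map_map x (a' y)]
    exact congrArg _ (haa y).symm
  have hin' : ∀ x y, ⟪a' x, y⟫_ℂ = ⟪x, a y⟫_ℂ := fun x y => by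
    rw [← A.inner_map_map (a' x) y]
    exact congrArg (fun t => ⟪t, a y⟫_ℂ) (haa x)
  have h1 : (a + a').IsSymmetric := fun x y => by
    simp only [LinearMap.add_apply, inner_add_left, inner_add_right, hin, hin', add_comm]
  -- The inverse of a unitary map is its adjoint, so $a+a^{-1}$ and $i(a-a^{-1})$ are commuting
  -- symmetric operators. On a joint eigenvector with eigenvalues $x,y$ the map $a$ acts as
  -- $(x-iy)/2$.
  have h2 : (I • (a - a')).IsSymmetric := fun x y => by
    simp only [LinearMap.smul_apply, LinearMap.sub_apply, inner_smul_left, inner_smul_right,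
      inner_sub_left, inner_sub_right, hin, hin', conj_I]
    ring
  have hc : Commute (a + a') (I • (a - a')) := by
    refine LinearMap.ext fun x => ?_
    simp only [Module.End.mul_apply, LinearMap.add_apply, LinearMap.smul_apply,
      LinearMap.sub_apply, map_smul, map_sub, map_add, haa, haa']
    module
  have htop := h1.iSup_iSup_eigenspace_inf_eigenspace_eq_top_of_commute h2 hc
  have hspan : ⊤ ≤ Submodule.span ℂ {v : V | ∃ ε : ℂ, A v = ε • v} := by
    rw [← htop]
    refine iSup_le fun x => iSup_le fun y v hv => Submodule.subset_span ⟨(x - I * y) / 2, ?_⟩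
    have e1 := Module.End.mem_eigenspace_iff.1 hv.1
    have e2 := Module.End.mem_eigenspace_iff.1 hv.2
    simp only [LinearMap.add_apply, LinearMap.smul_apply, LinearMap.sub_apply] at e1 e2
    have e3 : (2 : ℂ) • a v = (x - I * y) • v := by
      rw [sub_smul, mul_smul, ← e1, ← e2, smul_smul, I_mul_I]
      module
    calc A v = (2 : ℂ)⁻¹ • (2 : ℂ) • a v := by rw [smul_smul]; norm_num; rfl
      _ = _ := by rw [e3, smul_smul]; congr 1; ring
  let b := Module.Basis.ofSpan hspan
  have hb : ∀ l, ∃ ε : ℂ, A (b l) = ε • b l := fun l =>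
    Module.Basis.ofSpan_subset hspan (Set.mem_range_self l)
  choose ε hε using hb
  have := Module.Finite.finite_basis b
  refine ⟨_, Fintype.ofFinite _, b, ε,
    fun l => ⟨hε l, ?_⟩⟩
  have h := A.norm_map (b l)
  rw [hε, norm_smul] at h
  exact mul_right_cancel₀ (norm_ne_zero_iff.2 (b.ne_zero l)) (by rw [h, one_mul])

/-- Turns the number of eigenvectors that contribute a pole into the degree of singularity. -/
theorem card_eigenvalue_one_le (A : V ≃ₗᵢ[ℂ] V) {ι : Type*} [Fintype ι]
    (b : Module.Basis ι ℂ V) {ε : ι → ℂ} (h : ∀ l, A (b l) = ε l • b l)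
    [DecidablePred fun l => ε l = 1] :
    (Finset.univ.filter fun l => ε l = 1).card ≤
      Module.finrank ℂ (LinearMap.ker (A.toLinearEquiv.toLinearMap - LinearMap.id)) := by
  let w : {l // ε l = 1} → LinearMap.ker (A.toLinearEquiv.toLinearMap - LinearMap.id) :=
    fun l => ⟨b l, by
      rw [LinearMap.mem_ker, LinearMap.sub_apply, LinearMap.id_apply, sub_eq_zero]
      exact (h l).trans (by rw [l.2, one_smul])⟩
  have hw : LinearIndependent ℂ w :=
    LinearIndependent.of_comp (Submodule.subtype _) (b.linearIndependent.comp _ Subtype.val_injective)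
  rw [← Fintype.card_subtype]
  exact hw.fintype_card_le_finrank

/-- The part `∑ₙ j_s Aⁿ f(γₙ z)` of the transfer operator that is induced by the branches at a
parabolic fixed point `p`. -/
theorem exists_parabolic_block {p c : ℂ} (hp : p ∈ D'.opn) {u : ℂ → ℂ} (hu : IsHol D u)
    (hre : ∀ z ∈ D.cl, 0 < (u z).re)
    (hmaps : ∀ n : ℕ, 1 ≤ n → Set.MapsTo (fun z => p + c / (n + u z)) D.cl D'.opn)
    (A : V ≃ₗᵢ[ℂ] V) :
    ∃ L : ℂ → (HolSpace D' V →L[ℂ] HolSpace D V), HasSimplePoles (Module.finrank ℂ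
        (LinearMap.ker (A.toLinearEquiv.toLinearMap - LinearMap.id))) L ∧
      ∀ s : ℂ, 1 / 2 < s.re → IsNuclearOfOrderZero (L s) ∧
        ∀ (f : HolSpace D' V) (z : D.cl), HasSum (fun n : ℕ =>
          ((((n + 1 : ℕ) : ℂ) + u z) / u z) ^ (-2 * s) •
            (A ^ (n + 1)) (ext0 f.1 (p + c / (((n + 1 : ℕ) : ℂ) + u z))))
          ((L s f).1 z) := by
  classical
  obtain ⟨ι, _, b, ε, hb⟩ := exists_eigenbasis A
  -- Each eigenvector contributes residue rank `1` or `0` according to whether its eigenvalue is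
  -- `1`; the total is the number of eigenvalues equal to `1`.
  have hblock := fun l => exists_parabolic_block_scalar hp hu hre hmaps (hb l).2
    (b.coord l).toContinuousLinearMap (b l) (k := if ε l = 1 then 1 else 0) (by simp +contextual)
  choose L hL hLs using hblock
  have hpow : ∀ (n : ℕ) (l : ι), (A ^ n) (b l) = ε l ^ n • b l := by
    intro n l
    induction n with
    | zero => simp
    | succ n ih =>
      rw [pow_succ', LinearIsometryEquiv.coe_mul, Function.comp_apply, ih, map_smul, (hb l).1, smul_smul, pow_succ]
  refine ⟨fun s => ∑ l, L l s, (HasSimplePoles.sum _ fun l _ => hL l).mono ?_, fun s hs =>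
    ⟨IsNuclearOfOrderZero.sum _ fun l _ => (hLs l s hs).1, fun f z => ?_⟩⟩
  · rw [← Finset.card_filter]
    exact card_eigenvalue_one_le A b fun l => (hb l).1
  · have h1 := hasSum_sum (s := Finset.univ) fun l (_ : l ∈ Finset.univ) => (hLs l s hs).2 f z
    have h2 : ∑ l, (L l s f).1 z = ((∑ l, L l s) f).1 z := by
      have : evalAt z ((∑ l, L l s) f) = ∑ l, evalAt z (L l s f) := by
        rw [sum_apply, map_sum]
      exact this.symm
    rw [← h2]
    refine h1.congr_fun fun n => ?_
    rw [← Finset.smul_sum]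
    congr 1
    conv_lhs => rw [← b.sum_repr (ext0 f.1 (p + c / (((n + 1 : ℕ) : ℂ) + u z)))]
    rw [map_sum]
    refine Finset.sum_congr rfl fun l _ => ?_
    rw [map_smul, hpow, smul_smul, mul_comm]
    rfl

end ParabolicBlock

/-! ### The matrices of the branches -/

section Matrices

/-- `sin (x π / q) / sin (π / q)`. -/
def chebU (q : ℕ) (x : ℝ) : ℝ := Real.sin (x * (Real.pi / q)) / Real.sin (Real.pi / q)

variable {q : ℕ}

theorem sin_pi_div_pos (hq : 3 ≤ q) : 0 < Real.sin (Real.pi / q) := by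
  have hq' : (3 : ℝ) ≤ q := by exact_mod_cast hq
  refine Real.sin_pos_of_pos_of_lt_pi (by positivity) ?_
  rw [div_lt_iff₀ (by positivity)]
  nlinarith [Real.pi_pos]

theorem one_le_lam (hq : 3 ≤ q) : 1 ≤ lam q := by
  have hq' : (3 : ℝ) ≤ q := by exact_mod_cast hq
  have h : Real.cos (Real.pi / 3) ≤ Real.cos (Real.pi / q) := by
    refine Real.cos_le_cos_of_nonneg_of_le_pi (by positivity) (by linarith [Real.pi_pos]) ?_
    gcongr
  rw [Real.cos_pi_div_three] at h
  rw [lam]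
  linarith

theorem lam_lt_two (hq : 3 ≤ q) : lam q < 2 := by
  have h := sin_pi_div_pos hq
  have h2 := Real.sin_sq_add_cos_sq (Real.pi / q)
  rw [lam]
  nlinarith

theorem chebU_zero : chebU q 0 = 0 := by simp [chebU]

theorem chebU_one (hq : 3 ≤ q) : chebU q 1 = 1 := by
  rw [chebU, one_mul, div_self (sin_pi_div_pos hq).ne']

theorem chebU_add_one (x : ℝ) : chebU q (x + 1) = lam q * chebU q x - chebU q (x - 1) := by
  rw [chebU, chebU, chebU, lam, add_mul, sub_mul, one_mul, Real.sin_add, Real.sin_sub]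
  ring

theorem chebU_two (hq : 3 ≤ q) : chebU q 2 = lam q := by
  have h := chebU_add_one (q := q) 1
  rw [sub_self, chebU_zero, chebU_one hq] at h
  norm_num at h
  exact h

theorem chebU_sub (hq : 3 ≤ q) (x : ℝ) : chebU q (q - x) = chebU q x := by
  have hq' : (q : ℝ) ≠ 0 := by positivity
  rw [chebU, chebU, sub_mul, mul_div_cancel₀ _ hq', Real.sin_pi_sub]

theorem chebU_nonneg (hq : 3 ≤ q) {x : ℝ} (h0 : 0 ≤ x) (h1 : x ≤ q) : 0 ≤ chebU q x := by
  have hq' : (0 : ℝ) < q := by positivity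
  refine div_nonneg (Real.sin_nonneg_of_nonneg_of_le_pi (by positivity) ?_) (sin_pi_div_pos hq).le
  calc x * (Real.pi / q) ≤ q * (Real.pi / q) := by gcongr
    _ = Real.pi := by field_simp

theorem chebU_pos (hq : 3 ≤ q) {x : ℝ} (h0 : 0 < x) (h1 : x < q) : 0 < chebU q x := by
  have hq' : (0 : ℝ) < q := by positivity
  refine div_pos (Real.sin_pos_of_pos_of_lt_pi (by positivity) ?_) (sin_pi_div_pos hq)
  calc x * (Real.pi / q) < q * (Real.pi / q) := by gcongr
    _ = Real.pi := by field_simp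

/-- Up to sign, left multiplication by $TS$ is the three-term recurrence `chebU_add_one` of the
Chebyshev values. -/
theorem coe_matTS_pow_mul_matS (hq : 3 ≤ q) (k : ℕ) :
    (((matT q * matS) ^ k * matS : SL(2, ℝ)) : Matrix (Fin 2) (Fin 2) ℝ) =
      (-1 : ℝ) ^ k • !![chebU q k, chebU q (k + 1); chebU q (k - 1), chebU q k] := by
  induction k with
  | zero =>
    have h : chebU q (-1) = -1 := by
      have := chebU_add_one (q := q) 0
      rw [zero_add, zero_sub, chebU_zero, chebU_one hq] at this
      linarith
    rw [pow_zero, one_mul]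
    simp [matS, chebU_zero, chebU_one hq, h]
  | succ k ih =>
    have h1 := chebU_add_one (q := q) k
    have h2 := chebU_add_one (q := q) (k + 1)
    rw [add_sub_cancel_right] at h2
    rw [pow_succ', mul_assoc, Matrix.SpecialLinearGroup.coe_mul, ih,
      Matrix.SpecialLinearGroup.coe_mul, pow_succ]
    push_cast
    rw [add_sub_cancel_right]
    ext i j
    fin_cases i <;> fin_cases j <;>
      simp [matT, matS, Matrix.mul_apply, Fin.sum_univ_two, h1, h2] <;> ring

theorem coe_conj_matC {X : SL(2, ℝ)} {σ a b c d : ℝ}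
    (hX : (X : Matrix (Fin 2) (Fin 2) ℝ) = σ • !![a, b; c, d]) :
    ((matC * X * matC⁻¹ : SL(2, ℝ)) : Matrix (Fin 2) (Fin 2) ℝ) =
      σ • !![(a - b - c + d) / 2, (a + b - c - d) / 2; (a - b + c - d) / 2,
        (a + b + c + d) / 2] := by
  have h2 : (√2 : ℝ) * √2 = 2 := Real.mul_self_sqrt (by norm_num)
  have h0 : (√2 : ℝ) ≠ 0 := by positivity
  have h3 : (√2 : ℝ)⁻¹ * (√2)⁻¹ = 1 / 2 := by rw [← mul_inv, h2]; norm_num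
  rw [Matrix.SpecialLinearGroup.coe_mul, Matrix.SpecialLinearGroup.coe_mul, hX,
    Matrix.SpecialLinearGroup.coe_inv]
  ext i j
  fin_cases i <;> fin_cases j <;>
    simp [matC, Matrix.adjugate_fin_two, Matrix.mul_apply, Fin.sum_univ_two]
  · linear_combination (σ * (a - b - c + d)) * h3
  · linear_combination (σ * (a + b - c - d)) * h3
  · linear_combination (σ * (a - b + c - d)) * h3
  · linear_combination (σ * (a + b + c + d)) * h3

theorem h_inv (q k : ℕ) : (h q k)⁻¹ = matC * ((matT q * matS) ^ k * matS) * matC⁻¹ := by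
  simp [h, g, mul_assoc]

theorem coe_h_inv (hq : 3 ≤ q) (k : ℕ) :
    (((h q k)⁻¹ : SL(2, ℝ)) : Matrix (Fin 2) (Fin 2) ℝ) = (-1 : ℝ) ^ k •
      !![chebU q k - (chebU q (k + 1) + chebU q (k - 1)) / 2,
          (chebU q (k + 1) - chebU q (k - 1)) / 2;
        -((chebU q (k + 1) - chebU q (k - 1)) / 2),
          chebU q k + (chebU q (k + 1) + chebU q (k - 1)) / 2] := by
  rw [h_inv, coe_conj_matC (coe_matTS_pow_mul_matS hq k)]
  congr 1
  ext i j
  fin_cases i <;> fin_cases j <;> simp <;> ring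

/-- The parabolic matrix with fixed point `p ∈ {1, -1}`. -/
def parabolicMatrix (p t : ℝ) : Matrix (Fin 2) (Fin 2) ℝ := !![1 - t, p * t; -(p * t), 1 + t]

theorem coe_h_one_inv (hq : 3 ≤ q) :
    (((h q 1)⁻¹ : SL(2, ℝ)) : Matrix (Fin 2) (Fin 2) ℝ) =
      (-1 : ℝ) • parabolicMatrix 1 (lam q / 2) := by
  rw [coe_h_inv hq, pow_one]
  congr 1
  have h2 : chebU q (1 + 1) = lam q := by rw [one_add_one_eq_two, chebU_two hq]
  ext i j
  fin_cases i <;> fin_cases j <;>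
    simp [parabolicMatrix, chebU_zero, chebU_one hq, h2]

theorem coe_h_pred_inv (hq : 3 ≤ q) :
    (((h q (q - 1))⁻¹ : SL(2, ℝ)) : Matrix (Fin 2) (Fin 2) ℝ) =
      (-1 : ℝ) ^ (q - 1) • parabolicMatrix (-1) (lam q / 2) := by
  have hc : ((q - 1 : ℕ) : ℝ) = q - 1 := by
    rw [Nat.cast_sub (by omega), Nat.cast_one]
  have h0 : chebU q (q - 1) = 1 := by rw [chebU_sub hq, chebU_one hq]
  have h1 : chebU q q = 0 := by
    have := chebU_sub hq 0
    rwa [sub_zero, chebU_zero] at this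
  have h2 : chebU q (q - 1 - 1) = lam q := by
    rw [sub_sub, one_add_one_eq_two, chebU_sub hq, chebU_two hq]
  rw [coe_h_inv hq, hc]
  congr 1
  ext i j
  fin_cases i <;> fin_cases j <;>
    simp [parabolicMatrix, h0, h1, h2] <;> ring

/-- These matrices fix $p$ and act on $1/(1-pz)$ as translation by $t$, so the parameters add under
multiplication; $p^2=1$ is what the matrix computation needs. -/
theorem coe_parabolic_pow {X : SL(2, ℝ)} {σ p t : ℝ} (hp : p * p = 1)
    (hX : (X : Matrix (Fin 2) (Fin 2) ℝ) = σ • parabolicMatrix p t) (n : ℕ) :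
    ((X ^ n : SL(2, ℝ)) : Matrix (Fin 2) (Fin 2) ℝ) = σ ^ n • parabolicMatrix p (n * t) := by
  induction n with
  | zero =>
    ext i j
    fin_cases i <;> fin_cases j <;> simp [parabolicMatrix]
  | succ n ih =>
    rw [pow_succ, Matrix.SpecialLinearGroup.coe_mul, ih, hX, Matrix.smul_mul, Matrix.mul_smul,
      smul_smul, ← pow_succ]
    congr 1
    ext i j
    fin_cases i <;> fin_cases j <;>
      simp [parabolicMatrix, Matrix.mul_apply, Fin.sum_univ_two]
    · linear_combination (-(n * t * t)) * hp
    · ring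
    · ring
    · linear_combination (-(n * t * t)) * hp

end Matrices

/-! ### Möbius action and automorphy factors of the branches -/

section Action

variable {X : SL(2, ℝ)} {σ p t : ℝ} {z : ℂ}

theorem den_parabolic (hX : (X : Matrix (Fin 2) (Fin 2) ℝ) = σ • parabolicMatrix p t) :
    den X z = σ * (1 + t * (1 - p * z)) := by
  simp [den, hX, parabolicMatrix]
  ring

theorem moebius_parabolic (hp : p * p = 1) (hσ : σ ≠ 0) (hz : 1 + (t : ℂ) * (1 - p * z) ≠ 0)
    (hX : (X : Matrix (Fin 2) (Fin 2) ℝ) = σ • parabolicMatrix p t) :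
    moebius X z = p - p * ((1 - p * z) / (1 + t * (1 - p * z))) := by
  have hσ' : (σ : ℂ) ≠ 0 := by exact_mod_cast hσ
  have hp' : (p : ℂ) * p = 1 := by exact_mod_cast hp
  rw [moebius, den_parabolic hX]
  simp only [hX, parabolicMatrix, Matrix.smul_apply, Matrix.of_apply, Matrix.cons_val_zero,
    Matrix.cons_val_one, smul_eq_mul, Matrix.cons_val', Matrix.cons_val_fin_one]
  push_cast
  rw [div_eq_iff (mul_ne_zero hσ' hz)]
  have hc := div_mul_cancel₀ (1 - (p : ℂ) * z) hz
  linear_combination (p * σ : ℂ) * hc + (σ * t * z - σ * z : ℂ) * hp'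

theorem autFactor_parabolic (hσ : σ = 1 ∨ σ = -1) (ht : 0 ≤ t)
    (hX : (X : Matrix (Fin 2) (Fin 2) ℝ) = σ • parabolicMatrix p t) (s : ℂ) :
    autFactor s X z = (1 + t * (1 - p * z)) ^ (-2 * s) := by
  have h11 : X 1 1 = σ * (1 + t) := by simp [hX, parabolicMatrix]
  rw [autFactor, h11, den_parabolic hX]
  congr 1
  rcases hσ with rfl | rfl
  · rw [one_mul, Real.sign_of_pos (by linarith)]
    simp
  · rw [Real.sign_of_neg (by linarith)]
    simp

/-- The normalized denominator has values in the slit plane on a disc that is mapped into the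
plane. -/
theorem sign_mul_den_mem_slitPlane {E : Disc} {U : Set ℂ} (hmaps : MapsInto X E.cl U)
    (hlt : |X 1 0| < |X 1 1|) {x₀ : ℝ} (hx₀ : |x₀| ≤ 1) (hxE : (x₀ : ℂ) ∈ E.cl) (hz : z ∈ E.cl) :
    (Real.sign (X 1 1) : ℂ) * den X z ∈ slitPlane := by
  set c : ℝ := Real.sign (X 1 1) * X 1 0 with hc
  set d : ℝ := |X 1 1| with hd
  have h11 : Real.sign (X 1 1) * X 1 1 = d := by
    rcases lt_trichotomy (X 1 1) 0 with h | h | h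
    · rw [Real.sign_of_neg h, hd, abs_of_neg h]; ring
    · simp [hd, h]
    · rw [Real.sign_of_pos h, hd, abs_of_pos h, one_mul]
  have hcd : |c| < d := by
    refine lt_of_le_of_lt ?_ hlt
    rw [hc, abs_mul]
    refine mul_le_of_le_one_left (abs_nonneg _) ?_
    rcases Real.sign_apply_eq (X 1 1) with h | h | h <;> simp [h]
  have hden : ∀ w : ℂ, (Real.sign (X 1 1) : ℂ) * den X w = c * w + d := by
    intro w
    rw [den, ← h11, hc]
    push_cast
    ring
  -- Outside the slit plane the normalized denominator is real and nonpositive, which forces `z` to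
  -- be real. At `x₀` it is positive, so by convexity the disc contains a zero of the denominator,
  -- which `MapsInto` excludes.
  by_contra hns
  rw [hden, mem_slitPlane_iff, not_or, not_lt, not_not] at hns
  simp only [add_re, mul_re, ofReal_re, ofReal_im, zero_mul, sub_zero, add_im, mul_im,
    add_zero] at hns
  obtain ⟨hre, him⟩ := hns
  have hd0 : 0 < d := (abs_nonneg c).trans_lt hcd
  have hc0 : c ≠ 0 := by
    intro h
    rw [h] at hre
    linarith
  have hzim : z.im = 0 := (mul_eq_zero.1 him).resolve_left hc0
  have hzr : z = (z.re : ℂ) := Complex.ext (by simp) (by simpa using hzim)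
  have hpos : 0 < c * x₀ + d := by
    have h1 : |c * x₀| ≤ |c| := by
      rw [abs_mul]
      exact mul_le_of_le_one_right (abs_nonneg _) hx₀
    linarith [(abs_le.1 h1).1]
  -- the pole lies on the segment between `x₀` and `z`
  set t : ℝ := (c * x₀ + d) / (c * x₀ - c * z.re) with ht
  have hden0 : 0 < c * x₀ - c * z.re := by linarith
  have ht0 : 0 ≤ t := by positivity
  have ht1 : t ≤ 1 := (div_le_one hden0).2 (by linarith)
  have hmem : ((1 - t : ℝ) : ℂ) * x₀ + (t : ℂ) * z ∈ E.cl := by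
    have h1 := (convex_closedBall E.center E.radius) hxE hz (sub_nonneg.2 ht1) ht0
      (sub_add_cancel 1 t)
    rwa [Complex.real_smul, Complex.real_smul] at h1
  have hzero := hden (((1 - t : ℝ) : ℂ) * x₀ + (t : ℂ) * z)
  have hval : (c : ℂ) * (((1 - t : ℝ) : ℂ) * x₀ + (t : ℂ) * z) + d = 0 := by
    have h1 : c * ((1 - t) * x₀ + t * z.re) + d = 0 := by
      have h2 : t * (c * x₀ - c * z.re) = c * x₀ + d := div_mul_cancel₀ _ hden0.ne'
      linear_combination -h2
    rw [hzr]
    exact_mod_cast h1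
  rw [hval] at hzero
  have hsign : (Real.sign (X 1 1) : ℂ) ≠ 0 := by
    intro h
    have h' : Real.sign (X 1 1) = 0 := by exact_mod_cast h
    rw [h', zero_mul] at h11
    linarith
  exact (hmaps _ hmem).1 ((mul_eq_zero.1 hzero).resolve_left hsign)

theorem isHol_den (D : Disc) (X : SL(2, ℝ)) : IsHol D (den X) :=
  ((isHol_id).const_mul _).add (isHol_const _)

theorem isHol_moebius {D : Disc} {U : Set ℂ} (hmaps : MapsInto X D.cl U) :
    IsHol D (moebius X) :=
  (((isHol_id).const_mul _).add (isHol_const _)).div (isHol_den D X) fun z hz => (hmaps z hz).1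

end Action

/-! ### Parabolic generators in PSL(2, ℝ) and their fixed spaces under η -/

section Representation

variable {q : ℕ}

theorem proj_eq_of_coe_eq {X Y : SL(2, ℝ)} {σ : ℝ} (hσ : σ = 1 ∨ σ = -1)
    (h : (X : Matrix (Fin 2) (Fin 2) ℝ) = σ • (Y : Matrix (Fin 2) (Fin 2) ℝ)) :
    proj X = proj Y := by
  refine QuotientGroup.eq.2 ?_
  rw [Matrix.SpecialLinearGroup.mem_center_iff]
  refine ⟨σ, by rcases hσ with rfl | rfl <;> simp, ?_⟩
  have hσ2 : σ * σ = 1 := by rcases hσ with rfl | rfl <;> norm_num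
  have hY : (Y : Matrix (Fin 2) (Fin 2) ℝ) = σ • (X : Matrix (Fin 2) (Fin 2) ℝ) := by
    rw [h, smul_smul, hσ2, one_smul]
  rw [Matrix.SpecialLinearGroup.coe_mul, hY, Matrix.mul_smul, ← Matrix.SpecialLinearGroup.coe_mul,
    inv_mul_cancel, Matrix.SpecialLinearGroup.coe_one]
  simp [Matrix.scalar_apply, Matrix.smul_one_eq_diagonal]

theorem proj_h_one (hq : 3 ≤ q) : proj (h q 1) = (proj (conjT q))⁻¹ := by
  rw [eq_inv_iff_mul_eq_one, ← inv_eq_iff_mul_eq_one, ← map_inv]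
  refine proj_eq_of_coe_eq (σ := -1) (Or.inr rfl) ?_
  have hT : ((matT q : SL(2, ℝ)) : Matrix (Fin 2) (Fin 2) ℝ) = (1 : ℝ) • !![1, lam q; 0, 1] := by
    simp [matT]
  rw [coe_h_one_inv hq, conjT, coe_conj_matC hT, one_smul, parabolicMatrix]
  congr 1
  ext i j
  fin_cases i <;> fin_cases j <;> simp <;> ring

/-- A matrix representing the conjugate of `S`. -/
def conjS : SL(2, ℝ) := matC * matS * matC⁻¹

theorem conjS_mem (q : ℕ) : proj conjS ∈ conjGroup q := proj_conj_mem (matS_mem q)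

/-- There is only one cusp: $S$ interchanges the two parabolic fixed points. Hence both generators
have fixed spaces of the same dimension under `η`. -/
theorem proj_h_pred (hq : 3 ≤ q) :
    proj (h q (q - 1)) = (proj conjS)⁻¹ * proj (conjT q) * proj conjS := by
  have h1 : proj (h q (q - 1)) = proj (conjS⁻¹ * conjT q * conjS) := by
    rw [← inv_inj, ← map_inv, ← map_inv]
    refine proj_eq_of_coe_eq (σ := (-1) ^ (q - 1)) (neg_one_pow_eq_or ℝ _) ?_
    have he : (conjS⁻¹ * conjT q * conjS)⁻¹ =
        matC * (matS⁻¹ * (matT q)⁻¹ * matS) * matC⁻¹ := by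
      simp [conjS, conjT, mul_assoc]
    have hT : ((matS⁻¹ * (matT q)⁻¹ * matS : SL(2, ℝ)) : Matrix (Fin 2) (Fin 2) ℝ) =
        (1 : ℝ) • !![1, 0; lam q, 1] := by
      rw [Matrix.SpecialLinearGroup.coe_mul, Matrix.SpecialLinearGroup.coe_mul,
        Matrix.SpecialLinearGroup.coe_inv, Matrix.SpecialLinearGroup.coe_inv]
      ext i j
      fin_cases i <;> fin_cases j <;>
        simp [matS, matT, Matrix.adjugate_fin_two, Matrix.mul_apply, Fin.sum_univ_two]
    rw [coe_h_pred_inv hq, he, coe_conj_matC hT, one_smul, parabolicMatrix]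
    congr 1
    ext i j
    fin_cases i <;> fin_cases j <;> simp <;> ring
  rw [h1, map_mul, map_mul, map_inv]

variable {V : Type*} [NormedAddCommGroup V] [InnerProductSpace ℂ V]

theorem ker_sub_id_inv (A : V ≃ₗᵢ[ℂ] V) :
    LinearMap.ker (A⁻¹.toLinearEquiv.toLinearMap - LinearMap.id) =
      LinearMap.ker (A.toLinearEquiv.toLinearMap - LinearMap.id) := by
  ext v
  simp only [LinearMap.mem_ker, LinearMap.sub_apply, LinearMap.id_apply, sub_eq_zero]
  change A.symm v = v ↔ A v = v
  rw [LinearIsometryEquiv.symm_apply_eq, eq_comm]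

theorem finrank_ker_sub_id_conj (A B : V ≃ₗᵢ[ℂ] V) :
    Module.finrank ℂ (LinearMap.ker ((B⁻¹ * A * B).toLinearEquiv.toLinearMap - LinearMap.id)) =
      Module.finrank ℂ (LinearMap.ker (A.toLinearEquiv.toLinearMap - LinearMap.id)) := by
  have h : LinearMap.ker (A.toLinearEquiv.toLinearMap - LinearMap.id) =
      (LinearMap.ker ((B⁻¹ * A * B).toLinearEquiv.toLinearMap - LinearMap.id)).map
        B.toLinearEquiv.toLinearMap := by
    ext v
    rw [Submodule.mem_map]
    simp only [LinearMap.mem_ker, LinearMap.sub_apply, LinearMap.id_apply, sub_eq_zero]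
    constructor
    · intro hv
      have hv' : A v = v := hv
      refine ⟨B.symm v, ?_, B.apply_symm_apply v⟩
      change B.symm (A (B (B.symm v))) = B.symm v
      rw [B.apply_symm_apply, hv']
    · rintro ⟨w, hw, rfl⟩
      have hw' : B.symm (A (B w)) = w := hw
      change A (B w) = B w
      rwa [LinearIsometryEquiv.symm_apply_eq] at hw'
  rw [h]
  exact (LinearEquiv.finrank_map_eq B.toLinearEquiv _).symm

variable (η : conjGroup q →* (V ≃ₗᵢ[ℂ] V))

/-- The unitary map `η(h_k)`. -/
def etaH (k : ℕ) : V ≃ₗᵢ[ℂ] V := η ⟨proj (h q k ^ 1), h_pow_mem q k 1⟩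

theorem eta_h_pow (k n : ℕ) : η ⟨proj (h q k ^ n), h_pow_mem q k n⟩ = etaH η k ^ n := by
  rw [etaH, ← map_pow]
  congr 1
  exact Subtype.ext (by simp)

theorem finrank_ker_etaH_one (hq : 3 ≤ q) :
    Module.finrank ℂ (LinearMap.ker ((etaH η 1).toLinearEquiv.toLinearMap - LinearMap.id)) =
      sd η := by
  have h1 : etaH η 1 = (η ⟨proj (conjT q), conjT_mem q⟩)⁻¹ := by
    rw [etaH, ← map_inv]
    congr 1
    exact Subtype.ext (by simpa using proj_h_one hq)
  rw [h1, ker_sub_id_inv, sd]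

theorem finrank_ker_etaH_pred (hq : 3 ≤ q) :
    Module.finrank ℂ (LinearMap.ker ((etaH η (q - 1)).toLinearEquiv.toLinearMap - LinearMap.id)) =
      sd η := by
  have h1 : etaH η (q - 1) = (η ⟨proj conjS, conjS_mem q⟩)⁻¹ *
      η ⟨proj (conjT q), conjT_mem q⟩ * η ⟨proj conjS, conjS_mem q⟩ := by
    rw [etaH, ← map_inv, ← map_mul, ← map_mul]
    congr 1
    exact Subtype.ext (by simpa using proj_h_pred hq)
  rw [h1, finrank_ker_sub_id_conj, sd]

end Representation

/-! ### Existence of admissible triples of discs -/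

section Existence

variable {q : ℕ}

theorem image_neg_conj_ball (c : ℂ) (r : ℝ) :
    (fun z : ℂ => -(starRingEnd ℂ) z) '' ball c r = ball (-(starRingEnd ℂ) c) r := by
  have hnorm : ∀ z w : ℂ, ‖-(starRingEnd ℂ) z - -(starRingEnd ℂ) w‖ = ‖z - w‖ := by
    intro z w
    rw [← neg_sub', norm_neg, ← map_sub, RCLike.norm_conj]
  ext w
  constructor
  · rintro ⟨z, hz, rfl⟩
    rw [mem_ball_iff_norm] at hz ⊢
    rwa [hnorm]
  · intro hw
    refine ⟨-(starRingEnd ℂ) w, ?_, by simp⟩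
    rw [mem_ball_iff_norm] at hw ⊢
    rw [← hnorm] at hw
    simpa using hw

theorem closure_realInterval_subset {a b r : ℝ} {c : ℝ} (ha : c - r < a) (hb : b < c + r) :
    closure (realInterval a b) ⊆ ball (c : ℂ) r := by
  have hsub : realInterval a b ⊆ Complex.ofReal '' Set.Icc a b :=
    Set.image_mono Set.Ioo_subset_Icc_self
  have hcl : IsClosed (Complex.ofReal '' Set.Icc a b) :=
    (isCompact_Icc.image Complex.continuous_ofReal).isClosed
  refine (closure_minimal hsub hcl).trans ?_
  rintro _ ⟨x, hx, rfl⟩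
  rw [mem_ball_iff_norm, ← ofReal_sub, norm_real, Real.norm_eq_abs, abs_lt]
  constructor <;> linarith [hx.1, hx.2]

theorem abs_re_sub_le_of_mem_closedBall {z : ℂ} {c r : ℝ} (hz : z ∈ closedBall (c : ℂ) r) :
    |z.re - c| ≤ r := by
  rw [mem_closedBall_iff_norm] at hz
  simpa using (abs_re_le_norm (z - c)).trans hz

/-- Here $y=1-pz$ and the branch is $1/y\mapsto1/y+t$. For $y\ne0$ the hypothesis says
$\operatorname{Re}(1/y)\ge1/(2+\delta)$, the disc with diameter $[0,2+\delta]$. After translation by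
$t\ge\frac12$ the image lies in a disc with diameter $[0,b-\delta]$, hence inside the open disc with
diameter $(-\delta,b)$. -/
theorem parabolic_mem_ball {y : ℂ} {b δ t : ℝ} (hδ : 0 < δ) (hδ' : δ ≤ 1 / 10) (hb : 4 / 3 ≤ b)
    (ht : 1 / 2 ≤ t) (hy : normSq y ≤ (2 + δ) * y.re) :
    1 + t * y ≠ 0 ∧ ‖((b - δ) / 2 : ℝ) - y / (1 + t * y)‖ < (b + δ) / 2 := by
  have hY := normSq_nonneg y
  have hre : 0 ≤ y.re := by
    by_contra h
    nlinarith
  have hne : 1 + (t : ℂ) * y ≠ 0 := by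
    intro h
    have h1 := congrArg Complex.re h
    simp at h1
    nlinarith
  refine ⟨hne, ?_⟩
  have hN : 0 < ‖1 + (t : ℂ) * y‖ := norm_pos_iff.2 hne
  have heq : (((b - δ) / 2 : ℝ) : ℂ) - y / (1 + t * y) =
      (((b - δ) / 2 : ℝ) * (1 + t * y) - y) / (1 + t * y) := by
    rw [eq_div_iff hne, sub_mul, div_mul_cancel₀ _ hne]
  rw [heq, norm_div, div_lt_iff₀ hN]
  refine lt_of_pow_lt_pow_left₀ 2 (by positivity) ?_
  rw [mul_pow, ← normSq_eq_norm_sq, ← normSq_eq_norm_sq, normSq_apply, normSq_apply]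
  rw [normSq_apply] at hy hY
  simp only [sub_re, sub_im, mul_re, mul_im, add_re, add_im, ofReal_re, ofReal_im, one_re, one_im,
    zero_mul, sub_zero, add_zero, zero_add]
  set u := y.re
  set v := y.im
  have h1 : (1 : ℝ) ≤ (b - δ) * (1 / (2 + δ) + t) := by
    have h2 : (10 : ℝ) / 21 ≤ 1 / (2 + δ) := by
      rw [div_le_div_iff₀ (by norm_num) (by linarith)]
      linarith
    nlinarith
  have h3 : (u * u + v * v) * (1 / (2 + δ)) ≤ u := by
    rw [mul_one_div, div_le_iff₀ (by linarith)]
    linarith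
  -- This is $|y'|^2\le(b-\delta)\operatorname{Re}y'$ for the image $y'=y/(1+ty)$, with denominators
  -- cleared. The strictly positive slack in `h5` is $b\delta|1+ty|^2$, since $b\delta$ is the
  -- difference of the squares of $(b+\delta)/2$ and $(b-\delta)/2$.
  have h4 : u * u + v * v ≤ (b - δ) * (u + t * (u * u + v * v)) := by
    calc u * u + v * v = 1 * (u * u + v * v) := (one_mul _).symm
      _ ≤ (b - δ) * (1 / (2 + δ) + t) * (u * u + v * v) := by gcongr
      _ = (b - δ) * ((u * u + v * v) * (1 / (2 + δ)) + t * (u * u + v * v)) := by ring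
      _ ≤ _ := by
        have : 0 ≤ b - δ := by linarith
        gcongr
  have h5 : 0 < b * δ * ((1 + t * u) * (1 + t * u) + t * v * (t * v)) := by
    have : 0 < 1 + t * u := by nlinarith
    have h6 : 0 ≤ t * v * (t * v) := mul_self_nonneg _
    have : 0 < b := by linarith
    positivity
  nlinarith [h4, h5]

theorem mapsInto_parabolic_ball {X : SL(2, ℝ)} {σ p t b δ : ℝ} (hp : p = 1 ∨ p = -1)
    (hσ : σ = 1 ∨ σ = -1)
    (hX : (X : Matrix (Fin 2) (Fin 2) ℝ) = σ • parabolicMatrix p t) (hδ : 0 < δ)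
    (hδ' : δ ≤ 1 / 10) (hb : 4 / 3 ≤ b) (ht : 1 / 2 ≤ t) {K : Set ℂ}
    (hK : ∀ z ∈ K, normSq (1 - p * z) ≤ (2 + δ) * (1 - p * z).re) :
    MapsInto X K (ball ((p * (1 - (b - δ) / 2) : ℝ) : ℂ) ((b + δ) / 2)) := by
  intro z hz
  have hσ0 : σ ≠ 0 := by rcases hσ with rfl | rfl <;> norm_num
  have hpp : p * p = 1 := by rcases hp with rfl | rfl <;> norm_num
  have hpn : ‖(p : ℂ)‖ = 1 := by rcases hp with rfl | rfl <;> simp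
  obtain ⟨hne, hlt⟩ := parabolic_mem_ball hδ hδ' hb ht (hK z hz)
  refine ⟨?_, ?_⟩
  · rw [den_parabolic hX]
    exact mul_ne_zero (by exact_mod_cast hσ0) hne
  · rw [moebius_parabolic hpp hσ0 hne hX, mem_ball_iff_norm]
    have heq : (p : ℂ) - p * ((1 - p * z) / (1 + t * (1 - p * z))) -
        ((p * (1 - (b - δ) / 2) : ℝ) : ℂ) =
        p * (((b - δ) / 2 : ℝ) - (1 - p * z) / (1 + t * (1 - p * z))) := by
      push_cast
      ring
    rwa [heq, norm_mul, hpn, one_mul]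

/-- On the unit disc $|h_k^{-1}.z|=|Az+B|/|D-Bz|\le(A+|B|)/(D-|B|)$, and this bound is at most
$\mu$. The estimate is kept free of division so that it defines an open set of `z`. -/
theorem norm_num_lt_norm_den (hq : 3 ≤ q) {k : ℕ} (hk : k ∈ Finset.Icc 2 (q - 2)) {r : ℝ}
    (hr : (lam q - 1) / (lam q + 1) < r) {z : ℂ} (hz : ‖z‖ ≤ 1) :
    ‖((h q k)⁻¹ 0 0 : ℂ) * z + ((h q k)⁻¹ 0 1 : ℂ)‖ < r * ‖den (h q k)⁻¹ z‖ := by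
  rw [Finset.mem_Icc] at hk
  have hl := one_le_lam hq
  have hl2 := lam_lt_two hq
  have hk2 : (2 : ℝ) ≤ k := by exact_mod_cast hk.1
  have hkq : (k : ℝ) + 2 ≤ q := by exact_mod_cast (by omega : k + 2 ≤ q)
  have hX := coe_h_inv hq k
  have hU0 := chebU_pos hq (x := k) (by linarith) (by linarith)
  have hUm := chebU_pos hq (x := (k : ℝ) - 1) (by linarith) (by linarith)
  have hUp := chebU_pos hq (x := (k : ℝ) + 1) (by linarith) (by linarith)
  have hUmm := chebU_nonneg hq (x := (k : ℝ) - 1 - 1) (by linarith) (by linarith)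
  have hUpp := chebU_nonneg hq (x := (k : ℝ) + 1 + 1) (by linarith) (by linarith)
  have r1 := chebU_add_one (q := q) ((k : ℝ) - 1)
  have r2 := chebU_add_one (q := q) (k : ℝ)
  have r3 := chebU_add_one (q := q) ((k : ℝ) + 1)
  rw [sub_add_cancel] at r1
  rw [add_sub_cancel_right] at r3
  set U0 := chebU q k
  set Um := chebU q ((k : ℝ) - 1)
  set Up := chebU q ((k : ℝ) + 1)
  set A : ℝ := U0 - (Up + Um) / 2 with hA
  set B : ℝ := (Up - Um) / 2 with hB
  set D : ℝ := U0 + (Up + Um) / 2 with hD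
  set σ : ℝ := (-1) ^ k with hσ
  have hσn : ‖(σ : ℂ)‖ = 1 := by
    rcases neg_one_pow_eq_or ℝ k with h1 | h1 <;> simp [hσ, h1]
  have hA0 : 0 ≤ A := by nlinarith
  have e1 : ((h q k)⁻¹ 0 0 : ℂ) * z + ((h q k)⁻¹ 0 1 : ℂ) = σ * (A * z + B) := by
    simp [hX]
    ring
  have e2 : den (h q k)⁻¹ z = σ * (D - B * z) := by
    simp [den, hX]
    ring
  rw [e1, e2, norm_mul, norm_mul, hσn, one_mul, one_mul]
  have hBz : ‖(B : ℂ) * z‖ ≤ |B| := by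
    rw [norm_mul, norm_real, Real.norm_eq_abs]
    exact mul_le_of_le_one_right (abs_nonneg _) hz
  have n1 : ‖(A : ℂ) * z + B‖ ≤ A + |B| := by
    refine (norm_add_le _ _).trans ?_
    rw [norm_mul, norm_real, norm_real, Real.norm_eq_abs, Real.norm_eq_abs, abs_of_nonneg hA0]
    gcongr
    exact mul_le_of_le_one_right hA0 hz
  have n2 : D - |B| ≤ ‖(D : ℂ) - B * z‖ := by
    have h1 := norm_sub_norm_le (D : ℂ) (B * z)
    have h2 : D ≤ ‖(D : ℂ)‖ := by
      rw [norm_real]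
      exact le_abs_self D
    linarith
  -- For $B\ge0$ the quotient is $(U_k-U_{k-1})/(U_k+U_{k-1})$. It is at most $\mu$ iff
  -- $U_k\le\lambda U_{k-1}$, that is, iff $U_{k-2}\ge0$. For $B\le0$ the same holds with $U_{k+1}$
  -- and $U_{k+2}\ge0$. These signs use $2\le k\le q-2$.
  have key : A + |B| ≤ (lam q - 1) / (lam q + 1) * (D - |B|) ∧ 0 < D - |B| := by
    rw [div_mul_eq_mul_div, le_div_iff₀ (by linarith)]
    rcases le_total 0 B with hB0 | hB0
    · rw [abs_of_nonneg hB0]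
      constructor <;> nlinarith
    · rw [abs_of_nonpos hB0]
      constructor <;> nlinarith
  have hμ : 0 ≤ (lam q - 1) / (lam q + 1) := div_nonneg (by linarith) (by linarith)
  calc ‖(A : ℂ) * z + B‖ ≤ (lam q - 1) / (lam q + 1) * (D - |B|) := n1.trans key.1
    _ < r * (D - |B|) := by gcongr; exact key.2
    _ ≤ _ := mul_le_mul_of_nonneg_left n2 (hμ.trans hr.le)

/-- A strict inequality on the compact unit disc persists on a slightly larger disc, uniformly over
the finitely many `k`. -/
theorem exists_mapsInto_middle (hq : 3 ≤ q) {r : ℝ} (hr : (lam q - 1) / (lam q + 1) < r) :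
    ∃ δ : ℝ, 0 < δ ∧ δ ≤ 1 / 10 ∧ ∀ k ∈ Finset.Icc 2 (q - 2),
      MapsInto (h q k)⁻¹ (closedBall 0 (1 + δ)) (ball 0 r) := by
  set W : Set ℂ := ⋂ k ∈ Finset.Icc 2 (q - 2),
    {z | ‖((h q k)⁻¹ 0 0 : ℂ) * z + ((h q k)⁻¹ 0 1 : ℂ)‖ < r * ‖den (h q k)⁻¹ z‖} with hW
  have hWo : IsOpen W := by
    refine isOpen_biInter_finset fun k _ => ?_
    refine isOpen_lt (by fun_prop) ?_
    simp only [den]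
    fun_prop
  have hsub : closedBall (0 : ℂ) 1 ⊆ W := by
    intro z hz
    rw [mem_closedBall_zero_iff] at hz
    exact Set.mem_iInter₂.2 fun k hk => norm_num_lt_norm_den hq hk hr hz
  obtain ⟨δ, hδ, hδW⟩ := (isCompact_closedBall (0 : ℂ) 1).exists_cthickening_subset_open hWo hsub
  rw [cthickening_closedBall hδ.le zero_le_one] at hδW
  refine ⟨min δ (1 / 10), lt_min hδ (by norm_num), min_le_right _ _, fun k hk z hz => ?_⟩
  have hzW : z ∈ W := hδW (closedBall_subset_closedBall (by linarith [min_le_left δ (1 / 10)]) hz)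
  have hlt := Set.mem_iInter₂.1 hzW k hk
  rw [Set.mem_ofPred_eq] at hlt
  have hne : den (h q k)⁻¹ z ≠ 0 := by
    intro h0
    rw [h0, norm_zero, mul_zero] at hlt
    exact absurd hlt (not_lt.2 (norm_nonneg _))
  refine ⟨hne, ?_⟩
  rw [mem_ball_zero_iff, moebius, norm_div, div_lt_iff₀ (norm_pos_iff.2 hne)]
  exact hlt

theorem normSq_one_sub_le_of_norm_le {w : ℂ} {δ : ℝ} (hδ : 0 ≤ δ) (hw : ‖w‖ ≤ 1) :
    normSq (1 - w) ≤ (2 + δ) * (1 - w).re := by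
  have h1 : normSq w ≤ 1 := by
    rw [normSq_eq_norm_sq]
    exact pow_le_one₀ (norm_nonneg _) hw
  have h2 : w.re ≤ 1 := (re_le_norm w).trans hw
  rw [normSq_apply] at h1 ⊢
  simp only [sub_re, sub_im, one_re, one_im]
  nlinarith

/-- For the disc opposite to the fixed point, $1-w$ runs through the disc with diameter
$[2-b,2+\delta]$, which lies in the one with diameter $[0,2+\delta]$ as $b\le2$. -/
theorem normSq_one_sub_le_of_mem_closedBall {w : ℂ} {b δ : ℝ} (hb : b ≤ 2)
    (hw : w ∈ closedBall ((-(1 - (b - δ) / 2) : ℝ) : ℂ) ((b + δ) / 2)) :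
    normSq (1 - w) ≤ (2 + δ) * (1 - w).re := by
  have hre := (abs_le.1 (abs_re_sub_le_of_mem_closedBall hw)).1
  rw [mem_closedBall_iff_norm] at hw
  have h1 := pow_le_pow_left₀ (norm_nonneg _) hw 2
  rw [← normSq_eq_norm_sq, normSq_apply] at h1
  rw [normSq_apply]
  simp only [sub_re, sub_im, one_re, one_im, ofReal_re, ofReal_im, sub_zero, zero_sub] at h1 ⊢
  nlinarith

theorem exists_isAdmissible (hq : 3 ≤ q) : ∃ E : DiscTriple, E.IsAdmissible q := by
  have hl := one_le_lam hq
  have hl2 := lam_lt_two hq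
  set μ := (lam q - 1) / (lam q + 1) with hμ
  have hμ0 : 0 ≤ μ := div_nonneg (by linarith) (by linarith)
  have hμ1 : μ < 1 / 3 := by
    rw [hμ, div_lt_iff₀ (by linarith)]
    linarith
  -- The middle disc is centered at `0` with `μ < r < 1`.
  set r := (1 + μ) / 2 with hr
  obtain ⟨δ, hδ, hδ', hmid⟩ := exists_mapsInto_middle hq (r := r) (by linarith)
  -- The disc at `1` has real diameter from `1 - b` to `1 + δ`. This choice gives `-1 < 1 - b < μ`,
  -- and `μ < 1 / 3` gives the bound `4 / 3 ≤ b` needed for the contraction.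
  set b := (3 - μ) / 2 with hb
  have hb1 : 4 / 3 ≤ b := by linarith
  have hb2 : b ≤ 3 / 2 := by linarith
  set c := 1 - (b - δ) / 2 with hc
  set R := (b + δ) / 2 with hR
  have hR0 : 0 < R := by linarith
  let D1 : Disc := ⟨((1 * c : ℝ) : ℂ), R, hR0⟩
  let D2 : Disc := ⟨((-1 * c : ℝ) : ℂ), R, hR0⟩
  let Dr : Disc := ⟨((0 : ℝ) : ℂ), r, by linarith⟩
  have hcl : ∀ (p : ℝ) (z : ℂ), (p = 1 ∨ p = -1) → z ∈ closedBall ((p * c : ℝ) : ℂ) R →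
      z ∈ closedBall (0 : ℂ) (1 + δ) := by
    intro p z hp hz
    rw [mem_closedBall_iff_norm] at hz
    have h1 : ‖((p * c : ℝ) : ℂ)‖ = c := by
      rw [norm_real, Real.norm_eq_abs, abs_mul, abs_of_nonneg (by linarith : 0 ≤ c)]
      rcases hp with rfl | rfl <;> simp
    have h2 := norm_sub_norm_le z ((p * c : ℝ) : ℂ)
    rw [mem_closedBall_zero_iff]
    linarith
  have hclr : ∀ z ∈ closedBall ((0 : ℝ) : ℂ) r, ‖z‖ ≤ 1 := by
    intro z hz
    rw [ofReal_zero, mem_closedBall_zero_iff] at hz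
    linarith
  have hpar : ∀ (X : SL(2, ℝ)) (σ p : ℝ), (p = 1 ∨ p = -1) → (σ = 1 ∨ σ = -1) →
      (X : Matrix (Fin 2) (Fin 2) ℝ) = σ • parabolicMatrix p (lam q / 2) → ∀ n : ℕ, 1 ≤ n →
      MapsInto (X ^ n) Dr.cl (ball ((p * c : ℝ) : ℂ) R) ∧
      MapsInto (X ^ n) (closedBall ((-p * c : ℝ) : ℂ) R) (ball ((p * c : ℝ) : ℂ) R) := by
    intro X σ p hp hσ hX n hn
    have hpp : p * p = 1 := by rcases hp with rfl | rfl <;> norm_num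
    have hpn : ‖(p : ℂ)‖ = 1 := by rcases hp with rfl | rfl <;> simp
    have hσn : σ ^ n = 1 ∨ σ ^ n = -1 := by
      rcases hσ with rfl | rfl
      · simp
      · exact neg_one_pow_eq_or ℝ n
    have hn' : (1 : ℝ) ≤ n := by exact_mod_cast hn
    have ht : 1 / 2 ≤ n * (lam q / 2) := by nlinarith
    have hXn := coe_parabolic_pow hpp hX n
    refine ⟨mapsInto_parabolic_ball hp hσn hXn hδ hδ' hb1 ht fun z hz => ?_,
      mapsInto_parabolic_ball hp hσn hXn hδ hδ' hb1 ht fun z hz => ?_⟩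
    · refine normSq_one_sub_le_of_norm_le hδ.le ?_
      rw [norm_mul, hpn, one_mul]
      exact hclr z hz
    · refine normSq_one_sub_le_of_mem_closedBall (b := b) (by linarith) ?_
      rw [mem_closedBall_iff_norm] at hz ⊢
      have hppc : (p : ℂ) * p = 1 := by exact_mod_cast hpp
      have heq : (p : ℂ) * z - ((-(1 - (b - δ) / 2) : ℝ) : ℂ) = p * (z - ((-p * c : ℝ) : ℂ)) := by
        rw [hc]
        push_cast
        linear_combination (-(1 - ((b : ℂ) - δ) / 2)) * hppc
      rwa [heq, norm_mul, hpn, one_mul]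
  refine ⟨⟨D1, Dr, D2⟩, ?_⟩
  constructor
  · exact closure_realInterval_subset (by linarith) (by linarith)
  · exact closure_realInterval_subset (by linarith) (by linarith)
  · exact closure_realInterval_subset (by linarith) (by linarith)
  · change _ '' ball ((0 : ℝ) : ℂ) r = ball ((0 : ℝ) : ℂ) r
    rw [image_neg_conj_ball]
    simp
  · change _ '' ball ((1 * c : ℝ) : ℂ) R = ball ((-1 * c : ℝ) : ℂ) R
    rw [image_neg_conj_ball, conj_ofReal, ← ofReal_neg]
    congr 2
    ring
  · intro k hk
    have hm := hmid k hk
    rw [← ofReal_zero] at hm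
    refine ⟨fun z hz => hm z ?_, fun z hz => hm z ?_, fun z hz => hm z ?_⟩
    · rw [ofReal_zero]
      exact hcl 1 z (Or.inl rfl) hz
    · rw [ofReal_zero, mem_closedBall_zero_iff]
      linarith [hclr z hz]
    · rw [ofReal_zero]
      exact hcl (-1) z (Or.inr rfl) hz
  · intro n hn
    rw [← inv_pow]
    exact hpar _ _ 1 (Or.inl rfl) (Or.inr rfl) (coe_h_one_inv hq) n hn
  · intro n hn
    rw [← inv_pow]
    have h1 := hpar _ _ (-1) (Or.inr rfl) (neg_one_pow_eq_or ℝ _) (coe_h_pred_inv hq) n hn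
    rw [neg_neg] at h1
    exact h1.symm
  · intro z hz
    have := (abs_le.1 (abs_re_sub_le_of_mem_closedBall hz)).1
    linarith
  · intro z hz
    have := (abs_le.1 (abs_re_sub_le_of_mem_closedBall hz)).2
    linarith
  · intro z hz
    have := abs_le.1 (abs_re_sub_le_of_mem_closedBall hz)
    constructor <;> linarith [this.1, this.2]

end Existence

/-! ### The blocks of the fast transfer operator -/

section Blocks

variable {q : ℕ} {V : Type*} [NormedAddCommGroup V] [InnerProductSpace ℂ V] {D D' : Disc}

theorem beta_eq (η : conjGroup q →* (V ≃ₗᵢ[ℂ] V)) (s : ℂ) (k n : ℕ) (f : ℂ → V) (z : ℂ) :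
    beta η s k n f z =
      autFactor s (h q k ^ n)⁻¹ z • (etaH η k ^ n) (f (moebius (h q k ^ n)⁻¹ z)) := by
  rw [beta, eta_h_pow, tau, map_smul]

variable [FiniteDimensional ℂ V]

/-- The continuation of the block `∑ₙ β_s(h_k^n)`, if `h_k` is parabolic with fixed point `p`. -/
theorem exists_series_block (hq : 3 ≤ q) (η : conjGroup q →* (V ≃ₗᵢ[ℂ] V)) {k : ℕ} {σ p : ℝ}
    (hp : p = 1 ∨ p = -1) (hσ : σ = 1 ∨ σ = -1)
    (hX : (((h q k)⁻¹ : SL(2, ℝ)) : Matrix (Fin 2) (Fin 2) ℝ) = σ • parabolicMatrix p (lam q / 2))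
    (hpD : (p : ℂ) ∈ D'.opn) (hre : ∀ z ∈ D.cl, p * z.re < 1)
    (hmaps : ∀ n : ℕ, 1 ≤ n → MapsInto (h q k ^ n)⁻¹ D.cl D'.opn) :
    ∃ L : ℂ → (HolSpace D' V →L[ℂ] HolSpace D V),
      HasSimplePoles (Module.finrank ℂ
        (LinearMap.ker ((etaH η k).toLinearEquiv.toLinearMap - LinearMap.id))) L ∧
      ∀ s : ℂ, 1 / 2 < s.re → IsNuclearOfOrderZero (L s) ∧
        ∀ (f : HolSpace D' V) (z : D.cl), HasSum (seriesTerm η s k f z) ((L s f).1 z) := by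
  have hl := one_le_lam hq
  have hl0 : (lam q : ℂ) ≠ 0 := by exact_mod_cast (by linarith : lam q ≠ 0)
  have hpp : p * p = 1 := by rcases hp with rfl | rfl <;> norm_num
  have hy : ∀ z ∈ D.cl, 0 < (1 - (p : ℂ) * z).re := by
    intro z hz
    have := hre z hz
    simp
    linarith
  have hy0 : ∀ z ∈ D.cl, 1 - (p : ℂ) * z ≠ 0 := fun z hz => ne_zero_of_re_pos (hy z hz)
  -- The scale `2 / lam q` normalizes the translation length `lam q / 2` of the generator to `1`.
  set u : ℂ → ℂ := fun z => ((2 / lam q : ℝ) : ℂ) * (1 - (p : ℂ) * z)⁻¹ with hu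
  have huh : IsHol D u :=
    (((isHol_const (1 : ℂ)).sub ((isHol_id).const_mul _)).inv hy0).const_mul _
  have hure : ∀ z ∈ D.cl, 0 < (u z).re := by
    intro z hz
    rw [hu]
    simp only
    rw [re_ofReal_mul, inv_re]
    have h1 := hy z hz
    have h2 := normSq_pos.2 (hy0 z hz)
    positivity
  have hden : ∀ (n : ℕ), ∀ z ∈ D.cl, 1 + ((n * (lam q / 2) : ℝ) : ℂ) * (1 - (p : ℂ) * z) ≠ 0 := by
    intro n z hz
    refine ne_zero_of_re_pos ?_
    rw [add_re, re_ofReal_mul, one_re]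
    have h1 := hy z hz
    positivity
  have hnu : ∀ (n : ℕ), ∀ z ∈ D.cl,
      (n : ℂ) + u z = (1 + ((n * (lam q / 2) : ℝ) : ℂ) * (1 - (p : ℂ) * z)) * u z := by
    intro n z hz
    have h1 := hy0 z hz
    rw [hu]
    push_cast
    field_simp
    ring
  have hXn : ∀ n : ℕ, (((h q k ^ n)⁻¹ : SL(2, ℝ)) : Matrix (Fin 2) (Fin 2) ℝ) =
      σ ^ n • parabolicMatrix p (n * (lam q / 2)) := by
    intro n
    rw [← inv_pow]
    exact coe_parabolic_pow hpp hX n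
  have hσn : ∀ n : ℕ, σ ^ n = 1 ∨ σ ^ n = -1 := by
    intro n
    rcases hσ with rfl | rfl
    · simp
    · exact neg_one_pow_eq_or ℝ n
  have hγ : ∀ (n : ℕ), ∀ z ∈ D.cl,
      (p : ℂ) + ((-(2 * p / lam q) : ℝ) : ℂ) / (n + u z) = moebius (h q k ^ n)⁻¹ z := by
    intro n z hz
    have h1 := hy0 z hz
    have h2 := hden n z hz
    have h3 : σ ^ n ≠ 0 := by rcases hσn n with h | h <;> rw [h] <;> norm_num
    rw [moebius_parabolic hpp h3 h2 (hXn n), hnu n z hz, hu]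
    generalize 1 + ((n * (lam q / 2) : ℝ) : ℂ) * (1 - (p : ℂ) * z) = w at h2 ⊢
    simp only
    generalize 1 - (p : ℂ) * z = y at h1 ⊢
    push_cast
    field_simp
    ring
  obtain ⟨L, hL, hLs⟩ := exists_parabolic_block (D := D) hpD huh hure
    (c := ((-(2 * p / lam q) : ℝ) : ℂ)) (fun n hn z hz => by
      simp only
      rw [hγ n z hz]
      exact (hmaps n hn z hz).2) (etaH η k)
  refine ⟨L, hL, fun s hs => ⟨(hLs s hs).1, fun f z => ?_⟩⟩
  convert (hLs s hs).2 f z using 1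
  funext n
  have hz := z.2
  have hu0 : u z ≠ 0 := ne_zero_of_re_pos (hure z hz)
  rw [seriesTerm, beta_eq, autFactor_parabolic (hσn _) (by positivity) (hXn _), hγ _ z hz,
    hnu _ z hz, mul_div_cancel_right₀ _ hu0]

/-- Positivity of three consecutive Chebyshev values keeps the pole off $[-1,1]$, so the
sign-normalized denominator is positive there, as required to fix the branch of the power. -/
theorem abs_h_inv_lt (hq : 3 ≤ q) {k : ℕ} (hk : k ∈ Finset.Icc 2 (q - 2)) :
    |(h q k)⁻¹ 1 0| < |(h q k)⁻¹ 1 1| := by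
  rw [Finset.mem_Icc] at hk
  have hk2 : (2 : ℝ) ≤ k := by exact_mod_cast hk.1
  have hkq : (k : ℝ) + 2 ≤ q := by exact_mod_cast (by omega : k + 2 ≤ q)
  have hU0 := chebU_pos hq (x := k) (by linarith) (by linarith)
  have hUm := chebU_pos hq (x := (k : ℝ) - 1) (by linarith) (by linarith)
  have hUp := chebU_pos hq (x := (k : ℝ) + 1) (by linarith) (by linarith)
  have e0 : (h q k)⁻¹ 1 0 = (-1) ^ k * -((chebU q (k + 1) - chebU q (k - 1)) / 2) := by
    simp [coe_h_inv hq k]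
  have e1 : (h q k)⁻¹ 1 1 = (-1) ^ k * (chebU q k + (chebU q (k + 1) + chebU q (k - 1)) / 2) := by
    simp [coe_h_inv hq k]
  rw [e0, e1, abs_mul, abs_mul, abs_neg_one_pow, one_mul, one_mul, abs_lt]
  rw [abs_of_pos (by positivity)]
  constructor <;> linarith

/-- The finite block `∑ₖ β_s(h_k)`. -/
theorem exists_finite_block (hq : 3 ≤ q) (η : conjGroup q →* (V ≃ₗᵢ[ℂ] V))
    (hmaps : ∀ k ∈ Finset.Icc 2 (q - 2), MapsInto (h q k)⁻¹ D.cl D'.opn)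
    (hx : ∀ k ∈ Finset.Icc 2 (q - 2), ∃ x₀ : ℝ, |x₀| ≤ 1 ∧ (x₀ : ℂ) ∈ D.cl) :
    ∃ L : ℂ → (HolSpace D' V →L[ℂ] HolSpace D V), HasSimplePoles 0 L ∧
      ∀ s : ℂ, IsNuclearOfOrderZero (L s) ∧
        ∀ (f : HolSpace D' V) (z : D.cl), (L s f).1 z = finPart η s f z := by
  have : CompleteSpace V := FiniteDimensional.complete ℂ V
  have hblock : ∀ k : ℕ, ∃ L : ℂ → (HolSpace D' V →L[ℂ] HolSpace D V),
      k ∈ Finset.Icc 2 (q - 2) → HasSimplePoles 0 L ∧ ∀ s : ℂ, IsNuclearOfOrderZero (L s) ∧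
        ∀ (f : HolSpace D' V) (z : D.cl), (L s f).1 z = beta η s k 1 (ext0 f.1) z := by
    intro k
    by_cases hk : k ∈ Finset.Icc 2 (q - 2)
    swap
    · exact ⟨0, fun h => absurd h hk⟩
    obtain ⟨x₀, hx₀, hxD⟩ := hx k hk
    have hslit : ∀ z ∈ D.cl, (Real.sign ((h q k)⁻¹ 1 1) : ℂ) * den (h q k)⁻¹ z ∈ slitPlane :=
      fun z hz => sign_mul_den_mem_slitPlane (hmaps k hk) (abs_h_inv_lt hq hk) hx₀ hxD hz
    have hlog : IsHol D (fun z =>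
        -2 * Complex.log ((Real.sign ((h q k)⁻¹ 1 1) : ℂ) * den (h q k)⁻¹ z)) :=
      (((isHol_den D _).const_mul _).clog hslit).const_mul _
    have hto : Set.MapsTo (moebius (h q k)⁻¹) D.cl D'.opn := fun z hz => (hmaps k hk z hz).2
    have hbr : IsBranch D D' (moebius (h q k)⁻¹) := .of_mapsTo (isHol_moebius (hmaps k hk)) hto
    let A : V →L[ℂ] V := (etaH η k).toContinuousLinearEquiv
    refine ⟨fun s => wcomp hbr A (hlog.exp_mul s), fun _ =>
      ⟨hasSimplePoles_of_analyticAt fun s => analyticAt_wcomp_exp hbr A hlog s,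
        fun s => ⟨isNuclearOfOrderZero_wcomp hbr hto A _, fun f z => ?_⟩⟩⟩
    rw [wcomp_apply, beta_eq, pow_one, pow_one, autFactor,
      cpow_def_of_ne_zero (slitPlane_ne_zero (hslit z z.2)), mul_left_comm, ← mul_assoc,
      mul_comm (-2 * s)]
    rfl
  choose L hL using hblock
  refine ⟨fun s => ∑ k ∈ Finset.Icc 2 (q - 2), L k s, ?_, fun s => ⟨?_, fun f z => ?_⟩⟩
  · simpa using HasSimplePoles.sum (Finset.Icc 2 (q - 2)) (r := fun _ => 0)
      fun k hk => (hL k hk).1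
  · exact IsNuclearOfOrderZero.sum _ fun k hk => ((hL k hk).2 s).1
  · rw [finPart, ← evalAt_apply, sum_apply, map_sum]
    exact Finset.sum_congr rfl fun k hk => ((hL k hk).2 s).2 f z

end Blocks

/-! ### The fast transfer operator -/

section BlockOperator

variable {X Y Z : Type*} [NormedAddCommGroup X] [NormedSpace ℂ X] [NormedAddCommGroup Y]
  [NormedSpace ℂ Y] [NormedAddCommGroup Z] [NormedSpace ℂ Z]

/-- The operator on `X ⊕ Y ⊕ Z` with the rows `(0, a, b)`, `(c, d, e)`, `(g, k, 0)`. -/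
def blockOp (a : Y →L[ℂ] X) (b : Z →L[ℂ] X) (c : X →L[ℂ] Y) (d : Y →L[ℂ] Y) (e : Z →L[ℂ] Y)
    (g : X →L[ℂ] Z) (k : Y →L[ℂ] Z) : X × Y × Z →L[ℂ] X × Y × Z :=
  let i₁ : X →L[ℂ] X × Y × Z := .inl ℂ X (Y × Z)
  let i₂ : Y →L[ℂ] X × Y × Z := .comp (.inr ℂ X (Y × Z)) (.inl ℂ Y Z)
  let i₃ : Z →L[ℂ] X × Y × Z := .comp (.inr ℂ X (Y × Z)) (.inr ℂ Y Z)
  let p₁ : X × Y × Z →L[ℂ] X := .fst ℂ X (Y × Z)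
  let p₂ : X × Y × Z →L[ℂ] Y := .comp (.fst ℂ Y Z) (.snd ℂ X (Y × Z))
  let p₃ : X × Y × Z →L[ℂ] Z := .comp (.snd ℂ Y Z) (.snd ℂ X (Y × Z))
  i₁ ∘L a ∘L p₂ + i₁ ∘L b ∘L p₃ + i₂ ∘L c ∘L p₁ + i₂ ∘L d ∘L p₂ + i₂ ∘L e ∘L p₃ +
    i₃ ∘L g ∘L p₁ + i₃ ∘L k ∘L p₂

theorem blockOp_apply (a : Y →L[ℂ] X) (b : Z →L[ℂ] X) (c : X →L[ℂ] Y) (d : Y →L[ℂ] Y)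
    (e : Z →L[ℂ] Y) (g : X →L[ℂ] Z) (k : Y →L[ℂ] Z) (f : X × Y × Z) :
    blockOp a b c d e g k f = (a f.2.1 + b f.2.2, c f.1 + d f.2.1 + e f.2.2, g f.1 + k f.2.1) := by
  simp [blockOp]

theorem HasSimplePoles.blockOp {ra rb rc rd re rg rk : ℕ} {a : ℂ → Y →L[ℂ] X}
    {b : ℂ → Z →L[ℂ] X} {c : ℂ → X →L[ℂ] Y} {d : ℂ → Y →L[ℂ] Y} {e : ℂ → Z →L[ℂ] Y}
    {g : ℂ → X →L[ℂ] Z} {k : ℂ → Y →L[ℂ] Z} (ha : HasSimplePoles ra a) (hb : HasSimplePoles rb b)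
    (hc : HasSimplePoles rc c) (hd : HasSimplePoles rd d) (he : HasSimplePoles re e)
    (hg : HasSimplePoles rg g) (hk : HasSimplePoles rk k) :
    HasSimplePoles (ra + rb + rc + rd + re + rg + rk)
      (fun s => blockOp (a s) (b s) (c s) (d s) (e s) (g s) (k s)) :=
  (((((((ha.comp_const _ _).add (hb.comp_const _ _)).add (hc.comp_const _ _)).add
    (hd.comp_const _ _)).add (he.comp_const _ _)).add (hg.comp_const _ _)).add
    (hk.comp_const _ _))

theorem IsNuclearOfOrderZero.blockOp {a : Y →L[ℂ] X} {b : Z →L[ℂ] X} {c : X →L[ℂ] Y}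
    {d : Y →L[ℂ] Y} {e : Z →L[ℂ] Y} {g : X →L[ℂ] Z} {k : Y →L[ℂ] Z}
    (ha : IsNuclearOfOrderZero a) (hb : IsNuclearOfOrderZero b) (hc : IsNuclearOfOrderZero c)
    (hd : IsNuclearOfOrderZero d) (he : IsNuclearOfOrderZero e) (hg : IsNuclearOfOrderZero g)
    (hk : IsNuclearOfOrderZero k) : IsNuclearOfOrderZero (blockOp a b c d e g k) :=
  (((((((ha.comp _ _).add (hb.comp _ _)).add (hc.comp _ _)).add (hd.comp _ _)).add
    (he.comp _ _)).add (hg.comp _ _)).add (hk.comp _ _))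

end BlockOperator

/-! ### Assembly of the fast transfer operator -/

section Operator

variable {q : ℕ} {V : Type*} [NormedAddCommGroup V] [InnerProductSpace ℂ V]
  [FiniteDimensional ℂ V] {E : DiscTriple}

theorem mem_closure_realInterval {a b x : ℝ} (hab : a < b) (hx : x ∈ Set.Icc a b) :
    (x : ℂ) ∈ closure (realInterval a b) := by
  have h1 := image_closure_subset_closure_image (s := Set.Ioo a b) Complex.continuous_ofReal
  rw [closure_Ioo hab.ne] at h1
  exact h1 ⟨x, hx, rfl⟩

theorem param_lt_one (hq : 3 ≤ q) : (lam q - 1) / (lam q + 1) < 1 := by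
  have := one_le_lam hq
  rw [div_lt_one (by linarith)]
  linarith

theorem one_mem_e1 (hq : 3 ≤ q) (hE : E.IsAdmissible q) : ((1 : ℝ) : ℂ) ∈ E.e1.opn :=
  hE.sub_e1 (mem_closure_realInterval (param_lt_one hq) ⟨(param_lt_one hq).le, le_rfl⟩)

theorem neg_one_mem_e2 (hq : 3 ≤ q) (hE : E.IsAdmissible q) : ((-1 : ℝ) : ℂ) ∈ E.e2.opn :=
  hE.sub_e2 (mem_closure_realInterval (neg_lt_neg (param_lt_one hq))
    ⟨le_rfl, (neg_lt_neg (param_lt_one hq)).le⟩)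

/-- For $q=3$ one has $\mu=0$ and the interval $E_r$ is empty, so `sub_er` gives no information;
$q\ge4$ makes $\mu>0$. -/
theorem zero_mem_er (hq : 4 ≤ q) (hE : E.IsAdmissible q) : ((0 : ℝ) : ℂ) ∈ E.er.opn := by
  have hl : 1 < lam q := by
    have hq' : (4 : ℝ) ≤ q := by exact_mod_cast hq
    have h : Real.cos (Real.pi / 3) < Real.cos (Real.pi / q) := by
      refine Real.cos_lt_cos_of_nonneg_of_le_pi (by positivity) (by linarith [Real.pi_pos]) ?_
      have := Real.pi_pos
      gcongr
      linarith
    rw [Real.cos_pi_div_three] at h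
    rw [lam]
    linarith
  have hμ : 0 < (lam q - 1) / (lam q + 1) := div_pos (by linarith) (by linarith)
  exact hE.sub_er (mem_closure_realInterval (by linarith) ⟨by linarith, hμ.le⟩)

theorem exists_transfer_family (hq : 3 ≤ q) (η : conjGroup q →* (V ≃ₗᵢ[ℂ] V))
    (hE : E.IsAdmissible q) :
    ∃ L : ℂ → (DirectSumSpace E V →L[ℂ] DirectSumSpace E V), HasSimplePoles (4 * sd η) L ∧
      ∀ s : ℂ, 1 / 2 < s.re → IsFastTransferOperator η E s (L s) ∧
        IsNuclearOfOrderZero (L s) := by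
  have h1 := one_mem_e1 hq hE
  have h2 := neg_one_mem_e2 hq hE
  obtain ⟨Q, hQ, hQs⟩ := exists_series_block hq η (D := E.er) (Or.inl rfl) (Or.inr rfl)
    (coe_h_one_inv hq) h1 (fun z hz => by linarith [(hE.re_er z hz).2])
    fun n hn => (hE.maps_1 n hn).1
  obtain ⟨Q', hQ', hQs'⟩ := exists_series_block hq η (D := E.e2) (Or.inl rfl) (Or.inr rfl)
    (coe_h_one_inv hq) h1 (fun z hz => by linarith [hE.re_e2 z hz])
    fun n hn => (hE.maps_1 n hn).2
  obtain ⟨P, hP, hPs⟩ := exists_series_block hq η (D := E.e1) (Or.inr rfl)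
    (neg_one_pow_eq_or ℝ _) (coe_h_pred_inv hq) h2 (fun z hz => by linarith [hE.re_e1 z hz])
    fun n hn => (hE.maps_2 n hn).1
  obtain ⟨P', hP', hPs'⟩ := exists_series_block hq η (D := E.er) (Or.inr rfl)
    (neg_one_pow_eq_or ℝ _) (coe_h_pred_inv hq) h2 (fun z hz => by linarith [(hE.re_er z hz).1])
    fun n hn => (hE.maps_2 n hn).2
  rw [finrank_ker_etaH_one η hq] at hQ hQ'
  rw [finrank_ker_etaH_pred η hq] at hP hP'
  obtain ⟨M₁, hM₁, hMs₁⟩ := exists_finite_block hq η (fun k hk => (hE.maps_k k hk).1)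
    fun _ _ => ⟨1, by simp, E.e1.opn_subset_cl h1⟩
  -- The base point `0` is needed only when some `k` with `2 ≤ k ≤ q - 2` exists, which already
  -- forces `q ≥ 4`.
  obtain ⟨M₂, hM₂, hMs₂⟩ := exists_finite_block hq η (fun k hk => (hE.maps_k k hk).2.1)
    fun k hk => ⟨0, by simp, E.er.opn_subset_cl (zero_mem_er (by
      rw [Finset.mem_Icc] at hk
      omega) hE)⟩
  obtain ⟨M₃, hM₃, hMs₃⟩ := exists_finite_block hq η (fun k hk => (hE.maps_k k hk).2.2)
    fun _ _ => ⟨-1, by simp, E.e2.opn_subset_cl h2⟩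
  -- The four parabolic entries `P`, `Q`, `P'`, `Q'` contribute residue rank at most `sd η` each;
  -- the finite blocks are entire.
  refine ⟨fun s => blockOp (M₁ s) (P s) (Q s) (M₂ s) (P' s) (Q' s) (M₃ s),
    (HasSimplePoles.blockOp hM₁ hP hQ hM₂ hP' hQ' hM₃).mono (by omega), fun s hs => ⟨⟨?_, ?_, ?_⟩,
      .blockOp (hMs₁ s).1 (hPs s hs).1 (hQs s hs).1 (hMs₂ s).1 (hPs' s hs).1 (hQs' s hs).1
        (hMs₃ s).1⟩⟩
  · intro f z
    have hs₁ := (hPs s hs).2 f.2.2 z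
    refine ⟨hs₁.summable, ?_⟩
    rw [hs₁.tsum_eq, ← (hMs₁ s).2 f.2.1 z, blockOp_apply]
    rfl
  · intro f z
    have hs₁ := (hQs s hs).2 f.1 z
    have hs₂ := (hPs' s hs).2 f.2.2 z
    refine ⟨hs₁.summable, hs₂.summable, ?_⟩
    rw [hs₁.tsum_eq, hs₂.tsum_eq, ← (hMs₂ s).2 f.2.1 z, blockOp_apply]
    rfl
  · intro f z
    have hs₁ := (hQs' s hs).2 f.1 z
    refine ⟨hs₁.summable, ?_⟩
    rw [hs₁.tsum_eq, ← (hMs₃ s).2 f.2.1 z, blockOp_apply]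
    rfl

end Operator

end

end HeckeTransfer

theorem mainTheorem2 (q : ℕ) (hq : 3 ≤ q)
    {V : Type*} [NormedAddCommGroup V] [InnerProductSpace ℂ V] [FiniteDimensional ℂ V]
    (η : HeckeTransfer.conjGroup q →* (V ≃ₗᵢ[ℂ] V)) :
    (∃ E : HeckeTransfer.DiscTriple, E.IsAdmissible q) ∧
    ∀ E : HeckeTransfer.DiscTriple, E.IsAdmissible q →
      ∃ L : ℂ → (HeckeTransfer.DirectSumSpace E V →L[ℂ] HeckeTransfer.DirectSumSpace E V),
        (∀ s : ℂ, 1 / 2 < s.re →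
          HeckeTransfer.IsFastTransferOperator η E s (L s) ∧
            HeckeTransfer.IsNuclearOfOrderZero (L s)) ∧
        (∀ s : ℂ, MeromorphicAt L s) ∧
        (∀ s : ℂ, 0 ≤ meromorphicOrderAt L s → AnalyticAt ℂ L s) ∧
        ∀ s₀ : ℂ, meromorphicOrderAt L s₀ < 0 →
          meromorphicOrderAt L s₀ = -1 ∧
          (∃ k : ℕ, s₀ = (1 - (k : ℂ)) / 2) ∧
          ∃ U : Set ℂ, IsOpen U ∧ s₀ ∈ U ∧
            ∃ A B : ℂ → (HeckeTransfer.DirectSumSpace E V →L[ℂ] HeckeTransfer.DirectSumSpace E V),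
              DifferentiableOn ℂ A U ∧ DifferentiableOn ℂ B U ∧
              (∀ s ∈ U, s ≠ s₀ → L s = (s - s₀)⁻¹ • A s + B s) ∧
              ∀ s ∈ U, LinearMap.rank (A s).toLinearMap ≤
                ((4 * HeckeTransfer.sd η : ℕ) : Cardinal) := by
  refine ⟨HeckeTransfer.exists_isAdmissible hq, fun E hE => ?_⟩
  have : CompleteSpace V := FiniteDimensional.complete ℂ V
  obtain ⟨L, hL, hLs⟩ := HeckeTransfer.exists_transfer_family hq η hE
  obtain ⟨L', hL', hmer, han, hpole⟩ := hL.exists_normalForm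
  refine ⟨L', fun s hs => ?_, hmer, han, hpole⟩
  -- The normal form can differ from the original family only at points `(1 - k) / 2`, none of which
  -- has real part above `1 / 2`.
  rw [hL' s fun k hk => ?_]
  · exact hLs s hs
  · have h1 : s.re = (1 - (k : ℝ)) / 2 := by
      have h2 : s = (((1 - (k : ℝ)) / 2 : ℝ) : ℂ) := by
        rw [hk]
        push_cast
        rfl
      rw [h2, Complex.ofReal_re]
    have : (0 : ℝ) ≤ k := k.cast_nonneg
    linarith
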